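/- **Theorem 2.2.** Let $M$ be a compact smooth manifold (without boundary) of real dimension $2n$, let $g$ be a smooth Riemannian metric on $M$ with Levi-Civita connection $\nabla$ and volume measure $dv$, and suppose that there is a smooth almost complex structure on $M$ compatible with $g$, that is, a smooth section $J_0$ of $\mathrm{End}(TM)$ with $J_0^2=-\mathrm{id}$ and $g(J_0\cdot,J_0\cdot)=g$. Let $W^{1,2}(M,\mathrm{End}(TM))$ be the completion of the space of smooth sections of $\mathrm{End}(TM)$ with respect to the norm $$\|S\|_{W^{1,2}}=\Big(\int_M(|S|^2+|\nabla S|^2)\,dv\Big)^{1/2},$$ and let $W^{1,2}(\mathcal J_g)$ be the set of the admissible almost complex structures, that is, of those $J\in W^{1,2}(M,\mathrm{End}(TM))$ such that $J^2=-\mathrm{id}$ and $g(J\cdot,J\cdot)=g$ almost everywhere on $M$. Put $E(J)=\int_M|\nabla J|^2\,dv$. Then: 1. There exists a minimizer of $E$ over $W^{1,2}(\mathcal J_g)$. 2. Every minimizer $J$ of $E$ over $W^{1,2}(\mathcal J_g)$ is a weak solution of $\Delta J-J\nabla_pJ\nabla_pJ=0$, in the sense that for every $T\in L^\infty(M,\mathrm{End}(TM))\cap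 W^{1,2}(M,\mathrm{End}(TM))$ both of the following integrals converge absolutely and $$\int_M\langle\nabla J,\nabla T\rangle\,dv+\int_M\langle J\nabla_pJ\nabla_pJ,T\rangle\,dv=0,$$ where $J\nabla_pJ\nabla_pJ=g^{pq}\,J\circ\nabla_pJ\circ\nabla_qJ$. 3. For every sequence $(J_i)_{i\ge 0}$ of minimizers of $E$ over $W^{1,2}(\mathcal J_g)$ there are a subsequence $(J_{k_i})$ and a minimizer $J$ of $E$ over $W^{1,2}(\mathcal J_g)$ such that $\|J_{k_i}-J\|_{W^{1,2}}\to 0$. -/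

import Mathlib

open MeasureTheory Filter Bundle Topology
open scoped Manifold ContDiff

noncomputable section

namespace AlmostHermitian

/-- The model space `ℝ^m`. -/
abbrev Model (m : ℕ) : Type := EuclideanSpace ℝ (Fin m)

/-- Smooth Riemannian metrics on an `m`-dimensional manifold `M`. -/
abbrev RMetric (m : ℕ) (M : Type*) [TopologicalSpace M] [ChartedSpace (Model m) M]
    [IsManifold (𝓡 m) ∞ M] :=
  ContMDiffRiemannianMetric (𝓡 m) ∞ (Model m) (fun x : M => TangentSpace (𝓡 m) x)

/-- Arbitrary (not necessarily continuous) sections of `End(TM)`. -/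
abbrev EndField (m : ℕ) (M : Type*) [TopologicalSpace M] [ChartedSpace (Model m) M] :=
  ∀ x : M, TangentSpace (𝓡 m) x →L[ℝ] TangentSpace (𝓡 m) x

/-- Arbitrary (not necessarily continuous) sections of `T^*M ⊗ End(TM)`; `A x v` is the value of
the endomorphism-valued one-form `A` on the tangent vector `v` at `x`. -/
abbrev GradField (m : ℕ) (M : Type*) [TopologicalSpace M] [ChartedSpace (Model m) M] :=
  ∀ x : M, TangentSpace (𝓡 m) x →L[ℝ] (TangentSpace (𝓡 m) x →L[ℝ] TangentSpace (𝓡 m) x)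

variable {m : ℕ} {M : Type*} [TopologicalSpace M] [ChartedSpace (Model m) M]
  [IsManifold (𝓡 m) ∞ M]

/-! ### Coordinates -/

/-- The `i`-th vector of the standard basis of `ℝ^m`. -/
def stdVec (m : ℕ) (i : Fin m) : Model m := EuclideanSpace.single i (1 : ℝ)

/-- The coordinate vector field `∂_i` of the chart around `p`, at a point `x` of its domain. -/
def coordVec (p : M) (i : Fin m) (x : M) : TangentSpace (𝓡 m) x :=
  (trivializationAt (Model m) (TangentSpace (𝓡 m)) p).symmL ℝ x (stdVec m i)

/-- The metric coefficients `g_{ij}` in the chart around `p`, as functions of the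
coordinates `y`. -/
def gram (g : RMetric m M) (p : M) (y : Model m) : Matrix (Fin m) (Fin m) ℝ :=
  Matrix.of fun i j =>
    g.inner ((extChartAt (𝓡 m) p).symm y)
      (coordVec p i ((extChartAt (𝓡 m) p).symm y)) (coordVec p j ((extChartAt (𝓡 m) p).symm y))

/-- The Christoffel symbols
`Γ^k_{ij} = ½ g^{kl} (∂_i g_{jl} + ∂_j g_{il} - ∂_l g_{ij})` of the Levi-Civita connection
in the chart around `p`. -/
def christoffel (g : RMetric m M) (p : M) (y : Model m) (i j k : Fin m) : ℝ :=
  (1 / 2 : ℝ) * ∑ l, (gram g p y)⁻¹ k l *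
    (fderiv ℝ (fun z => gram g p z j l) y (stdVec m i)
      + fderiv ℝ (fun z => gram g p z i l) y (stdVec m j)
      - fderiv ℝ (fun z => gram g p z i j) y (stdVec m l))

/-- The bilinear map `(v, w) ↦ Γ^k_{ij} v^i w^j e_k`. -/
def christoffelMap (g : RMetric m M) (p : M) (y : Model m) :
    Model m →L[ℝ] Model m →L[ℝ] Model m :=
  ∑ i, ∑ j, ∑ k, christoffel g p y i j k •
    ContinuousLinearMap.smulRight (EuclideanSpace.proj i : Model m →L[ℝ] ℝ)
      (ContinuousLinearMap.smulRight
        (EuclideanSpace.proj j : Model m →L[ℝ] ℝ) (stdVec m k))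

/-- The matrix `S_j^k` (as an endomorphism of `ℝ^m`) of the endomorphism `S x` of `T_xM` in the
chart around `p`, for `x` in the domain of that chart. -/
def coordEnd (p x : M) (S : TangentSpace (𝓡 m) x →L[ℝ] TangentSpace (𝓡 m) x) :
    Model m →L[ℝ] Model m :=
  ContinuousLinearMap.inCoordinates (Model m) (TangentSpace (𝓡 m) : M → Type _)
    (Model m) (TangentSpace (𝓡 m) : M → Type _) p x p x S

/-- The coordinate expression `y ↦ S_j^k(y)` of a section of `End(TM)` in the chart
around `p`. -/
def localEnd (p : M) (S : EndField m M) (y : Model m) : Model m →L[ℝ] Model m :=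
  coordEnd p ((extChartAt (𝓡 m) p).symm y) (S ((extChartAt (𝓡 m) p).symm y))

/-- The covariant derivative in the chart around `p`, at the point with coordinates `y`:
`(∇_i S)_j^k = ∂_i S_j^k + Γ^k_{il} S_j^l - Γ^l_{ij} S_l^k`,
that is `∇_v S = ∂_v S + Γ(v) ∘ S - S ∘ Γ(v)`. -/
def localCovDeriv (g : RMetric m M) (p : M) (S : EndField m M) (y : Model m) :
    Model m →L[ℝ] (Model m →L[ℝ] Model m) :=
  fderiv ℝ (localEnd p S) y
    + ((ContinuousLinearMap.compL ℝ (Model m) (Model m) (Model m)).flip (localEnd p S y)).comp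
        (christoffelMap g p y)
    - ((ContinuousLinearMap.compL ℝ (Model m) (Model m) (Model m)) (localEnd p S y)).comp
        (christoffelMap g p y)

/-- The Levi-Civita covariant derivative `∇S` of a (smooth) section of `End(TM)`. Its value at `x`
is computed in the preferred chart around `x`; the tangent space `T_xM` is by definition `ℝ^m`, a
vector being identified with its components in that same chart. -/
def covDeriv (g : RMetric m M) (S : EndField m M) : GradField m M := fun x =>
  (localCovDeriv g x S (extChartAt (𝓡 m) x x) :
    Model m →L[ℝ] (Model m →L[ℝ] Model m))

/-- Smoothness of a section of `End(TM)`. -/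
def IsSmooth (S : EndField m M) : Prop :=
  ContMDiff (𝓡 m) ((𝓡 m).prod 𝓘(ℝ, Model m →L[ℝ] Model m)) ∞
    (fun x => TotalSpace.mk' (Model m →L[ℝ] Model m)
      (E := fun x : M => TangentSpace (𝓡 m) x →L[ℝ] TangentSpace (𝓡 m) x) x (S x))

/-! ### Pointwise inner products, written in the preferred basis of `T_xM` -/

/-- The inverse metric `g^{ij}` at `x`, in the basis `∂_i` of the preferred chart around `x`. -/
def gInv (g : RMetric m M) (x : M) : Matrix (Fin m) (Fin m) ℝ :=
  (Matrix.of fun i j => g.inner x (coordVec x i x) (coordVec x j x))⁻¹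

/-- `⟨S, T⟩ = g^{ij} g_{kl} S_i^k T_j^l` for endomorphisms of `T_xM`. -/
def innerEnd (g : RMetric m M) (x : M)
    (S T : TangentSpace (𝓡 m) x →L[ℝ] TangentSpace (𝓡 m) x) : ℝ :=
  ∑ i, ∑ j, gInv g x i j * g.inner x (S (coordVec x i x)) (T (coordVec x j x))

/-- `⟨A, B⟩ = g^{pq} ⟨A_p, B_q⟩` for elements of `T_x^*M ⊗ End(T_xM)`. -/
def innerGrad (g : RMetric m M) (x : M)
    (A B : TangentSpace (𝓡 m) x →L[ℝ]
      (TangentSpace (𝓡 m) x →L[ℝ] TangentSpace (𝓡 m) x)) : ℝ :=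
  ∑ p, ∑ q, gInv g x p q * innerEnd g x (A (coordVec x p x)) (B (coordVec x q x))

/-- The endomorphism `J ∇_pJ ∇_pJ = g^{pq} J ∘ A_p ∘ A_q` of `T_xM`, where `A = ∇J`. -/
def quadTerm (g : RMetric m M) (x : M)
    (J : TangentSpace (𝓡 m) x →L[ℝ] TangentSpace (𝓡 m) x)
    (A : TangentSpace (𝓡 m) x →L[ℝ]
      (TangentSpace (𝓡 m) x →L[ℝ] TangentSpace (𝓡 m) x)) :
    TangentSpace (𝓡 m) x →L[ℝ] TangentSpace (𝓡 m) x :=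
  ∑ p, ∑ q, gInv g x p q • (J.comp ((A (coordVec x p x)).comp (A (coordVec x q x))))

/-- The conditions `J_x² = -id` and `g(J_x v, J_x w) = g(v, w)` at the point `x`. -/
def CompatibleAt (g : RMetric m M) (J : EndField m M) (x : M) : Prop :=
  (∀ v, J x (J x v) = -v) ∧ ∀ v w, g.inner x (J x v) (J x w) = g.inner x v w

/-- Smooth almost complex structures compatible with `g`. -/
def IsCompatibleACS (g : RMetric m M) (J : EndField m M) : Prop :=
  IsSmooth J ∧ ∀ x, CompatibleAt g J x

/-! ### The Riemannian volume -/

variable [T2Space M] [CompactSpace M] [MeasurableSpace M] [BorelSpace M]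

/-- A smooth partition of unity subordinate to the domains of the charts. -/
def chartPartition (m : ℕ) (M : Type*) [TopologicalSpace M] [ChartedSpace (Model m) M]
    [IsManifold (𝓡 m) ∞ M] [T2Space M] [CompactSpace M] :
    SmoothPartitionOfUnity M (𝓡 m) M Set.univ :=
  (SmoothPartitionOfUnity.exists_isSubordinate_chartAt_source (𝓡 m) M).choose

/-- The measure `√det(g_{ij}) dy` on the domain of the chart around `p`, as a measure on `M`. -/
def chartVolume (g : RMetric m M) (p : M) : Measure M :=
  Measure.map (extChartAt (𝓡 m) p).symm
    ((volume.restrict (extChartAt (𝓡 m) p).target).withDensity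
      fun y => ENNReal.ofReal (Real.sqrt (gram g p y).det))

/-- The Riemannian volume measure `dv` of `g`, glued from the charts with a partition of
unity. -/
def vol (g : RMetric m M) : Measure M :=
  Measure.sum fun p : M =>
    (chartVolume g p).withDensity fun x => ENNReal.ofReal (chartPartition m M p x)

/-! ### The Sobolev space `W^{1,2}(M, End(TM))` -/

/-- Measurability (up to null sets) of a section of `End(TM)`: in each chart, its coefficients
are measurable. -/
def MeasEnd (g : RMetric m M) (S : EndField m M) : Prop :=
  ∀ p : M, AEStronglyMeasurable (fun x => coordEnd p x (S x))
    ((vol g).restrict (chartAt (Model m) p).source)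

/-- Measurability (up to null sets) of a section of `T^*M ⊗ End(TM)`. -/
def MeasGrad (g : RMetric m M) (A : GradField m M) : Prop :=
  ∀ (p : M) (i : Fin m), AEStronglyMeasurable (fun x => coordEnd p x (A x (coordVec p i x)))
    ((vol g).restrict (chartAt (Model m) p).source)

/-- `A` is the (generalized) covariant derivative of `S`: there are smooth sections `S_k` with
`S_k → S` and `∇S_k → A` in `L²`. So the pairs `(S, A)` are the elements of the closure, in
`L² × L²`, of the set of the pairs `(S, ∇S)` with `S` smooth, which is the completion of the
space of smooth sections for the `W^{1,2}` norm. -/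
def IsSobolevGrad (g : RMetric m M) (S : EndField m M) (A : GradField m M) : Prop :=
  MeasEnd g S ∧ MeasGrad g A ∧
    ∃ Sₖ : ℕ → EndField m M, (∀ k, IsSmooth (Sₖ k)) ∧
      Tendsto (fun k => ∫⁻ x, ENNReal.ofReal (innerEnd g x (Sₖ k x - S x) (Sₖ k x - S x)) ∂vol g)
        atTop (𝓝 0) ∧
      Tendsto (fun k => ∫⁻ x, ENNReal.ofReal
          (innerGrad g x (covDeriv g (Sₖ k) x - A x) (covDeriv g (Sₖ k) x - A x)) ∂vol g)
        atTop (𝓝 0)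

/-- Membership in `W^{1,2}(M, End(TM))`, the completion of the smooth sections for the `W^{1,2}`
norm (realized as sections, up to equality almost everywhere). -/
def MemW12 (g : RMetric m M) (S : EndField m M) : Prop :=
  ∃ A : GradField m M, IsSobolevGrad g S A

open Classical in
/-- The covariant derivative `∇S` (unique up to null sets) of `S ∈ W^{1,2}(M, End(TM))`. -/
def weakGrad (g : RMetric m M) (S : EndField m M) : GradField m M :=
  if h : MemW12 g S then h.choose else 0

/-- The norm `‖S‖_{W^{1,2}} = (∫_M |S|² + |∇S|² dv)^{1/2}` of `S ∈ W^{1,2}(M, End(TM))`. -/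
def normW12 (g : RMetric m M) (S : EndField m M) : ℝ :=
  Real.sqrt (∫ x, (innerEnd g x (S x) (S x)
    + innerGrad g x (weakGrad g S x) (weakGrad g S x)) ∂vol g)

/-- Membership in `L^∞(M, End(TM))`. -/
def MemLinfty (g : RMetric m M) (T : EndField m M) : Prop :=
  MeasEnd g T ∧ ∃ C : ℝ, ∀ᵐ x ∂vol g, innerEnd g x (T x) (T x) ≤ C

/-! ### Admissible almost complex structures and their energy -/

/-- The admissible almost complex structures, that is the elements of `W^{1,2}(𝒥_g)`. -/
def IsAdmissible (g : RMetric m M) (J : EndField m M) : Prop :=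
  MemW12 g J ∧ ∀ᵐ x ∂vol g, CompatibleAt g J x

/-- The energy `E(J) = ∫_M |∇J|² dv`. -/
def energy (g : RMetric m M) (J : EndField m M) : ℝ :=
  ∫ x, innerGrad g x (weakGrad g J x) (weakGrad g J x) ∂vol g

/-- `J` minimizes the energy over `W^{1,2}(𝒥_g)`. -/
def IsEnergyMinimizer (g : RMetric m M) (J : EndField m M) : Prop :=
  IsAdmissible g J ∧ ∀ K : EndField m M, IsAdmissible g K → energy g J ≤ energy g K

/-- `J` is a weak solution of `ΔJ - J ∇_pJ ∇_pJ = 0`: for all `T ∈ L^∞ ∩ W^{1,2}`,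
`∫ ⟨∇J, ∇T⟩ dv + ∫ ⟨J ∇_pJ ∇_pJ, T⟩ dv = 0`, where both integrals converge absolutely. -/
def IsWeaklyHarmonic (g : RMetric m M) (J : EndField m M) : Prop :=
  ∀ T : EndField m M, MemLinfty g T → MemW12 g T →
    Integrable (fun x => innerGrad g x (weakGrad g J x) (weakGrad g T x)) (vol g) ∧
    Integrable (fun x => innerEnd g x (quadTerm g x (J x) (weakGrad g J x)) (T x)) (vol g) ∧
    (∫ x, innerGrad g x (weakGrad g J x) (weakGrad g T x) ∂vol g)
      + (∫ x, innerEnd g x (quadTerm g x (J x) (weakGrad g J x)) (T x) ∂vol g) = 0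

end AlmostHermitian

end

/-!
The theorem is an instance of the direct method, made possible by the fact that almost complex
structures compatible with `g` are pointwise bounded.

*Frames and charts.* A measurable orthonormal frame `frame g` of the tangent bundle (Gram–Schmidt in
finitely many charts) turns sections of `End(TM)` into functions with values in the fixed Euclidean
algebra `End(ℝ^m)`, where `|·|` is the Hilbert–Schmidt norm `hs`, the `g`-adjoint is the adjoint,
and the compatible structures are the `J` with `J^* = -J` and `J² = -1`. The pairs `(σ, ∇σ)`, with
`σ` smooth, satisfy the axioms of `IsJetAlgebra` (`isJetAlgebra_isSmoothJet`): the Leibniz rule for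
products, inverses, adjoints and trace functions, which rest on the metric and torsion-free
properties of the Christoffel symbols and on the independence of `∇` of the chart
(`coordEnd_covDeriv`); closability of `∇`, by integration by parts in charts; and Rellich's theorem.
In `ℝ^m` (`rellich_vector`), a bounded sequence supported in a fixed compact set has a weakly
convergent subsequence in `L²`, whose Fourier transforms converge pointwise, hence in `L²` of every
ball, while the bound on the derivatives controls the frequencies outside the ball; the partition of
unity transfers this to `M`. The elements of `W^{1,2}` are the members of the closure `MemClosure`
of these pairs in `L² × L²`.

*Compactness.* A sequence of admissible structures of bounded energy has a subsequence converging in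
`L²` and almost everywhere, so that the constraint `J^* = -J`, `J² = -1` passes to the limit `J`.
Suppose that the energies tend to their infimum. Limits of convex combinations of the gradients far
along the sequence are again gradients of `J`, so they have at least the infimum as energy. In a
Hilbert space this forces the gradients themselves to converge (`exists_tendsto_of_convexHull`), by
comparison with the elements of least norm in the closed convex hulls of the tails.
Hence a subsequence converges strongly in `W^{1,2}` (`IsJetAlgebra.exists_subseq_tendsto`), which
gives both the existence of minimizers and the compactness of the set of minimizers.

*Euler–Lagrange equation.* For a skew-symmetric field `B` in `W^{1,2}`, the Cayley transform
`C = (1 + tB)(1 - tB)⁻¹` is orthogonal, so that `C^* J C` is again admissible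
(`memStructures_cayley`); comparing energies to first order in `t` gives the first variation
(`first_variation_nonneg`). For a bounded `U` in `W^{1,2}`, it is applied to the skew-symmetric part
of `J U` and to its negative. Since `∇J` is skew-symmetric and anticommutes with `J` (`anticomm`),
the first variation becomes the weak equation (`IsJetAlgebra.euler_lagrange`), with absolutely
convergent integrals because `J` and `U` are bounded.
-/

open MeasureTheory Filter Bundle Topology
open scoped Manifold ContDiff

noncomputable section

set_option linter.unusedSectionVars false

namespace AlmostHermitian

section

/-! ### The Levi-Civita connection under a change of coordinates -/

section ChangeOfCoordinates

variable {E : Type*} [NormedAddCommGroup E] [NormedSpace ℝ E]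

/-- The Koszul formula: `Γ` is the connection form at `y` (in the coordinates of `E`) of the
Levi-Civita connection of the metric with coefficients `B`. -/
def IsKoszul (B : E → E →L[ℝ] E →L[ℝ] ℝ) (y : E) (Γ : E →L[ℝ] E →L[ℝ] E) : Prop :=
  ∀ u v w, B y (Γ u v) w
    = (1 / 2 : ℝ) * (fderiv ℝ B y u v w + fderiv ℝ B y v u w - fderiv ℝ B y w u v)

set_option synthInstance.maxHeartbeats 200000 in
set_option maxHeartbeats 1000000 in
/-- The Koszul formula has to be checked only on a spanning family. -/
lemma isKoszul_of_span {B : E → E →L[ℝ] E →L[ℝ] ℝ} {y : E} {Γ : E →L[ℝ] E →L[ℝ] E}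
    {ι : Type*} (b : ι → E) (hb : Submodule.span ℝ (Set.range b) = ⊤)
    (h : ∀ i j k, B y (Γ (b i) (b j)) (b k) = (1 / 2 : ℝ) * (fderiv ℝ B y (b i) (b j) (b k)
      + fderiv ℝ B y (b j) (b i) (b k) - fderiv ℝ B y (b k) (b i) (b j))) :
    IsKoszul B y Γ := by
  intro u v w
  generalize fderiv ℝ B y = D at h ⊢
  have hu : u ∈ Submodule.span ℝ (Set.range b) := hb ▸ Submodule.mem_top
  have hv : v ∈ Submodule.span ℝ (Set.range b) := hb ▸ Submodule.mem_top
  have hw : w ∈ Submodule.span ℝ (Set.range b) := hb ▸ Submodule.mem_top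
  induction hu using Submodule.span_induction with
  | zero => simp
  | add x z _ _ ha hb => simp only [map_add, add_apply, ha, hb]; ring
  | smul c x _ ha => simp only [map_smul, smul_apply, smul_eq_mul, ha]; ring
  | mem _ hx =>
  obtain ⟨i, rfl⟩ := hx
  induction hv using Submodule.span_induction with
  | zero => simp
  | add x z _ _ ha hb => simp only [map_add, add_apply, ha, hb]; ring
  | smul c x _ ha => simp only [map_smul, smul_apply, smul_eq_mul, ha]; ring
  | mem _ hx =>
  obtain ⟨j, rfl⟩ := hx
  induction hw using Submodule.span_induction with
  | zero => simp
  | add x z _ _ ha hb => simp only [map_add, add_apply, ha, hb]; ring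
  | smul c x _ ha => simp only [map_smul, smul_apply, smul_eq_mul, ha]; ring
  | mem _ hx =>
  obtain ⟨k, rfl⟩ := hx
  exact h i j k

/-- The Koszul formula makes the connection compatible with the metric. -/
lemma IsKoszul.compatible {B : E → E →L[ℝ] E →L[ℝ] ℝ} {y : E} {Γ : E →L[ℝ] E →L[ℝ] E}
    (h : IsKoszul B y Γ) (hB : DifferentiableAt ℝ B y)
    (hsymm : ∀ᶠ z in 𝓝 y, ∀ u v, B z u v = B z v u) (u v w : E) :
    fderiv ℝ B y u v w = B y (Γ u v) w + B y v (Γ u w) := by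
  have hd : ∀ a b c, fderiv ℝ B y a b c = fderiv ℝ B y a c b := by
    intro a b c
    have e1 : HasFDerivAt (fun z => B z b c) (((fderiv ℝ B y).flip b).flip c) y := by
      exact (hB.hasFDerivAt.clm_apply (hasFDerivAt_const b y)).clm_apply
        (hasFDerivAt_const c y) |>.congr_fderiv (by ext; simp)
    have e2 : HasFDerivAt (fun z => B z c b) (((fderiv ℝ B y).flip c).flip b) y := by
      exact (hB.hasFDerivAt.clm_apply (hasFDerivAt_const c y)).clm_apply
        (hasFDerivAt_const b y) |>.congr_fderiv (by ext; simp)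
    have e3 := (e2.congr_of_eventuallyEq (hsymm.mono fun z hz => hz b c)).unique e1
    exact (DFunLike.congr_fun e3 a).symm
  rw [hsymm.self_of_nhds v, h, h, hd u w v]
  ring

set_option synthInstance.maxHeartbeats 100000 in
lemma hasFDerivAt_pullback {B' : E → E →L[ℝ] E →L[ℝ] ℝ} {φ : E → E} {y : E}
    (hB' : DifferentiableAt ℝ B' (φ y)) (hφ : ContDiffAt ℝ 2 φ y) (v w : E) :
    HasFDerivAt (fun z => B' (φ z) (fderiv ℝ φ z v) (fderiv ℝ φ z w))
      ((((fderiv ℝ B' (φ y)).comp (fderiv ℝ φ y)).flip (fderiv ℝ φ y v)).flip (fderiv ℝ φ y w)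
        + ((B' (φ y)).comp ((fderiv ℝ (fderiv ℝ φ) y).flip v)).flip (fderiv ℝ φ y w)
        + (B' (φ y) (fderiv ℝ φ y v)).comp ((fderiv ℝ (fderiv ℝ φ) y).flip w)) y := by
  have h1 : HasFDerivAt φ (fderiv ℝ φ y) y := (hφ.differentiableAt (by norm_num)).hasFDerivAt
  have h2 : HasFDerivAt (fderiv ℝ φ) (fderiv ℝ (fderiv ℝ φ) y) y :=
    ((hφ.fderiv_right (m := 1) (by norm_num)).differentiableAt (by norm_num)).hasFDerivAt
  have h3 : HasFDerivAt (fun z => B' (φ z)) ((fderiv ℝ B' (φ y)).comp (fderiv ℝ φ y)) y :=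
    HasFDerivAt.comp (g := B') y hB'.hasFDerivAt h1
  have h4 := (h3.clm_apply (h2.clm_apply (hasFDerivAt_const v y))).clm_apply
    (h2.clm_apply (hasFDerivAt_const w y))
  refine h4.congr_fderiv ?_
  ext u
  simp
  ring

/-- The transformation law of the Christoffel symbols under a change of coordinates `φ`. -/
lemma IsKoszul.transform {B B' : E → E →L[ℝ] E →L[ℝ] ℝ} {φ : E → E} {y : E}
    {Γ Γ' : E →L[ℝ] E →L[ℝ] E} (h : IsKoszul B y Γ) (h' : IsKoszul B' (φ y) Γ')
    (hB : DifferentiableAt ℝ B y) (hB' : DifferentiableAt ℝ B' (φ y)) (hφ : ContDiffAt ℝ 2 φ y)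
    (hBφ : ∀ᶠ z in 𝓝 y, ∀ u v, B z u v = B' (φ z) (fderiv ℝ φ z u) (fderiv ℝ φ z v))
    (hsymm : ∀ u v, B' (φ y) u v = B' (φ y) v u)
    (hnd : ∀ u, (∀ v, B' (φ y) u v = 0) → u = 0)
    (hsurj : Function.Surjective (fderiv ℝ φ y)) (u v : E) :
    fderiv ℝ φ y (Γ u v)
      = Γ' (fderiv ℝ φ y u) (fderiv ℝ φ y v) + fderiv ℝ (fderiv ℝ φ) y u v := by
  have hD : ∀ a b c, fderiv ℝ B y a b c
      = fderiv ℝ B' (φ y) (fderiv ℝ φ y a) (fderiv ℝ φ y b) (fderiv ℝ φ y c)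
        + B' (φ y) (fderiv ℝ (fderiv ℝ φ) y a b) (fderiv ℝ φ y c)
        + B' (φ y) (fderiv ℝ φ y b) (fderiv ℝ (fderiv ℝ φ) y a c) := by
    intro a b c
    have e1 : HasFDerivAt (fun z => B z b c) (((fderiv ℝ B y).flip b).flip c) y := by
      exact (hB.hasFDerivAt.clm_apply (hasFDerivAt_const b y)).clm_apply
        (hasFDerivAt_const c y) |>.congr_fderiv (by ext; simp)
    have e2 := (hasFDerivAt_pullback hB' hφ b c).congr_of_eventuallyEq
      (hBφ.mono fun z hz => hz b c)
    have e3 := DFunLike.congr_fun (e1.unique e2) a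
    simpa using e3
  have hs : ∀ a b, fderiv ℝ (fderiv ℝ φ) y a b = fderiv ℝ (fderiv ℝ φ) y b a :=
    hφ.isSymmSndFDerivAt (by simp)
  rw [← sub_eq_zero]
  apply hnd
  intro w'
  obtain ⟨w, rfl⟩ := hsurj w'
  have k1 := h u v w
  have k2 := h' (fderiv ℝ φ y u) (fderiv ℝ φ y v) (fderiv ℝ φ y w)
  rw [hBφ.self_of_nhds, hD, hD, hD, hs v u, hs w u, hs w v] at k1
  rw [hsymm (fderiv ℝ (fderiv ℝ φ) y u w)] at k1
  simp only [map_sub, map_add, sub_apply, add_apply]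
  rw [k1, k2]
  ring

/-- The covariant derivative of an endomorphism field is independent of the coordinates. -/
lemma covariant_transform {φ : E → E} {y : E} {Γ Γ' : E →L[ℝ] E →L[ℝ] E}
    {S S' : E → E →L[ℝ] E} (hφ : ContDiffAt ℝ 2 φ y)
    (hΓ : ∀ u v, fderiv ℝ φ y (Γ u v)
      = Γ' (fderiv ℝ φ y u) (fderiv ℝ φ y v) + fderiv ℝ (fderiv ℝ φ) y u v)
    (hS : DifferentiableAt ℝ S y) (hS' : DifferentiableAt ℝ S' (φ y))
    (hSφ : ∀ᶠ z in 𝓝 y, ∀ v, S' (φ z) (fderiv ℝ φ z v) = fderiv ℝ φ z (S z v)) (u v : E) :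
    fderiv ℝ φ y (fderiv ℝ S y u v + Γ u (S y v) - S y (Γ u v))
      = fderiv ℝ S' (φ y) (fderiv ℝ φ y u) (fderiv ℝ φ y v)
        + Γ' (fderiv ℝ φ y u) (S' (φ y) (fderiv ℝ φ y v))
        - S' (φ y) (Γ' (fderiv ℝ φ y u) (fderiv ℝ φ y v)) := by
  have h1 : HasFDerivAt φ (fderiv ℝ φ y) y := (hφ.differentiableAt (by norm_num)).hasFDerivAt
  have h2 : HasFDerivAt (fderiv ℝ φ) (fderiv ℝ (fderiv ℝ φ) y) y :=
    ((hφ.fderiv_right (m := 1) (by norm_num)).differentiableAt (by norm_num)).hasFDerivAt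
  have e1 := (hS'.hasFDerivAt.comp y h1).clm_apply (h2.clm_apply (hasFDerivAt_const v y))
  have e2 := h2.clm_apply (hS.hasFDerivAt.clm_apply (hasFDerivAt_const v y))
  have e3 := DFunLike.congr_fun ((e1.congr_of_eventuallyEq
    ((hSφ.mono fun z hz => (hz v).symm) : _ =ᶠ[𝓝 y] _)).unique e2) u
  simp at e3
  have e0 := hSφ.self_of_nhds
  simp only [map_sub, map_add, hΓ, e0]
  have : fderiv ℝ φ y (fderiv ℝ S y u v) = fderiv ℝ S' (φ y) (fderiv ℝ φ y u) (fderiv ℝ φ y v)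
      + S' (φ y) (fderiv ℝ (fderiv ℝ φ) y u v) - fderiv ℝ (fderiv ℝ φ) y u (S y v) := by
    rw [← sub_eq_zero]
    rw [← sub_eq_zero] at e3
    rw [← neg_eq_zero, ← e3]
    abel
  have e4 := hΓ u v
  rw [this, ← e0 (Γ u v), e4, map_add]
  abel

end ChangeOfCoordinates

end

section

/-! ### Coordinates in the charts -/

section Coordinates

variable {m : ℕ} {M : Type*} [TopologicalSpace M] [ChartedSpace (Model m) M]
  [IsManifold (𝓡 m) ∞ M]

/-- The components of a tangent vector in the chart around `p`. -/
def toCoord (p x : M) : TangentSpace (𝓡 m) x →L[ℝ] Model m :=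
  (trivializationAt (Model m) (TangentSpace (𝓡 m)) p).continuousLinearMapAt ℝ x

/-- The tangent vector with given components in the chart around `p`. -/
def ofCoord (p x : M) : Model m →L[ℝ] TangentSpace (𝓡 m) x :=
  (trivializationAt (Model m) (TangentSpace (𝓡 m)) p).symmL ℝ x

lemma coordVec_eq (p : M) (i : Fin m) (x : M) : coordVec p i x = ofCoord p x (stdVec m i) := rfl

lemma coordEnd_apply (p x : M) (S : TangentSpace (𝓡 m) x →L[ℝ] TangentSpace (𝓡 m) x)
    (v : Model m) : coordEnd p x S v = toCoord p x (S (ofCoord p x v)) := rfl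

lemma toCoord_ofCoord {p x : M} (hx : x ∈ (chartAt (Model m) p).source) (v : Model m) :
    toCoord p x (ofCoord p x v) = v :=
  Bundle.Trivialization.continuousLinearMapAt_symmL _ (by simpa using hx) v

lemma ofCoord_toCoord {p x : M} (hx : x ∈ (chartAt (Model m) p).source)
    (v : TangentSpace (𝓡 m) x) : ofCoord p x (toCoord p x v) = v :=
  Bundle.Trivialization.symmL_continuousLinearMapAt _ (by simpa using hx) v

lemma ofCoord_eq {p x : M} (hx : x ∈ (chartAt (Model m) p).source) (v : Model m) :
    ofCoord p x v = tangentCoordChange (𝓡 m) p x x v := by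
  rw [ofCoord, TangentBundle.symmL_trivializationAt_eq_core hx]
  rfl

lemma ofCoord_self (x : M) (v : Model m) : ofCoord x x v = v := by
  rw [ofCoord_eq (mem_chart_source _ x), tangentCoordChange_self]
  simp

lemma toCoord_self (x : M) (v : TangentSpace (𝓡 m) x) : toCoord x x v = v := by
  conv_rhs => rw [← ofCoord_toCoord (mem_chart_source _ x) v, ofCoord_self]

lemma toCoord_eq {p x : M} (hx : x ∈ (chartAt (Model m) p).source) (v : TangentSpace (𝓡 m) x) :
    toCoord p x v = tangentCoordChange (𝓡 m) x p x v := by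
  rw [toCoord, TangentBundle.continuousLinearMapAt_trivializationAt_eq_core hx]
  rfl

lemma toCoord_ofCoord_eq {p q x : M} (hp : x ∈ (chartAt (Model m) p).source)
    (hq : x ∈ (chartAt (Model m) q).source) (v : Model m) :
    toCoord p x (ofCoord q x v) = tangentCoordChange (𝓡 m) q p x v := by
  rw [toCoord_eq hp, ofCoord_eq hq, tangentCoordChange_comp]
  simp [hp, hq]

/-- The transition map from the chart around `q` to the chart around `p`. -/
def transition (m : ℕ) {M : Type*} [TopologicalSpace M] [ChartedSpace (Model m) M] (q p : M) :
    Model m → Model m := extChartAt (𝓡 m) p ∘ (extChartAt (𝓡 m) q).symm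

lemma transition_apply {q x : M} (p : M) (hq : x ∈ (chartAt (Model m) q).source) :
    transition m q p (extChartAt (𝓡 m) q x) = extChartAt (𝓡 m) p x := by
  simp only [transition, Function.comp_apply]
  rw [(extChartAt (𝓡 m) q).left_inv (by simpa using hq)]

lemma contDiffAt_transition {p q x : M} (hp : x ∈ (chartAt (Model m) p).source)
    (hq : x ∈ (chartAt (Model m) q).source) :
    ContDiffAt ℝ ∞ (transition m q p) (extChartAt (𝓡 m) q x) := by
  have h := contDiffWithinAt_ext_coord_change (I := 𝓡 m) (n := ∞) p q (y := extChartAt (𝓡 m) q x)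
    (by simp [hp, hq])
  rw [ModelWithCorners.range_eq_univ, contDiffWithinAt_univ] at h
  exact h

lemma fderiv_transition {p q x : M} (hp : x ∈ (chartAt (Model m) p).source)
    (hq : x ∈ (chartAt (Model m) q).source) (v : Model m) :
    fderiv ℝ (transition m q p) (extChartAt (𝓡 m) q x) v = toCoord p x (ofCoord q x v) := by
  rw [toCoord_ofCoord_eq hp hq, tangentCoordChange_def]
  simp [fderivWithin_univ, transition]

/-- Near the coordinates of `x`, all points are coordinates of points near `x`. -/
lemma eventually_chart {p x : M} (hp : x ∈ (chartAt (Model m) p).source) {P : Model m → Prop}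
    (h : ∀ᶠ z in 𝓝 x, P (extChartAt (𝓡 m) p z)) : ∀ᶠ y in 𝓝 (extChartAt (𝓡 m) p x), P y := by
  have hp' : x ∈ (extChartAt (𝓡 m) p).source := by simpa using hp
  have h1 : ContinuousAt (extChartAt (𝓡 m) p).symm (extChartAt (𝓡 m) p x) :=
    continuousAt_extChartAt_symm' hp'
  have h2 := h1.eventually (p := fun z => P (extChartAt (𝓡 m) p z))
    (by rwa [(extChartAt (𝓡 m) p).left_inv hp'])
  filter_upwards [h2, (isOpen_extChartAt_target (I := 𝓡 m) p).mem_nhds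
    ((extChartAt (𝓡 m) p).map_source hp')] with y hy hy'
  rwa [(extChartAt (𝓡 m) p).right_inv hy'] at hy

lemma eventually_source {p x : M} (hp : x ∈ (chartAt (Model m) p).source) :
    ∀ᶠ z in 𝓝 x, z ∈ (chartAt (Model m) p).source :=
  (chartAt (Model m) p).open_source.mem_nhds hp

/-! ### The metric and endomorphism fields in coordinates -/

lemma localEnd_apply {p x : M} (hx : x ∈ (chartAt (Model m) p).source) (S : EndField m M) :
    localEnd p S (extChartAt (𝓡 m) p x) = coordEnd p x (S x) := by
  rw [localEnd, (extChartAt (𝓡 m) p).left_inv (by simpa using hx)]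

lemma gram_apply (g : RMetric m M) {p x : M} (hx : x ∈ (chartAt (Model m) p).source)
    (i j : Fin m) : gram g p (extChartAt (𝓡 m) p x) i j
      = g.inner x (ofCoord p x (stdVec m i)) (ofCoord p x (stdVec m j)) := by
  simp only [gram, Matrix.of_apply, coordVec_eq]
  rw [(extChartAt (𝓡 m) p).left_inv (by simpa using hx)]

/-- The metric in the chart around `p`, as a bilinear form depending on the coordinates. -/
def metricForm (g : RMetric m M) (p : M) (y : Model m) : Model m →L[ℝ] Model m →L[ℝ] ℝ :=
  ∑ i, ∑ j, gram g p y i j • ContinuousLinearMap.smulRight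
    (EuclideanSpace.proj i : Model m →L[ℝ] ℝ) (EuclideanSpace.proj j : Model m →L[ℝ] ℝ)

lemma metricForm_eq_sum (g : RMetric m M) (p : M) (y : Model m) (v w : Model m) :
    metricForm g p y v w = ∑ i, ∑ j, gram g p y i j * (v i * w j) := by
  simp [metricForm]

lemma sum_stdVec (v : Model m) : ∑ i, v i • stdVec m i = v := by
  ext j
  simp [stdVec, Pi.single_apply]

lemma metricForm_apply (g : RMetric m M) {p x : M} (hx : x ∈ (chartAt (Model m) p).source)
    (v w : Model m) : metricForm g p (extChartAt (𝓡 m) p x) v w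
      = g.inner x (ofCoord p x v) (ofCoord p x w) := by
  rw [metricForm_eq_sum]
  conv_rhs => rw [← sum_stdVec v, ← sum_stdVec w]
  simp only [map_sum, map_smul, gram_apply g hx, sum_apply,
    smul_apply, smul_eq_mul, Finset.mul_sum]
  rw [Finset.sum_comm]
  refine Finset.sum_congr rfl fun i _ => Finset.sum_congr rfl fun j _ => by ring

lemma metricForm_stdVec (g : RMetric m M) (p : M) (y : Model m) (i j : Fin m) :
    metricForm g p y (stdVec m i) (stdVec m j) = gram g p y i j := by
  simp [metricForm_eq_sum, stdVec]

lemma contMDiffOn_coordVec (p : M) (i : Fin m) :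
    ContMDiffOn (𝓡 m) ((𝓡 m).prod 𝓘(ℝ, Model m)) ∞
      (fun x => TotalSpace.mk' (Model m) (E := fun x : M => TangentSpace (𝓡 m) x) x
        (coordVec p i x)) (chartAt (Model m) p).source := by
  rw [(trivializationAt (Model m) (TangentSpace (𝓡 m)) p).contMDiffOn_iff
    (fun x hx => by simpa [Trivialization.mem_source] using hx)]
  refine ⟨contMDiffOn_id, (contMDiffOn_const (c := stdVec m i)).congr fun x hx => ?_⟩
  have h := toCoord_ofCoord hx (stdVec m i)
  rw [toCoord, Trivialization.continuousLinearMapAt_apply,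
    Trivialization.coe_linearMapAt_of_mem _ (by simpa using hx)] at h
  exact h

lemma contDiffOn_of_contMDiffOn {F : Type*} [NormedAddCommGroup F] [NormedSpace ℝ F] {p : M}
    {f : M → F} (hf : ContMDiffOn (𝓡 m) 𝓘(ℝ, F) ∞ f (chartAt (Model m) p).source) :
    ContDiffOn ℝ ∞ (fun y => f ((extChartAt (𝓡 m) p).symm y)) (extChartAt (𝓡 m) p).target := by
  rw [← contMDiffOn_iff_contDiffOn]
  refine hf.comp (contMDiffOn_extChartAt_symm p) fun y hy => ?_
  simpa using (extChartAt (𝓡 m) p).map_target hy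

lemma contDiffOn_gram (g : RMetric m M) (p : M) (i j : Fin m) :
    ContDiffOn ℝ ∞ (fun y => gram g p y i j) (extChartAt (𝓡 m) p).target := by
  refine contDiffOn_of_contMDiffOn (f := fun x => g.inner x (coordVec p i x) (coordVec p j x)) ?_
  have h := ContMDiffOn.clm_bundle_apply₂ (b := id) (F₃ := ℝ) (E₃ := fun _ => ℝ) (g.contMDiff.contMDiffOn)
    (contMDiffOn_coordVec p i) (contMDiffOn_coordVec p j)
  intro x hx
  have h1 := h x hx
  rw [contMDiffWithinAt_totalSpace] at h1
  exact h1.2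

lemma contDiffOn_localEnd {S : EndField m M} (hS : IsSmooth S) (p : M) :
    ContDiffOn ℝ ∞ (localEnd p S) (extChartAt (𝓡 m) p).target := by
  refine contDiffOn_of_contMDiffOn (f := fun x => coordEnd p x (S x)) ?_
  have h := ((trivializationAt (Model m →L[ℝ] Model m)
    (fun x : M => TangentSpace (𝓡 m) x →L[ℝ] TangentSpace (𝓡 m) x) p).contMDiffOn_iff
    (s := (chartAt (Model m) p).source) (IB := 𝓡 m) (n := ∞)
    (fun x hx => by simpa using hx)).1 (ContMDiff.contMDiffOn hS)
  exact h.2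

lemma isSmooth_of_contDiffOn {S : EndField m M}
    (hS : ∀ p, ContDiffOn ℝ ∞ (localEnd p S) (extChartAt (𝓡 m) p).target) : IsSmooth S := by
  intro p
  rw [contMDiffAt_hom_bundle]
  refine ⟨contMDiffAt_id, ?_⟩
  have h := (contMDiffOn_iff_contDiffOn.2 (hS p)).comp (contMDiffOn_extChartAt (x := p))
    (fun x hx => (extChartAt (𝓡 m) p).map_source (by simpa using hx))
  refine (h.contMDiffAt (eventually_source (mem_chart_source _ p))).congr_of_eventuallyEq ?_
  filter_upwards [eventually_source (mem_chart_source (Model m) p)] with x hx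
  exact (localEnd_apply hx S).symm

end Coordinates

end

section

/-! ### The Christoffel symbols and the covariant derivative in a chart -/

section Covariant

variable {m : ℕ} {M : Type*} [TopologicalSpace M] [ChartedSpace (Model m) M]
  [IsManifold (𝓡 m) ∞ M]

lemma span_stdVec : Submodule.span ℝ (Set.range (stdVec m)) = ⊤ := by
  refine eq_top_iff.2 fun v _ => ?_
  rw [← sum_stdVec v]
  exact Submodule.sum_mem _ fun i _ => Submodule.smul_mem _ _ (Submodule.subset_span ⟨i, rfl⟩)

lemma metricForm_symm (g : RMetric m M) {p : M} {y : Model m} (hy : y ∈ (extChartAt (𝓡 m) p).target)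
    (v w : Model m) : metricForm g p y v w = metricForm g p y w v := by
  have hx : (extChartAt (𝓡 m) p).symm y ∈ (chartAt (Model m) p).source := by
    simpa using (extChartAt (𝓡 m) p).map_target hy
  rw [← (extChartAt (𝓡 m) p).right_inv hy, metricForm_apply g hx, metricForm_apply g hx, g.symm]

lemma metricForm_pos (g : RMetric m M) {p : M} {y : Model m} (hy : y ∈ (extChartAt (𝓡 m) p).target)
    {v : Model m} (hv : v ≠ 0) : 0 < metricForm g p y v v := by
  have hx : (extChartAt (𝓡 m) p).symm y ∈ (chartAt (Model m) p).source := by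
    simpa using (extChartAt (𝓡 m) p).map_target hy
  rw [← (extChartAt (𝓡 m) p).right_inv hy, metricForm_apply g hx]
  refine g.pos _ _ fun h => hv ?_
  rw [← toCoord_ofCoord hx v, h, map_zero]

lemma gram_posDef (g : RMetric m M) {p : M} {y : Model m} (hy : y ∈ (extChartAt (𝓡 m) p).target) :
    (gram g p y).PosDef := by
  refine Matrix.PosDef.of_dotProduct_mulVec_pos ?_ fun v hv => ?_
  · ext i j
    simpa [metricForm_stdVec] using metricForm_symm g hy (stdVec m j) (stdVec m i)
  · have h := metricForm_pos g hy (v := WithLp.toLp 2 v) (by simpa using hv)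
    rw [metricForm_eq_sum] at h
    simp only [dotProduct, Matrix.mulVec, star_trivial, Finset.mul_sum]
    refine h.trans_eq (Finset.sum_congr rfl fun i _ => Finset.sum_congr rfl fun j _ => ?_)
    simp only
    ring

set_option synthInstance.maxHeartbeats 200000 in
lemma contDiffOn_metricForm (g : RMetric m M) (p : M) :
    ContDiffOn ℝ ∞ (metricForm g p) (extChartAt (𝓡 m) p).target := by
  refine ContDiffOn.sum fun i _ => ContDiffOn.sum fun j _ => ?_
  have h := ContinuousLinearMap.contDiff (n := ∞) (ContinuousLinearMap.toSpanSingleton ℝ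
    (ContinuousLinearMap.smulRight (EuclideanSpace.proj i : Model m →L[ℝ] ℝ)
      (EuclideanSpace.proj j : Model m →L[ℝ] ℝ)))
  exact h.comp_contDiffOn (contDiffOn_gram g p i j)

lemma differentiableAt_metricForm (g : RMetric m M) {p : M} {y : Model m}
    (hy : y ∈ (extChartAt (𝓡 m) p).target) : DifferentiableAt ℝ (metricForm g p) y :=
  ((contDiffOn_metricForm g p).contDiffAt ((isOpen_extChartAt_target p).mem_nhds hy)).differentiableAt
    (by simp)

lemma fderiv_metricForm_stdVec (g : RMetric m M) {p : M} {y : Model m}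
    (hy : y ∈ (extChartAt (𝓡 m) p).target) (u : Model m) (i j : Fin m) :
    fderiv ℝ (metricForm g p) y u (stdVec m i) (stdVec m j)
      = fderiv ℝ (fun z => gram g p z i j) y u := by
  have h := (differentiableAt_metricForm g hy).hasFDerivAt
  have h1 := (h.clm_apply (hasFDerivAt_const (stdVec m i) y)).clm_apply
    (hasFDerivAt_const (stdVec m j) y)
  simp only [metricForm_stdVec] at h1
  rw [h1.fderiv]
  simp

lemma christoffelMap_stdVec (g : RMetric m M) (p : M) (y : Model m) (i j : Fin m) :
    christoffelMap g p y (stdVec m i) (stdVec m j) = ∑ k, christoffel g p y i j k • stdVec m k := by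
  simp only [christoffelMap, sum_apply, smul_apply, ContinuousLinearMap.smulRight_apply]
  rw [Finset.sum_eq_single i, Finset.sum_eq_single j]
  · simp [stdVec]
  · intro b _ hb
    simp [stdVec, hb]
  · simp
  · intro b _ hb
    simp [stdVec, hb]
  · simp

/-- The Christoffel symbols satisfy the Koszul formula. -/
lemma isKoszul_christoffelMap (g : RMetric m M) {p : M} {y : Model m}
    (hy : y ∈ (extChartAt (𝓡 m) p).target) :
    IsKoszul (metricForm g p) y (christoffelMap g p y) := by
  have hdet : IsUnit (gram g p y).det := (gram_posDef g hy).det_pos.ne'.isUnit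
  refine isKoszul_of_span (stdVec m) span_stdVec fun i j l => ?_
  rw [christoffelMap_stdVec]
  simp only [map_sum, map_smul, sum_apply, smul_apply, metricForm_stdVec, smul_eq_mul,
    fderiv_metricForm_stdVec g hy, christoffel]
  set F : Fin m → ℝ := fun l => fderiv ℝ (fun z => gram g p z j l) y (stdVec m i)
      + fderiv ℝ (fun z => gram g p z i l) y (stdVec m j)
      - fderiv ℝ (fun z => gram g p z i j) y (stdVec m l) with hF
  have hsym : ∀ a b, gram g p y a b = gram g p y b a := fun a b => by
    rw [← metricForm_stdVec, ← metricForm_stdVec, metricForm_symm g hy]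
  have h1 : ∑ k, (∑ l', (gram g p y)⁻¹ k l' * F l') * gram g p y k l = F l := by
    have h2 := Matrix.mul_nonsing_inv (gram g p y) hdet
    calc ∑ k, (∑ l', (gram g p y)⁻¹ k l' * F l') * gram g p y k l
        = (gram g p y).mulVec ((gram g p y)⁻¹.mulVec F) l := by
          simp only [Matrix.mulVec, dotProduct]
          exact Finset.sum_congr rfl fun k _ => by rw [hsym k l, mul_comm]
      _ = F l := by rw [Matrix.mulVec_mulVec, h2, Matrix.one_mulVec]
  calc _ = (1 / 2 : ℝ) * ∑ k, (∑ l', (gram g p y)⁻¹ k l' * F l') * gram g p y k l := by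
        rw [Finset.mul_sum]
        exact Finset.sum_congr rfl fun k _ => by ring
    _ = _ := by rw [h1]

lemma localCovDeriv_apply (g : RMetric m M) (p : M) (S : EndField m M) (y u v : Model m) :
    localCovDeriv g p S y u v = fderiv ℝ (localEnd p S) y u v
      + christoffelMap g p y u (localEnd p S y v)
      - localEnd p S y (christoffelMap g p y u v) := by
  rfl

lemma differentiableAt_localEnd {S : EndField m M} (hS : IsSmooth S) {p : M} {y : Model m}
    (hy : y ∈ (extChartAt (𝓡 m) p).target) : DifferentiableAt ℝ (localEnd p S) y :=
  ((contDiffOn_localEnd hS p).contDiffAt ((isOpen_extChartAt_target p).mem_nhds hy)).differentiableAt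
    (by simp)

lemma mem_extChartAt_target {p x : M} (hp : x ∈ (chartAt (Model m) p).source) :
    extChartAt (𝓡 m) p x ∈ (extChartAt (𝓡 m) p).target :=
  (extChartAt (𝓡 m) p).map_source (by simpa using hp)

lemma covDeriv_apply (g : RMetric m M) (S : EndField m M) (x : M) (u v : TangentSpace (𝓡 m) x) :
    covDeriv g S x u v = ofCoord x x
      (localCovDeriv g x S (extChartAt (𝓡 m) x x) (toCoord x x u) (toCoord x x v)) := by
  rw [ofCoord_self, toCoord_self, toCoord_self]
  rfl

/-- The covariant derivative of a smooth section can be computed in any chart. -/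
lemma coordEnd_covDeriv (g : RMetric m M) {S : EndField m M} (hS : IsSmooth S) {p x : M}
    (hp : x ∈ (chartAt (Model m) p).source) (u v : Model m) :
    coordEnd p x (covDeriv g S x (ofCoord p x u)) v
      = localCovDeriv g p S (extChartAt (𝓡 m) p x) u v := by
  have hx := mem_chart_source (Model m) x
  have hφ := contDiffAt_transition hp hx
  have hφ2 : ContDiffAt ℝ 2 (transition m x p) (extChartAt (𝓡 m) x x) :=
    hφ.of_le (WithTop.coe_le_coe.2 le_top)
  have hφx := transition_apply (m := m) p hx
  have hnear : ∀ᶠ y in 𝓝 (extChartAt (𝓡 m) x x), ∃ z ∈ (chartAt (Model m) x).source,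
      z ∈ (chartAt (Model m) p).source ∧ extChartAt (𝓡 m) x z = y := by
    refine eventually_chart hx ?_
    filter_upwards [eventually_source hx, eventually_source hp] with z h1 h2
    exact ⟨z, h1, h2, rfl⟩
  have hΓ := (isKoszul_christoffelMap g (mem_extChartAt_target hx)).transform
    (φ := transition m x p) (B' := metricForm g p) (Γ' := christoffelMap g p (extChartAt (𝓡 m) p x))
    (by rw [hφx]; exact isKoszul_christoffelMap g (mem_extChartAt_target hp))
    (differentiableAt_metricForm g (mem_extChartAt_target hx))
    (by rw [hφx]; exact differentiableAt_metricForm g (mem_extChartAt_target hp))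
    hφ2
    (by
      filter_upwards [hnear]
      rintro _ ⟨z, h1, h2, rfl⟩ a b
      rw [fderiv_transition h2 h1, fderiv_transition h2 h1, transition_apply p h1,
        metricForm_apply g h1, metricForm_apply g h2, ofCoord_toCoord h2, ofCoord_toCoord h2])
    (by rw [hφx]; exact metricForm_symm g (mem_extChartAt_target hp))
    (by
      rw [hφx]
      intro a ha
      by_contra h
      exact (metricForm_pos g (mem_extChartAt_target hp) h).ne' (ha a))
    (fun w => ⟨toCoord x x (ofCoord p x w), by
      rw [fderiv_transition hp hx, ofCoord_toCoord hx, toCoord_ofCoord hp]⟩)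
  have h := covariant_transform (S := localEnd x S) (S' := localEnd p S) hφ2 hΓ
    (differentiableAt_localEnd hS (mem_extChartAt_target hx))
    (by rw [hφx]; exact differentiableAt_localEnd hS (mem_extChartAt_target hp))
    (by
      filter_upwards [hnear]
      rintro _ ⟨z, h1, h2, rfl⟩ a
      rw [fderiv_transition h2 h1, fderiv_transition h2 h1, transition_apply p h1,
        localEnd_apply h1, localEnd_apply h2, coordEnd_apply, coordEnd_apply, ofCoord_toCoord h2,
        ofCoord_toCoord h1]) (toCoord x x (ofCoord p x u)) (toCoord x x (ofCoord p x v))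
  rw [hφx] at h
  simp only [fderiv_transition hp hx, ofCoord_toCoord hx, toCoord_ofCoord hp] at h
  rw [coordEnd_apply, covDeriv_apply, localCovDeriv_apply, localCovDeriv_apply, ← h]

end Covariant

end

section

/-! ### Calculus rules for the covariant derivative -/

section LocalRules

variable {E : Type*} [NormedAddCommGroup E] [NormedSpace ℝ E]

/-- The covariant derivative `∇_u A = ∂_u A + [Γ(u), A]` in coordinates. -/
def covAt (Γ : E →L[ℝ] E →L[ℝ] E) (A : E → E →L[ℝ] E) (y u : E) : E →L[ℝ] E :=
  fderiv ℝ A y u + Γ u * A y - A y * Γ u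

variable {Γ : E →L[ℝ] E →L[ℝ] E} {A A' : E → E →L[ℝ] E} {y : E}

lemma covAt_congr (h : A =ᶠ[𝓝 y] A') (u : E) : covAt Γ A y u = covAt Γ A' y u := by
  rw [covAt, covAt, h.fderiv_eq, h.self_of_nhds]

lemma covAt_add (hA : DifferentiableAt ℝ A y) (hA' : DifferentiableAt ℝ A' y) (u : E) :
    covAt Γ (fun z => A z + A' z) y u = covAt Γ A y u + covAt Γ A' y u := by
  rw [covAt, fderiv_fun_add hA hA', covAt, covAt, add_apply, mul_add, add_mul]
  abel

lemma covAt_mul (hA : DifferentiableAt ℝ A y) (hA' : DifferentiableAt ℝ A' y) (u : E) :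
    covAt Γ (fun z => A z * A' z) y u = covAt Γ A y u * A' y + A y * covAt Γ A' y u := by
  have e : HasFDerivAt (fun z => A z * A' z) _ y := hA.hasFDerivAt.mul' hA'.hasFDerivAt
  rw [covAt, e.fderiv, covAt, covAt]
  simp only [add_apply, smul_apply, smul_eq_mul, MulOpposite.smul_eq_mul_unop,
    MulOpposite.unop_op]
  noncomm_ring

lemma covAt_const_one (u : E) : covAt Γ (fun _ => 1) y u = 0 := by
  simp [covAt]

lemma covAt_smul {f : E → ℝ} (hf : DifferentiableAt ℝ f y) (hA : DifferentiableAt ℝ A y) (u : E) :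
    covAt Γ (fun z => f z • A z) y u = fderiv ℝ f y u • A y + f y • covAt Γ A y u := by
  have e : HasFDerivAt (fun z => f z • A z) _ y := hf.hasFDerivAt.smul hA.hasFDerivAt
  rw [covAt, e.fderiv, covAt]
  simp only [add_apply, smul_apply, ContinuousLinearMap.smulRight_apply, smul_sub, smul_add,
    mul_smul_comm, smul_mul_assoc]
  abel

/-- A metric connection commutes with taking adjoints. -/
lemma covAt_adjoint {B : E → E →L[ℝ] E →L[ℝ] ℝ} (hB : DifferentiableAt ℝ B y)
    (hA : DifferentiableAt ℝ A y) (hA' : DifferentiableAt ℝ A' y)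
    (hc : ∀ u v w, fderiv ℝ B y u v w = B y (Γ u v) w + B y v (Γ u w))
    (hadj : ∀ᶠ z in 𝓝 y, ∀ v w, B z (A z v) w = B z v (A' z w)) (u v w : E) :
    B y (covAt Γ A y u v) w = B y v (covAt Γ A' y u w) := by
  have e1 := (hB.hasFDerivAt.clm_apply (hA.hasFDerivAt.clm_apply (hasFDerivAt_const v y))).clm_apply
    (hasFDerivAt_const w y)
  have e2 := (hB.hasFDerivAt.clm_apply (hasFDerivAt_const v y)).clm_apply
    (hA'.hasFDerivAt.clm_apply (hasFDerivAt_const w y))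
  have e3 := DFunLike.congr_fun ((e1.congr_of_eventuallyEq
    ((hadj.mono fun z hz => (hz v w).symm) : _ =ᶠ[𝓝 y] _)).unique e2) u
  simp at e3
  rw [hc, hc] at e3
  have e0 := hadj.self_of_nhds
  simp only [covAt, add_apply, sub_apply, map_add, map_sub, mul_apply_eq_comp, e0] at e3 ⊢
  linarith

/-- The commutator term of the covariant derivative is invisible to the trace. -/
lemma fderiv_trace (T : (E →L[ℝ] E) →L[ℝ] ℝ) (hT : ∀ X Y, T (X * Y) = T (Y * X))
    (hA : DifferentiableAt ℝ A y) (u : E) :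
    fderiv ℝ (fun z => T (A z)) y u = T (covAt Γ A y u) := by
  have h : HasFDerivAt (fun z => T (A z)) (T.comp (fderiv ℝ A y)) y :=
    T.hasFDerivAt.comp y hA.hasFDerivAt
  rw [h.fderiv, covAt, map_sub, map_add, hT]
  simp

end LocalRules

section SectionRules

variable {m : ℕ} {M : Type*} [TopologicalSpace M] [ChartedSpace (Model m) M]
  [IsManifold (𝓡 m) ∞ M]

lemma coordEnd_injective {p x : M} (hp : x ∈ (chartAt (Model m) p).source)
    {A B : TangentSpace (𝓡 m) x →L[ℝ] TangentSpace (𝓡 m) x} (h : coordEnd p x A = coordEnd p x B) :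
    A = B := by
  ext1 v
  have h1 := DFunLike.congr_fun h (toCoord p x v)
  rw [coordEnd_apply, coordEnd_apply, ofCoord_toCoord hp] at h1
  rw [← ofCoord_toCoord hp (A v), h1, ofCoord_toCoord hp]

lemma coordEnd_comp {p x : M} (hp : x ∈ (chartAt (Model m) p).source)
    (A B : TangentSpace (𝓡 m) x →L[ℝ] TangentSpace (𝓡 m) x) :
    coordEnd p x (A.comp B) = coordEnd p x A * coordEnd p x B := by
  ext1 v
  rw [mul_apply_eq_comp, coordEnd_apply, coordEnd_apply, coordEnd_apply,
    ofCoord_toCoord hp]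
  rfl

lemma coordEnd_id {p x : M} (hp : x ∈ (chartAt (Model m) p).source) :
    coordEnd p x (ContinuousLinearMap.id ℝ (TangentSpace (𝓡 m) x)) = 1 := by
  ext1 v
  rw [coordEnd_apply]
  exact toCoord_ofCoord hp v

lemma coordEnd_add (p x : M) (A B : TangentSpace (𝓡 m) x →L[ℝ] TangentSpace (𝓡 m) x) :
    coordEnd p x (A + B) = coordEnd p x A + coordEnd p x B := by
  ext1 v
  simp only [coordEnd_apply, add_apply, map_add]

lemma coordEnd_smul (p x : M) (c : ℝ) (A : TangentSpace (𝓡 m) x →L[ℝ] TangentSpace (𝓡 m) x) :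
    coordEnd p x (c • A) = c • coordEnd p x A := by
  ext1 v
  simp only [coordEnd_apply, smul_apply, map_smul]

/-- On the target of a chart, an identity between coordinate expressions holds if it holds
pointwise on the manifold. -/
lemma forall_target {p : M} {P : Model m → Prop}
    (h : ∀ x ∈ (chartAt (Model m) p).source, P (extChartAt (𝓡 m) p x)) :
    ∀ y ∈ (extChartAt (𝓡 m) p).target, P y := fun y hy => by
  rw [← (extChartAt (𝓡 m) p).right_inv hy]
  exact h _ (by simpa using (extChartAt (𝓡 m) p).map_target hy)

lemma eventually_target {p x : M} {P : Model m → Prop} (hp : x ∈ (chartAt (Model m) p).source)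
    (h : ∀ x ∈ (chartAt (Model m) p).source, P (extChartAt (𝓡 m) p x)) :
    ∀ᶠ y in 𝓝 (extChartAt (𝓡 m) p x), P y := by
  filter_upwards [(isOpen_extChartAt_target (I := 𝓡 m) p).mem_nhds (mem_extChartAt_target hp)]
  exact forall_target h

lemma coordEnd_covDeriv' (g : RMetric m M) {S : EndField m M} (hS : IsSmooth S) {p x : M}
    (hp : x ∈ (chartAt (Model m) p).source) (u : TangentSpace (𝓡 m) x) :
    coordEnd p x (covDeriv g S x u)
      = covAt (christoffelMap g p (extChartAt (𝓡 m) p x)) (localEnd p S) (extChartAt (𝓡 m) p x)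
        (toCoord p x u) := by
  ext1 v
  have h := coordEnd_covDeriv g hS hp (toCoord p x u) v
  rw [ofCoord_toCoord hp] at h
  rw [h, localCovDeriv_apply]
  rfl

variable {S T : EndField m M}

lemma IsSmooth.add (hS : IsSmooth S) (hT : IsSmooth T) : IsSmooth (S + T) :=
  isSmooth_of_contDiffOn fun p =>
    ((contDiffOn_localEnd hS p).add (contDiffOn_localEnd hT p)).congr
      (fun _ _ => coordEnd_add _ _ _ _)

lemma IsSmooth.const_smul (hS : IsSmooth S) (c : ℝ) : IsSmooth (c • S) :=
  isSmooth_of_contDiffOn fun p =>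
    ((contDiffOn_localEnd hS p).const_smul c).congr (fun _ _ => coordEnd_smul _ _ _ _)

lemma IsSmooth.comp (hS : IsSmooth S) (hT : IsSmooth T) : IsSmooth (fun x => (S x).comp (T x)) :=
  isSmooth_of_contDiffOn fun p =>
    ((contDiffOn_localEnd hS p).mul (contDiffOn_localEnd hT p)).congr
      (forall_target fun x hx => by
        rw [localEnd_apply hx, localEnd_apply hx, localEnd_apply hx, coordEnd_comp hx])

lemma isSmooth_id : IsSmooth (fun x : M => ContinuousLinearMap.id ℝ (TangentSpace (𝓡 m) x)) :=
  isSmooth_of_contDiffOn fun p => (contDiffOn_const (c := (1 : Model m →L[ℝ] Model m))).congr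
      (forall_target fun x hx => by rw [localEnd_apply hx, coordEnd_id hx])

lemma isSmooth_of_inverse (hS : IsSmooth S)
    (h1 : ∀ x, (S x).comp (T x) = ContinuousLinearMap.id ℝ _)
    (h2 : ∀ x, (T x).comp (S x) = ContinuousLinearMap.id ℝ _) : IsSmooth T := by
  refine isSmooth_of_contDiffOn fun p => ?_
  have key : ∀ y ∈ (extChartAt (𝓡 m) p).target, ∃ w : (Model m →L[ℝ] Model m)ˣ,
      (w : Model m →L[ℝ] Model m) = localEnd p S y
        ∧ ((w⁻¹ : (Model m →L[ℝ] Model m)ˣ) : Model m →L[ℝ] Model m) = localEnd p T y :=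
    forall_target fun x hx => ⟨⟨localEnd p S (extChartAt (𝓡 m) p x),
      localEnd p T (extChartAt (𝓡 m) p x),
      by rw [localEnd_apply hx, localEnd_apply hx, ← coordEnd_comp hx, h1, coordEnd_id hx],
      by rw [localEnd_apply hx, localEnd_apply hx, ← coordEnd_comp hx, h2, coordEnd_id hx]⟩, rfl, rfl⟩
  have h : ContDiffOn ℝ ∞ (fun y => Ring.inverse (localEnd p S y)) (extChartAt (𝓡 m) p).target := by
    intro y hy
    obtain ⟨w, hw, -⟩ := key y hy
    have h := contDiffAt_ringInverse ℝ (n := ∞) w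
    rw [hw] at h
    exact h.comp_contDiffWithinAt y (contDiffOn_localEnd hS p y hy)
  refine h.congr fun y hy => ?_
  obtain ⟨w, hw, hw'⟩ := key y hy
  rw [← hw, ← hw', Ring.inverse_unit]

lemma covDeriv_add (g : RMetric m M) (hS : IsSmooth S) (hT : IsSmooth T) (x : M) :
    covDeriv g (S + T) x = covDeriv g S x + covDeriv g T x := by
  have hx := mem_chart_source (Model m) x
  ext1 u
  refine coordEnd_injective hx ?_
  rw [add_apply, coordEnd_add, coordEnd_covDeriv' g (hS.add hT) hx, coordEnd_covDeriv' g hS hx,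
    coordEnd_covDeriv' g hT hx, ← covAt_add (differentiableAt_localEnd hS (mem_extChartAt_target hx))
      (differentiableAt_localEnd hT (mem_extChartAt_target hx))]
  exact covAt_congr (Eventually.of_forall fun y => coordEnd_add _ _ _ _) _

lemma covDeriv_comp (g : RMetric m M) (hS : IsSmooth S) (hT : IsSmooth T) (x : M)
    (u : TangentSpace (𝓡 m) x) :
    covDeriv g (fun x => (S x).comp (T x)) x u
      = (covDeriv g S x u).comp (T x) + (S x).comp (covDeriv g T x u) := by
  have hx := mem_chart_source (Model m) x
  refine coordEnd_injective hx ?_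
  rw [coordEnd_add, coordEnd_comp hx, coordEnd_comp hx, coordEnd_covDeriv' g (hS.comp hT) hx,
    coordEnd_covDeriv' g hS hx, coordEnd_covDeriv' g hT hx, ← localEnd_apply hx, ← localEnd_apply hx,
    ← covAt_mul (differentiableAt_localEnd hS (mem_extChartAt_target hx))
      (differentiableAt_localEnd hT (mem_extChartAt_target hx))]
  exact covAt_congr (eventually_target hx fun z hz => by
    rw [localEnd_apply hz, localEnd_apply hz, localEnd_apply hz, coordEnd_comp hz]) _

lemma covDeriv_id (g : RMetric m M) (x : M) :
    covDeriv g (fun x : M => ContinuousLinearMap.id ℝ (TangentSpace (𝓡 m) x)) x = 0 := by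
  have hx := mem_chart_source (Model m) x
  ext1 u
  refine coordEnd_injective hx ?_
  rw [coordEnd_covDeriv' g isSmooth_id hx]
  refine (covAt_congr (A' := fun _ => 1) (eventually_target hx fun z hz => ?_) _).trans ?_
  · rw [localEnd_apply hz, coordEnd_id hz]
  · rw [covAt_const_one]
    ext1 v
    simp [coordEnd_apply]

/-- Smoothness of a real function, expressed in the charts. -/
def IsSmoothFun (m : ℕ) {M : Type*} [TopologicalSpace M] [ChartedSpace (Model m) M]
    (f : M → ℝ) : Prop :=
  ∀ p : M, ContDiffOn ℝ ∞ (fun y => f ((extChartAt (𝓡 m) p).symm y)) (extChartAt (𝓡 m) p).target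

lemma IsSmooth.smul {f : M → ℝ} (hf : IsSmoothFun m f) (hS : IsSmooth S) :
    IsSmooth (fun x => f x • S x) :=
  isSmooth_of_contDiffOn fun p =>
    ((hf p).smul (contDiffOn_localEnd hS p)).congr (fun _ _ => coordEnd_smul _ _ _ _)

lemma covDeriv_smul (g : RMetric m M) {f : M → ℝ} (hf : IsSmoothFun m f) (hS : IsSmooth S) (x : M)
    (u : TangentSpace (𝓡 m) x) :
    covDeriv g (fun x => f x • S x) x u
      = fderiv ℝ (fun y => f ((extChartAt (𝓡 m) x).symm y)) (extChartAt (𝓡 m) x x)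
          (toCoord x x u) • S x + f x • covDeriv g S x u := by
  have hx := mem_chart_source (Model m) x
  refine coordEnd_injective hx ?_
  have hfx : f x = f ((extChartAt (𝓡 m) x).symm (extChartAt (𝓡 m) x x)) := by
    rw [(extChartAt (𝓡 m) x).left_inv (by simp)]
  have hd : DifferentiableAt ℝ (fun y => f ((extChartAt (𝓡 m) x).symm y)) (extChartAt (𝓡 m) x x) :=
    ((hf x).contDiffAt ((isOpen_extChartAt_target x).mem_nhds
      (mem_extChartAt_target hx))).differentiableAt (by simp)
  rw [coordEnd_add, coordEnd_smul, coordEnd_smul, coordEnd_covDeriv' g (hS.smul hf) hx,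
    coordEnd_covDeriv' g hS hx, hfx, ← localEnd_apply hx,
    ← covAt_smul hd (differentiableAt_localEnd hS (mem_extChartAt_target hx))]
  exact covAt_congr (Eventually.of_forall fun y => coordEnd_smul _ _ _ _) _

lemma covDeriv_const_smul (g : RMetric m M) (hS : IsSmooth S) (c : ℝ) (x : M) :
    covDeriv g (c • S) x = c • covDeriv g S x := by
  ext1 u
  have h := covDeriv_smul g (f := fun _ => c) (fun p => contDiffOn_const) hS x u
  simp at h
  exact h

end SectionRules

end

section

/-! ### Adjoints, inverses and truncations of smooth sections -/

/-- The trace of endomorphisms of a finite-dimensional space, as a continuous linear form. -/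
def traceL (V : Type*) [NormedAddCommGroup V] [NormedSpace ℝ V] [FiniteDimensional ℝ V] :
    (V →L[ℝ] V) →L[ℝ] ℝ :=
  LinearMap.toContinuousLinearMap
    ((LinearMap.trace ℝ V).comp (ContinuousLinearMap.coeLM ℝ))

section FormAdjoint

variable {E : Type*} [NormedAddCommGroup E] [NormedSpace ℝ E] [FiniteDimensional ℝ E]

lemma traceL_apply (A : E →L[ℝ] E) : traceL E A = LinearMap.trace ℝ E A := rfl

lemma traceL_mul_comm (A B : E →L[ℝ] E) : traceL E (A * B) = traceL E (B * A) :=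
  LinearMap.trace_mul_comm ℝ (A : E →ₗ[ℝ] E) (B : E →ₗ[ℝ] E)

/-- A positive form, as an isomorphism onto the dual space. -/
lemma exists_equiv_of_pos (B : E →L[ℝ] E →L[ℝ] ℝ) (hB : ∀ v, v ≠ 0 → 0 < B v v) :
    ∃ e : E ≃L[ℝ] (E →L[ℝ] ℝ), (e : E →L[ℝ] (E →L[ℝ] ℝ)) = B := by
  have hinj : Function.Injective (B : E →ₗ[ℝ] (E →L[ℝ] ℝ)) := by
    rw [← LinearMap.ker_eq_bot, LinearMap.ker_eq_bot']
    intro v hv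
    by_contra h
    have h1 : B v = 0 := hv
    have := hB v h
    simp [h1] at this
  have hfin : Module.finrank ℝ E = Module.finrank ℝ (E →L[ℝ] ℝ) := by
    rw [← (LinearMap.toContinuousLinearMap (𝕜 := ℝ) (E := E) (F' := ℝ)).finrank_eq]
    exact (Subspace.dual_finrank_eq (K := ℝ) (V := E)).symm
  have hbij : Function.Bijective (B : E →ₗ[ℝ] (E →L[ℝ] ℝ)) :=
    ⟨hinj, (LinearMap.injective_iff_surjective_of_finrank_eq_finrank hfin).1 hinj⟩
  exact ⟨(LinearEquiv.ofBijective _ hbij).toContinuousLinearEquiv, by ext; rfl⟩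

set_option synthInstance.maxHeartbeats 200000 in
/-- The adjoints of a smooth family of endomorphisms with respect to a smooth family of inner
products form a smooth family. -/
lemma exists_contDiffOn_adjoint {B : E → E →L[ℝ] E →L[ℝ] ℝ} {A : E → E →L[ℝ] E} {s : Set E}
    (hB : ContDiffOn ℝ ∞ B s) (hA : ContDiffOn ℝ ∞ A s)
    (hpos : ∀ y ∈ s, ∀ v, v ≠ 0 → 0 < B y v v) :
    ∃ W : E → E →L[ℝ] E, ContDiffOn ℝ ∞ W s ∧
      ∀ y ∈ s, ∀ v w, B y (W y v) w = B y v (A y w) := by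
  refine ⟨fun y => (B y).inverse.comp
    (((ContinuousLinearMap.compL ℝ E E ℝ).flip (A y)).comp (B y)), ?_, fun y hy v w => ?_⟩
  · have h1 : ContDiffOn ℝ ∞ (fun y => (B y).inverse) s := by
      intro y hy
      obtain ⟨e, he⟩ := exists_equiv_of_pos (B y) (hpos y hy)
      have h := contDiffAt_map_inverse (𝕜 := ℝ) (n := ∞) e
      rw [he] at h
      exact h.comp_contDiffWithinAt y (hB y hy)
    have h2 : ContDiffOn ℝ ∞ (fun y => (ContinuousLinearMap.compL ℝ E E ℝ).flip (A y)) s :=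
      (ContinuousLinearMap.contDiff _).comp_contDiffOn hA
    exact h1.clm_comp (h2.clm_comp hB)
  · obtain ⟨e, he⟩ := exists_equiv_of_pos (B y) (hpos y hy)
    beta_reduce
    rw [← he]
    simp

end FormAdjoint

section Sections

variable {m : ℕ} {M : Type*} [TopologicalSpace M] [ChartedSpace (Model m) M]
  [IsManifold (𝓡 m) ∞ M] {S T : EndField m M}

lemma metricForm_localEnd (g : RMetric m M) {p x : M} (hx : x ∈ (chartAt (Model m) p).source)
    (S : EndField m M) (v w : Model m) :
    metricForm g p (extChartAt (𝓡 m) p x) (localEnd p S (extChartAt (𝓡 m) p x) v) w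
      = g.inner x (S x (ofCoord p x v)) (ofCoord p x w) := by
  rw [localEnd_apply hx, metricForm_apply g hx, coordEnd_apply, ofCoord_toCoord hx]

/-- A smooth section of `End(TM)` has a smooth `g`-adjoint, whose covariant derivative is the
adjoint of the covariant derivative. -/
lemma exists_adjoint (g : RMetric m M) (hS : IsSmooth S) :
    ∃ S' : EndField m M, IsSmooth S' ∧
      (∀ x v w, g.inner x (S x v) w = g.inner x v (S' x w)) ∧
      ∀ x u v w, g.inner x (covDeriv g S x u v) w = g.inner x v (covDeriv g S' x u w) := by
  choose W hW hW' using fun p => exists_contDiffOn_adjoint (contDiffOn_metricForm g p)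
    (contDiffOn_localEnd hS p) (fun y hy v hv => metricForm_pos g hy hv)
  set S' : EndField m M := fun x => (ofCoord x x).comp ((W x (extChartAt (𝓡 m) x x)).comp
    (toCoord x x)) with hS'
  have hadj : ∀ x v w, g.inner x (S x v) w = g.inner x v (S' x w) := by
    intro x v w
    have hx := mem_chart_source (Model m) x
    have h := hW' x _ (mem_extChartAt_target hx) (toCoord x x w) (toCoord x x v)
    rw [metricForm_symm g (mem_extChartAt_target hx) _ (localEnd x S _ _),
      metricForm_localEnd g hx, metricForm_apply g hx] at h
    simp only [ofCoord_toCoord hx] at h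
    rw [← h, g.symm]
    rfl
  have hloc : ∀ p, ∀ y ∈ (extChartAt (𝓡 m) p).target, localEnd p S' y = W p y := by
    intro p
    refine forall_target fun x hx => ?_
    have hy := mem_extChartAt_target hx
    ext1 v
    rw [← sub_eq_zero]
    by_contra hne
    refine (metricForm_pos g hy hne).ne' ?_
    have key : ∀ w, metricForm g p (extChartAt (𝓡 m) p x) (localEnd p S' (extChartAt (𝓡 m) p x) v) w
        = metricForm g p (extChartAt (𝓡 m) p x) (W p (extChartAt (𝓡 m) p x) v) w := fun w => by
      rw [hW' p _ hy, metricForm_localEnd g hx, g.symm, ← hadj, metricForm_symm g hy v,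
        metricForm_localEnd g hx]
    rw [map_sub (metricForm g p _), sub_apply, key, sub_self]
  have hsm : IsSmooth S' := isSmooth_of_contDiffOn fun p => (hW p).congr (hloc p)
  refine ⟨S', hsm, hadj, fun x u v w => ?_⟩
  have hx := mem_chart_source (Model m) x
  have hy := mem_extChartAt_target hx
  have h := covAt_adjoint (Γ := christoffelMap g x (extChartAt (𝓡 m) x x)) (y := extChartAt (𝓡 m) x x)
    (differentiableAt_metricForm g hy)
    (differentiableAt_localEnd hS hy) (differentiableAt_localEnd hsm hy)
    ((isKoszul_christoffelMap g hy).compatible (differentiableAt_metricForm g hy)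
      (eventually_target hx fun z hz => metricForm_symm g (mem_extChartAt_target hz)))
    (eventually_target hx fun z hz v w => by
      rw [metricForm_localEnd g hz, metricForm_symm g (mem_extChartAt_target hz) v,
        metricForm_localEnd g hz, hadj, g.symm])
    (toCoord x x u) (toCoord x x v) (toCoord x x w)
  rw [← coordEnd_covDeriv' g hS hx, ← coordEnd_covDeriv' g hsm hx, metricForm_apply g hx,
    metricForm_apply g hx, coordEnd_apply, coordEnd_apply] at h
  simpa only [ofCoord_toCoord hx] using h

/-- The trace of endomorphisms of the tangent space. -/
def traceTangent (x : M) (A : TangentSpace (𝓡 m) x →L[ℝ] TangentSpace (𝓡 m) x) : ℝ :=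
  LinearMap.trace ℝ (TangentSpace (𝓡 m) x) A

lemma traceL_coordEnd {p x : M} (hx : x ∈ (chartAt (Model m) p).source)
    (A : TangentSpace (𝓡 m) x →L[ℝ] TangentSpace (𝓡 m) x) :
    traceL (Model m) (coordEnd p x A) = traceTangent x A := by
  let e : TangentSpace (𝓡 m) x ≃ₗ[ℝ] Model m :=
    LinearEquiv.ofLinearMap (toCoord (m := m) p x).toLinearMap
      (ofCoord (m := m) p x).toLinearMap
      (by ext1 v; exact toCoord_ofCoord hx v) (by ext1 v; exact ofCoord_toCoord hx v)
  exact LinearMap.trace_conj' (A : TangentSpace (𝓡 m) x →ₗ[ℝ] TangentSpace (𝓡 m) x) e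

lemma isSmoothFun_trace {χ : ℝ → ℝ} (hχ : ContDiff ℝ ∞ χ) (hS : IsSmooth S) :
    IsSmoothFun m (fun x => χ (traceTangent x (S x))) := by
  intro p
  refine ((hχ.comp (traceL (Model m)).contDiff).comp_contDiffOn (contDiffOn_localEnd hS p)).congr ?_
  refine forall_target fun x hx => ?_
  rw [Function.comp_apply, Function.comp_apply, localEnd_apply hx, traceL_coordEnd hx,
    (extChartAt (𝓡 m) p).left_inv (by simpa using hx)]

lemma covDeriv_trace_smul (g : RMetric m M) {χ : ℝ → ℝ} (hχ : ContDiff ℝ ∞ χ) (hS : IsSmooth S)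
    (hT : IsSmooth T) (x : M) (u : TangentSpace (𝓡 m) x) :
    covDeriv g (fun x => χ (traceTangent x (S x)) • T x) x u
      = (deriv χ (traceTangent x (S x)) * traceTangent x (covDeriv g S x u)) • T x
        + χ (traceTangent x (S x)) • covDeriv g T x u := by
  have hx := mem_chart_source (Model m) x
  have hy := mem_extChartAt_target hx
  rw [covDeriv_smul g (isSmoothFun_trace hχ hS) hT]
  congr 2
  have h1 : (fun y => χ (traceTangent ((extChartAt (𝓡 m) x).symm y) (S ((extChartAt (𝓡 m) x).symm y))))
      =ᶠ[𝓝 (extChartAt (𝓡 m) x x)] fun y => χ (traceL (Model m) (localEnd x S y)) :=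
    eventually_target hx fun z hz => by
      beta_reduce
      rw [localEnd_apply hz, traceL_coordEnd hz,
        (extChartAt (𝓡 m) x).left_inv (by simpa using hz)]
  have hd : DifferentiableAt ℝ (fun y => traceL (Model m) (localEnd x S y)) (extChartAt (𝓡 m) x x) :=
    (traceL (Model m)).differentiableAt.comp _ (differentiableAt_localEnd hS hy)
  have h2 : HasFDerivAt (fun y => χ (traceL (Model m) (localEnd x S y))) _ (extChartAt (𝓡 m) x x) :=
    ((hχ.differentiable (by simp)).differentiableAt.hasDerivAt).comp_hasFDerivAt _ hd.hasFDerivAt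
  rw [h1.fderiv_eq, h2.fderiv, smul_apply, smul_eq_mul,
    fderiv_trace (Γ := christoffelMap g x (extChartAt (𝓡 m) x x)) _ traceL_mul_comm
      (differentiableAt_localEnd hS hy), ← coordEnd_covDeriv' g hS hx, traceL_coordEnd hx,
    localEnd_apply hx, traceL_coordEnd hx]

end Sections

end

section

/-! ### The Hilbert–Schmidt inner product -/

section HilbertSchmidt

variable {V : Type*} [NormedAddCommGroup V] [InnerProductSpace ℝ V] [FiniteDimensional ℝ V]
  {ι : Type*} [Fintype ι]

/-- The Hilbert–Schmidt inner product `tr(σᵀ τ)` of endomorphisms. -/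
def hs (σ τ : V →L[ℝ] V) : ℝ := traceL V (star σ * τ)

/-- The Hilbert–Schmidt inner product of tuples of endomorphisms, that is, for tuples indexed by
an orthonormal basis, of elements of `V^* ⊗ End(V)`. -/
def hsGrad (α β : ι → V →L[ℝ] V) : ℝ := ∑ a, hs (α a) (β a)

lemma traceL_eq_sum (b : OrthonormalBasis ι ℝ V) (σ : V →L[ℝ] V) :
    traceL V σ = ∑ a, inner ℝ (b a) (σ (b a)) := by
  rw [traceL_apply, LinearMap.trace_eq_sum_inner _ b]
  rfl

lemma hs_eq_sum (b : OrthonormalBasis ι ℝ V) (σ τ : V →L[ℝ] V) :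
    hs σ τ = ∑ a, inner ℝ (σ (b a)) (τ (b a)) := by
  rw [hs, traceL_eq_sum b]
  refine Finset.sum_congr rfl fun a _ => ?_
  rw [mul_apply_eq_comp, ContinuousLinearMap.star_eq_adjoint,
    ContinuousLinearMap.adjoint_inner_right]

lemma norm_star_end (σ : V →L[ℝ] V) : ‖star σ‖ = ‖σ‖ := by
  rw [ContinuousLinearMap.star_eq_adjoint, LinearIsometryEquiv.norm_map]

lemma traceL_star (σ : V →L[ℝ] V) : traceL V (star σ) = traceL V σ := by
  rw [traceL_eq_sum (stdOrthonormalBasis ℝ V), traceL_eq_sum (stdOrthonormalBasis ℝ V)]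
  refine Finset.sum_congr rfl fun a _ => ?_
  rw [ContinuousLinearMap.star_eq_adjoint, ContinuousLinearMap.adjoint_inner_right,
    real_inner_comm]

lemma abs_traceL_le (σ : V →L[ℝ] V) : |traceL V σ| ≤ Module.finrank ℝ V * ‖σ‖ := by
  rw [traceL_eq_sum (stdOrthonormalBasis ℝ V)]
  refine (Finset.abs_sum_le_sum_abs _ _).trans ?_
  refine (Finset.sum_le_card_nsmul _ _ ‖σ‖ fun a _ => ?_).trans (by simp)
  refine (abs_real_inner_le_norm _ _).trans ?_
  have := σ.le_opNorm (stdOrthonormalBasis ℝ V a)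
  simpa using this

lemma hs_self_nonneg (σ : V →L[ℝ] V) : 0 ≤ hs σ σ := by
  rw [hs_eq_sum (stdOrthonormalBasis ℝ V)]
  exact Finset.sum_nonneg fun a _ => real_inner_self_nonneg

lemma hs_self_le (σ : V →L[ℝ] V) : hs σ σ ≤ Module.finrank ℝ V * ‖σ‖ ^ 2 := by
  have h := abs_traceL_le (star σ * σ)
  have h2 : ‖star σ * σ‖ ≤ ‖σ‖ ^ 2 := (norm_mul_le _ _).trans (by rw [norm_star_end, sq])
  calc hs σ σ ≤ Module.finrank ℝ V * ‖star σ * σ‖ := (le_abs_self _).trans h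
    _ ≤ Module.finrank ℝ V * ‖σ‖ ^ 2 := by gcongr

/-- The operator norm is bounded by the Hilbert–Schmidt norm. -/
lemma norm_sq_le_hs (σ : V →L[ℝ] V) : ‖σ‖ ^ 2 ≤ hs σ σ := by
  have h : ‖σ‖ ≤ √(hs σ σ) := by
    refine σ.opNorm_le_bound (Real.sqrt_nonneg _) fun v => ?_
    set b := stdOrthonormalBasis ℝ V
    have h1 : σ v = ∑ a, inner ℝ (b a) v • σ (b a) := by
      conv_lhs => rw [← b.sum_repr' v]
      simp
    have h2 : ‖σ v‖ ≤ ∑ a, ‖σ (b a)‖ * ‖inner ℝ (b a) v‖ := by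
      rw [h1]
      exact (norm_sum_le _ _).trans (Finset.sum_le_sum fun a _ => by rw [norm_smul, mul_comm])
    refine h2.trans ((Real.sum_mul_le_sqrt_mul_sqrt Finset.univ _ _).trans (le_of_eq ?_))
    rw [b.sum_sq_norm_inner_right, Real.sqrt_sq (norm_nonneg _), hs_eq_sum b]
    simp only [real_inner_self_eq_norm_sq]
  calc ‖σ‖ ^ 2 ≤ √(hs σ σ) ^ 2 := by gcongr
    _ = hs σ σ := Real.sq_sqrt (hs_self_nonneg σ)

lemma abs_hs_le (σ τ : V →L[ℝ] V) : |hs σ τ| ≤ Module.finrank ℝ V * (‖σ‖ * ‖τ‖) := by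
  refine (abs_traceL_le _).trans ?_
  gcongr
  exact (norm_mul_le _ _).trans (by rw [norm_star_end])

lemma hs_comm (σ τ : V →L[ℝ] V) : hs σ τ = hs τ σ := by
  rw [hs, hs, ← traceL_star, star_mul, star_star]

lemma hs_add_left (σ σ' τ : V →L[ℝ] V) : hs (σ + σ') τ = hs σ τ + hs σ' τ := by
  simp [hs, add_mul]

lemma hs_add_right (σ τ τ' : V →L[ℝ] V) : hs σ (τ + τ') = hs σ τ + hs σ τ' := by
  simp [hs, mul_add]

lemma hs_neg_right (σ τ : V →L[ℝ] V) : hs σ (-τ) = -hs σ τ := by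
  simp [hs]

lemma hs_neg_left (σ τ : V →L[ℝ] V) : hs (-σ) τ = -hs σ τ := by
  simp [hs]

lemma hs_sub_right (σ τ τ' : V →L[ℝ] V) : hs σ (τ - τ') = hs σ τ - hs σ τ' := by
  simp [hs, mul_sub]

lemma hs_smul_right (c : ℝ) (σ τ : V →L[ℝ] V) : hs σ (c • τ) = c * hs σ τ := by
  simp [hs]

lemma hs_smul_left (c : ℝ) (σ τ : V →L[ℝ] V) : hs (c • σ) τ = c * hs σ τ := by
  simp [hs]

lemma hs_star_star (σ τ : V →L[ℝ] V) : hs (star σ) (star τ) = hs σ τ := by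
  rw [hs, hs, star_star, traceL_mul_comm, ← traceL_star, star_mul, star_star]

lemma hs_mul_left (ρ σ τ : V →L[ℝ] V) : hs σ (ρ * τ) = hs (star ρ * σ) τ := by
  rw [hs, hs, star_mul, star_star, mul_assoc]

lemma hs_mul_right (ρ σ τ : V →L[ℝ] V) : hs σ (τ * ρ) = hs (σ * star ρ) τ := by
  rw [hs, hs, star_mul, star_star, ← mul_assoc, traceL_mul_comm, mul_assoc]

lemma hs_conj {C : V →L[ℝ] V} (hC : star C * C = 1) (σ τ : V →L[ℝ] V) :
    hs (C * σ * star C) (C * τ * star C) = hs σ τ := by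
  rw [hs_mul_right, star_star, mul_assoc (C * σ), hC, mul_one, hs_mul_left, ← mul_assoc, hC, one_mul]

lemma hsGrad_self_nonneg (α : ι → V →L[ℝ] V) : 0 ≤ hsGrad α α :=
  Finset.sum_nonneg fun _ _ => hs_self_nonneg _

lemma norm_sq_le_hsGrad (α : ι → V →L[ℝ] V) : ‖α‖ ^ 2 ≤ hsGrad α α := by
  have h : ‖α‖ ≤ √(hsGrad α α) := by
    refine (pi_norm_le_iff_of_nonneg (Real.sqrt_nonneg _)).2 fun a => ?_
    refine Real.le_sqrt_of_sq_le ((norm_sq_le_hs _).trans ?_)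
    exact Finset.single_le_sum (f := fun b => hs (α b) (α b)) (fun _ _ => hs_self_nonneg _)
      (Finset.mem_univ a)
  calc ‖α‖ ^ 2 ≤ √(hsGrad α α) ^ 2 := by gcongr
    _ = hsGrad α α := Real.sq_sqrt (hsGrad_self_nonneg α)

lemma abs_hsGrad_le (α β : ι → V →L[ℝ] V) : |hsGrad α β| ≤ Fintype.card ι * Module.finrank ℝ V * (‖α‖ * ‖β‖) := by
  refine (Finset.abs_sum_le_sum_abs _ _).trans ?_
  refine (Finset.sum_le_card_nsmul _ _ (Module.finrank ℝ V * (‖α‖ * ‖β‖)) fun _ _ => ?_).trans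
    (by simp [mul_assoc])
  refine (abs_hs_le _ _).trans ?_
  gcongr <;> exact norm_le_pi_norm _ _

lemma hsGrad_self_le (α : ι → V →L[ℝ] V) : hsGrad α α ≤ Fintype.card ι * Module.finrank ℝ V * ‖α‖ ^ 2 := by
  rw [sq]
  exact (le_abs_self _).trans (abs_hsGrad_le α α)

lemma hsGrad_add_smul (α β : ι → V →L[ℝ] V) (t : ℝ) :
    hsGrad (α + t • β) (α + t • β) = hsGrad α α + t * (2 * hsGrad α β) + t ^ 2 * hsGrad β β := by
  simp only [hsGrad, Finset.mul_sum, ← Finset.sum_add_distrib]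
  refine Finset.sum_congr rfl fun a _ => ?_
  simp only [Pi.add_apply, Pi.smul_apply, hs_add_left, hs_add_right, hs_smul_left, hs_smul_right,
    hs_comm (β a) (α a)]
  ring

lemma continuous_hs {Y : Type*} [TopologicalSpace Y] {f g : Y → V →L[ℝ] V}
    (hf : Continuous f) (hg : Continuous g) : Continuous fun y => hs (f y) (g y) :=
  (traceL V).continuous.comp (hf.star.mul hg)

lemma continuous_hsGrad {Y : Type*} [TopologicalSpace Y] {f g : Y → ι → V →L[ℝ] V}
    (hf : Continuous f) (hg : Continuous g) : Continuous fun y => hsGrad (f y) (g y) :=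
  continuous_finsetSum _ fun a _ =>
    continuous_hs ((continuous_apply a).comp hf) ((continuous_apply a).comp hg)

lemma inner_skew {S : V →L[ℝ] V} (hS : star S = -S) (v : V) : inner ℝ v (S v) = 0 := by
  have h1 : inner ℝ v (S v) = inner ℝ v (star S v) := by
    rw [ContinuousLinearMap.star_eq_adjoint, ContinuousLinearMap.adjoint_inner_right,
      real_inner_comm]
  rw [hS, neg_apply, inner_neg_right] at h1
  linarith

lemma norm_le_norm_one_sub_skew {S : V →L[ℝ] V} (hS : star S = -S) (v : V) :
    ‖v‖ ≤ ‖(1 - S) v‖ := by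
  have h2 : ‖(1 - S) v‖ ^ 2 = ‖v‖ ^ 2 + ‖S v‖ ^ 2 := by
    rw [sub_apply, one_apply_eq_self, norm_sub_sq_real, inner_skew hS]
    ring
  exact le_of_sq_le_sq (by nlinarith [sq_nonneg ‖S v‖]) (norm_nonneg _)

lemma isUnit_one_sub_skew {S : V →L[ℝ] V} (hS : star S = -S) : IsUnit (1 - S) := by
  rw [ContinuousLinearMap.isUnit_iff_isUnit_toLinearMap, LinearMap.isUnit_iff_ker_eq_bot,
    LinearMap.ker_eq_bot']
  intro v hv
  have h := norm_le_norm_one_sub_skew hS v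
  have hv' : (1 - S) v = 0 := hv
  rw [hv', norm_zero] at h
  exact norm_le_zero_iff.1 h

/-- For skew `S`, the inverse of `1 - S` is a contraction. -/
lemma norm_inverse_one_sub_skew_le {S : V →L[ℝ] V} (hS : star S = -S) :
    ‖Ring.inverse (1 - S)‖ ≤ 1 := by
  refine ContinuousLinearMap.opNorm_le_bound _ zero_le_one fun v => ?_
  refine (norm_le_norm_one_sub_skew hS _).trans ?_
  rw [← mul_apply_eq_comp, Ring.mul_inverse_cancel _ (isUnit_one_sub_skew hS), one_mul,
    one_apply_eq_self]

end HilbertSchmidt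

end

section

/-! ### Convergence in `L²` -/

section LTwo

variable {X : Type*} [MeasurableSpace X] {μ : Measure X}
  {E F : Type*} [NormedAddCommGroup E] [NormedAddCommGroup F]

lemma eLpNorm_two_sq (f : X → E) : eLpNorm f 2 μ ^ 2 = ∫⁻ x, ‖f x‖ₑ ^ 2 ∂μ := by
  have h := eLpNorm_nnreal_pow_eq_lintegral (f := f) (μ := μ) (p := 2) two_ne_zero
  simpa using h

lemma tendsto_eLpNorm_two_iff {f : ℕ → X → E} :
    Tendsto (fun k => eLpNorm (f k) 2 μ) atTop (𝓝 0)
      ↔ Tendsto (fun k => ∫⁻ x, ‖f k x‖ₑ ^ 2 ∂μ) atTop (𝓝 0) := by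
  simp only [← eLpNorm_two_sq]
  refine ⟨fun h => by simpa using ENNReal.Tendsto.pow (n := 2) h, fun h => ?_⟩
  have h2 := h.ennrpow_const (1 / 2 : ℝ)
  rw [ENNReal.zero_rpow_of_pos (by norm_num)] at h2
  refine h2.congr fun k => ?_
  rw [← ENNReal.rpow_natCast, ← ENNReal.rpow_mul]
  norm_num

lemma tendsto_eLpNorm_zero_of_dominated {v : ℕ → X → E} {w : X → F}
    (hv : ∀ k, AEStronglyMeasurable (v k) μ) (hw : MemLp w 2 μ)
    (h : ∀ k, ∀ᵐ x ∂μ, ‖v k x‖ ≤ ‖w x‖)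
    (hlim : ∀ᵐ x ∂μ, Tendsto (fun k => v k x) atTop (𝓝 0)) :
    Tendsto (fun k => eLpNorm (v k) 2 μ) atTop (𝓝 0) := by
  rw [tendsto_eLpNorm_two_iff]
  have h0 : ∫⁻ _x : X, (0 : ENNReal) ∂μ = 0 := by simp
  rw [← h0]
  refine tendsto_lintegral_of_dominated_convergence' (fun x => ‖w x‖ₑ ^ 2)
    (fun k => (hv k).enorm.pow_const 2) (fun k => ?_) ?_ ?_
  · filter_upwards [h k] with x hx
    gcongr
    exact enorm_le_iff_norm_le.2 hx
  · rw [← eLpNorm_two_sq]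
    exact ENNReal.pow_ne_top hw.eLpNorm_ne_top
  · filter_upwards [hlim] with x hx
    have h1 := ENNReal.Tendsto.pow (n := 2) hx.enorm
    simpa using h1

/-- Generalized dominated convergence in `L²`: the dominating functions may depend on the index,
as long as they converge in `L²`. -/
lemma tendsto_eLpNorm_sub_of_dominated {u : ℕ → X → F} {u₀ : X → F} {v : ℕ → X → E} {v₀ : X → E}
    {C : ℝ} (hC : 0 ≤ C) (hu : ∀ k, AEStronglyMeasurable (u k) μ) (hu₀ : MemLp u₀ 2 μ)
    (hconv : Tendsto (fun k => eLpNorm (u k - u₀) 2 μ) atTop (𝓝 0))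
    (hv : ∀ k, AEStronglyMeasurable (v k) μ) (hb : ∀ k, ∀ᵐ x ∂μ, ‖v k x‖ ≤ C * ‖u k x‖)
    (huae : ∀ᵐ x ∂μ, Tendsto (fun k => u k x) atTop (𝓝 (u₀ x)))
    (hvae : ∀ᵐ x ∂μ, Tendsto (fun k => v k x) atTop (𝓝 (v₀ x))) :
    Tendsto (fun k => eLpNorm (v k - v₀) 2 μ) atTop (𝓝 0) := by
  have hv₀ : AEStronglyMeasurable v₀ μ := aestronglyMeasurable_of_tendsto_ae atTop hv hvae
  have hball := ae_all_iff.2 hb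
  have hb₀ : ∀ᵐ x ∂μ, ‖v₀ x‖ ≤ C * ‖u₀ x‖ := by
    filter_upwards [hball, huae, hvae] with x h1 h2 h3
    exact le_of_tendsto_of_tendsto' h3.norm (h2.norm.const_mul C) h1
  set r : ℕ → X → ℝ := fun k x => max (‖v k x - v₀ x‖ - C * ‖u k x - u₀ x‖) 0 with hr
  have hrm : ∀ k, AEStronglyMeasurable (r k) μ := fun k =>
    ((((hv k).sub hv₀).norm.sub (((hu k).sub hu₀.1).norm.const_mul C)).sup
      aestronglyMeasurable_const)
  have h1 : Tendsto (fun k => eLpNorm (r k) 2 μ) atTop (𝓝 0) := by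
    refine tendsto_eLpNorm_zero_of_dominated hrm (hu₀.norm.const_mul (2 * C)) (fun k => ?_) ?_
    · filter_upwards [hb k, hb₀] with x h1 h2
      rw [Real.norm_of_nonneg (le_max_right _ _), Real.norm_of_nonneg (by positivity)]
      refine max_le ?_ (by positivity)
      have h3 : ‖v k x - v₀ x‖ ≤ ‖v k x‖ + ‖v₀ x‖ := norm_sub_le _ _
      have h4 : ‖u k x‖ ≤ ‖u k x - u₀ x‖ + ‖u₀ x‖ := by
        simpa using norm_add_le (u k x - u₀ x) (u₀ x)
      nlinarith [mul_le_mul_of_nonneg_left h4 hC]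
    · filter_upwards [hvae] with x hx
      have h5 : Tendsto (fun k => ‖v k x - v₀ x‖) atTop (𝓝 0) :=
        tendsto_iff_norm_sub_tendsto_zero.1 hx
      refine squeeze_zero (fun k => le_max_right _ _) (fun k => max_le ?_ (norm_nonneg _)) h5
      have : 0 ≤ C * ‖u k x - u₀ x‖ := by positivity
      linarith
  have h2 : Tendsto (fun k => eLpNorm (r k) 2 μ + ENNReal.ofReal C * eLpNorm (u k - u₀) 2 μ) atTop
      (𝓝 0) := by
    simpa using h1.add (ENNReal.Tendsto.const_mul hconv (Or.inr ENNReal.ofReal_ne_top))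
  refine tendsto_of_tendsto_of_tendsto_of_le_of_le tendsto_const_nhds h2 (fun k => zero_le)
    fun k => ?_
  have hum : AEStronglyMeasurable (fun x => C * ‖u k x - u₀ x‖) μ :=
    ((hu k).sub hu₀.1).norm.const_mul C
  calc eLpNorm (v k - v₀) 2 μ ≤ eLpNorm (r k + fun x => C * ‖u k x - u₀ x‖) 2 μ := by
        refine eLpNorm_mono_real fun x => ?_
        have := le_max_left (‖v k x - v₀ x‖ - C * ‖u k x - u₀ x‖) 0
        simp only [Pi.sub_apply, Pi.add_apply, hr]
        linarith
    _ ≤ eLpNorm (r k) 2 μ + eLpNorm (fun x => C * ‖u k x - u₀ x‖) 2 μ :=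
        eLpNorm_add_le (hrm k) hum (by norm_num)
    _ ≤ _ := by
        gcongr
        refine eLpNorm_le_mul_eLpNorm_of_ae_le_mul (Eventually.of_forall fun x => ?_) _
        rw [Real.norm_of_nonneg (by positivity)]
        rfl

/-- A sequence converging in `L²` has a subsequence converging almost everywhere. -/
lemma exists_subseq_tendsto_ae {f : ℕ → X → E} {f₀ : X → E}
    (hf : ∀ k, AEStronglyMeasurable (f k) μ) (hf₀ : AEStronglyMeasurable f₀ μ)
    (h : Tendsto (fun k => eLpNorm (f k - f₀) 2 μ) atTop (𝓝 0)) :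
    ∃ φ : ℕ → ℕ, StrictMono φ ∧ ∀ᵐ x ∂μ, Tendsto (fun k => f (φ k) x) atTop (𝓝 (f₀ x)) :=
  (tendstoInMeasure_of_tendsto_eLpNorm (by norm_num) hf hf₀ h).exists_seq_tendsto_ae

lemma tendsto_eLpNorm_add {f g : ℕ → X → E} {f₀ g₀ : X → E}
    (hf : ∀ k, AEStronglyMeasurable (f k) μ) (hf₀ : AEStronglyMeasurable f₀ μ)
    (hg : ∀ k, AEStronglyMeasurable (g k) μ) (hg₀ : AEStronglyMeasurable g₀ μ)
    (h : Tendsto (fun k => eLpNorm (f k - f₀) 2 μ) atTop (𝓝 0))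
    (h' : Tendsto (fun k => eLpNorm (g k - g₀) 2 μ) atTop (𝓝 0)) :
    Tendsto (fun k => eLpNorm (f k + g k - (f₀ + g₀)) 2 μ) atTop (𝓝 0) := by
  refine tendsto_of_tendsto_of_tendsto_of_le_of_le tendsto_const_nhds (by simpa using h.add h')
    (fun k => zero_le) fun k => ?_
  have e : f k + g k - (f₀ + g₀) = (f k - f₀) + (g k - g₀) := by abel
  beta_reduce
  rw [e]
  exact eLpNorm_add_le ((hf k).sub hf₀) ((hg k).sub hg₀) (by norm_num)

lemma memLp_two_of_tendsto {f : ℕ → X → E} {f₀ : X → E} (hf : ∀ k, MemLp (f k) 2 μ)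
    (hf₀ : AEStronglyMeasurable f₀ μ)
    (h : Tendsto (fun k => eLpNorm (f k - f₀) 2 μ) atTop (𝓝 0)) : MemLp f₀ 2 μ := by
  obtain ⟨k, hk⟩ := (h.eventually (gt_mem_nhds zero_lt_one)).exists
  have h1 : MemLp (f k - f₀) 2 μ := ⟨(hf k).1.sub hf₀, hk.trans ENNReal.one_lt_top⟩
  simpa using (hf k).sub h1

end LTwo

end

section

/-! ### Abstract Sobolev spaces of endomorphism fields -/

section Jets

variable {X : Type*} [MeasurableSpace X] {μ : Measure X}
  {V : Type*} [NormedAddCommGroup V] [InnerProductSpace ℝ V] [FiniteDimensional ℝ V]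
  {ι : Type*} [Fintype ι]

/-- The properties of the space of the pairs `(σ, ∇σ)`, with `σ` a smooth section of `End(TM)`
read in a measurable orthonormal frame, on which the variational argument rests: it is a
`*`-algebra for the Leibniz rule, closed under inverses and truncations; the derivation is closable
(`closable`) and Rellich's theorem holds (`rellich`). -/
structure IsJetAlgebra (μ : Measure X) (D : (X → V →L[ℝ] V) → (X → ι → V →L[ℝ] V) → Prop) :
    Prop where
  aesm_fst : ∀ {σ α}, D σ α → AEStronglyMeasurable σ μ
  aesm_snd : ∀ {σ α}, D σ α → AEStronglyMeasurable α μ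
  bdd : ∀ {σ α}, D σ α → ∃ C : ℝ, ∀ x, ‖σ x‖ ≤ C ∧ ‖α x‖ ≤ C
  add : ∀ {σ α τ β}, D σ α → D τ β → D (fun x => σ x + τ x) (fun x => α x + β x)
  smul : ∀ (c : ℝ) {σ α}, D σ α → D (fun x => c • σ x) (fun x => c • α x)
  one : D (fun _ => 1) (fun _ => 0)
  mul : ∀ {σ α τ β}, D σ α → D τ β →
    D (fun x => σ x * τ x) (fun x a => α x a * τ x + σ x * β x a)
  star_mem : ∀ {σ α}, D σ α → D (fun x => star (σ x)) (fun x a => star (α x a))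
  inv : ∀ {σ α}, D σ α → (∀ x, IsUnit (σ x)) →
    D (fun x => Ring.inverse (σ x)) (fun x a => -(Ring.inverse (σ x) * α x a * Ring.inverse (σ x)))
  trace_smul : ∀ {σ α τ β} {χ : ℝ → ℝ}, D σ α → D τ β → ContDiff ℝ ∞ χ →
    D (fun x => χ (traceL V (σ x)) • τ x) (fun x a =>
      (deriv χ (traceL V (σ x)) * traceL V (α x a)) • τ x + χ (traceL V (σ x)) • β x a)
  closable : ∀ {σ : ℕ → X → V →L[ℝ] V} {α : ℕ → X → ι → V →L[ℝ] V} {α₀ : X → ι → V →L[ℝ] V},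
    (∀ k, D (σ k) (α k)) → AEStronglyMeasurable α₀ μ →
    Tendsto (fun k => eLpNorm (σ k) 2 μ) atTop (𝓝 0) →
    Tendsto (fun k => eLpNorm (α k - α₀) 2 μ) atTop (𝓝 0) → α₀ =ᵐ[μ] 0
  rellich : ∀ {σ : ℕ → X → V →L[ℝ] V} {α : ℕ → X → ι → V →L[ℝ] V} {C : ENNReal},
    (∀ k, D (σ k) (α k)) → C ≠ ⊤ → (∀ k, eLpNorm (σ k) 2 μ ≤ C) → (∀ k, eLpNorm (α k) 2 μ ≤ C) →
    ∃ φ : ℕ → ℕ, StrictMono φ ∧ ∃ σ₀ : X → V →L[ℝ] V,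
      ∀ᵐ x ∂μ, Tendsto (fun k => σ (φ k) x) atTop (𝓝 (σ₀ x))

/-- The closure of `D` in `L² × L²`. -/
def MemClosure (μ : Measure X) (D : (X → V →L[ℝ] V) → (X → ι → V →L[ℝ] V) → Prop)
    (σ : X → V →L[ℝ] V) (α : X → ι → V →L[ℝ] V) : Prop :=
  AEStronglyMeasurable σ μ ∧ AEStronglyMeasurable α μ ∧
    ∃ (s : ℕ → X → V →L[ℝ] V) (a : ℕ → X → ι → V →L[ℝ] V), (∀ k, D (s k) (a k)) ∧
      Tendsto (fun k => eLpNorm (s k - σ) 2 μ) atTop (𝓝 0) ∧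
      Tendsto (fun k => eLpNorm (a k - α) 2 μ) atTop (𝓝 0)

variable {D : (X → V →L[ℝ] V) → (X → ι → V →L[ℝ] V) → Prop}
  {σ τ : X → V →L[ℝ] V} {α β : X → ι → V →L[ℝ] V}

section NoFinite

lemma eLpNorm_sub_self {E : Type*} [NormedAddCommGroup E] (f : X → E) :
    eLpNorm (f - f) 2 μ = 0 := by
  rw [sub_self]
  exact eLpNorm_zero

lemma IsJetAlgebra.memClosure (hD : IsJetAlgebra μ D) (h : D σ α) : MemClosure μ D σ α :=
  ⟨hD.aesm_fst h, hD.aesm_snd h, fun _ => σ, fun _ => α, fun _ => h,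
    tendsto_const_nhds.congr fun _ => (eLpNorm_sub_self σ).symm,
    tendsto_const_nhds.congr fun _ => (eLpNorm_sub_self α).symm⟩

lemma MemClosure.congr (h : MemClosure μ D σ α) (hσ : σ =ᵐ[μ] τ) (hα : α =ᵐ[μ] β) :
    MemClosure μ D τ β := by
  obtain ⟨h1, h2, s, a, hs, ha, hb⟩ := h
  refine ⟨h1.congr hσ, h2.congr hα, s, a, hs, ?_, ?_⟩
  · refine ha.congr fun k => eLpNorm_congr_ae ?_
    filter_upwards [hσ] with x hx
    simp [hx]
  · refine hb.congr fun k => eLpNorm_congr_ae ?_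
    filter_upwards [hα] with x hx
    simp [hx]

/-- Elements of the closure are limits almost everywhere and in `L²` of elements of `D`. -/
lemma IsJetAlgebra.exists_approx (hD : IsJetAlgebra μ D) (h : MemClosure μ D σ α) :
    ∃ (s : ℕ → X → V →L[ℝ] V) (a : ℕ → X → ι → V →L[ℝ] V), (∀ k, D (s k) (a k)) ∧
      Tendsto (fun k => eLpNorm (s k - σ) 2 μ) atTop (𝓝 0) ∧
      Tendsto (fun k => eLpNorm (a k - α) 2 μ) atTop (𝓝 0) ∧
      (∀ᵐ x ∂μ, Tendsto (fun k => s k x) atTop (𝓝 (σ x))) ∧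
      ∀ᵐ x ∂μ, Tendsto (fun k => a k x) atTop (𝓝 (α x)) := by
  obtain ⟨h1, h2, s, a, hs, ha, hb⟩ := h
  obtain ⟨φ, hφ, h3⟩ := exists_subseq_tendsto_ae (fun k => hD.aesm_fst (hs k)) h1 ha
  obtain ⟨ψ, hψ, h4⟩ := exists_subseq_tendsto_ae (fun k => hD.aesm_snd (hs (φ k))) h2
    (hb.comp hφ.tendsto_atTop)
  refine ⟨fun k => s (φ (ψ k)), fun k => a (φ (ψ k)), fun k => hs _,
    ha.comp (hφ.comp hψ).tendsto_atTop, hb.comp (hφ.comp hψ).tendsto_atTop, ?_, h4⟩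
  filter_upwards [h3] with x hx
  exact hx.comp hψ.tendsto_atTop

lemma IsJetAlgebra.memClosure_add (hD : IsJetAlgebra μ D) (h : MemClosure μ D σ α)
    (h' : MemClosure μ D τ β) : MemClosure μ D (fun x => σ x + τ x) (fun x => α x + β x) := by
  obtain ⟨h1, h2, s, a, hs, ha, hb⟩ := h
  obtain ⟨h1', h2', s', a', hs', ha', hb'⟩ := h'
  exact ⟨h1.add h1', h2.add h2', _, _, fun k => hD.add (hs k) (hs' k),
    tendsto_eLpNorm_add (fun k => hD.aesm_fst (hs k)) h1 (fun k => hD.aesm_fst (hs' k)) h1' ha ha',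
    tendsto_eLpNorm_add (fun k => hD.aesm_snd (hs k)) h2 (fun k => hD.aesm_snd (hs' k)) h2' hb hb'⟩

lemma IsJetAlgebra.memClosure_smul (hD : IsJetAlgebra μ D) (c : ℝ) (h : MemClosure μ D σ α) :
    MemClosure μ D (fun x => c • σ x) (fun x => c • α x) := by
  obtain ⟨h1, h2, s, a, hs, ha, hb⟩ := h
  refine ⟨h1.const_smul c, h2.const_smul c, _, _, fun k => hD.smul c (hs k), ?_, ?_⟩
  · have e : ∀ k, eLpNorm ((fun x => c • s k x) - fun x => c • σ x) 2 μ
        = ‖c‖ₑ * eLpNorm (s k - σ) 2 μ := fun k => by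
      rw [← eLpNorm_const_smul, smul_sub]
      rfl
    simp only [e]
    simpa using ENNReal.Tendsto.const_mul ha (Or.inr enorm_ne_top)
  · have e : ∀ k, eLpNorm ((fun x => c • a k x) - fun x => c • α x) 2 μ
        = ‖c‖ₑ * eLpNorm (a k - α) 2 μ := fun k => by
      rw [← eLpNorm_const_smul, smul_sub]
      rfl
    simp only [e]
    simpa using ENNReal.Tendsto.const_mul hb (Or.inr enorm_ne_top)

lemma IsJetAlgebra.memClosure_sub (hD : IsJetAlgebra μ D) (h : MemClosure μ D σ α)
    (h' : MemClosure μ D τ β) : MemClosure μ D (fun x => σ x - τ x) (fun x => α x - β x) := by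
  have := hD.memClosure_add h (hD.memClosure_smul (-1) h')
  simpa [sub_eq_add_neg] using this

/-- The derivative is determined by the field, up to null sets. -/
lemma IsJetAlgebra.ae_eq_of_memClosure (hD : IsJetAlgebra μ D) (h : MemClosure μ D σ α)
    (h' : MemClosure μ D σ β) : α =ᵐ[μ] β := by
  obtain ⟨h1, h2, s, a, hs, ha, hb⟩ := hD.memClosure_sub h h'
  have e : (fun x => σ x - σ x) = 0 := by
    funext x
    simp
  rw [e] at ha
  have h3 := hD.closable hs h2 (by simpa using ha) hb
  filter_upwards [h3] with x hx
  exact sub_eq_zero.1 hx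

/-- The closure is closed. -/
lemma IsJetAlgebra.memClosure_of_tendsto (hD : IsJetAlgebra μ D) {s : ℕ → X → V →L[ℝ] V}
    {a : ℕ → X → ι → V →L[ℝ] V} (hs : ∀ k, MemClosure μ D (s k) (a k))
    (hσ : AEStronglyMeasurable σ μ) (hα : AEStronglyMeasurable α μ)
    (h1 : Tendsto (fun k => eLpNorm (s k - σ) 2 μ) atTop (𝓝 0))
    (h2 : Tendsto (fun k => eLpNorm (a k - α) 2 μ) atTop (𝓝 0)) : MemClosure μ D σ α := by
  have key : ∀ k : ℕ, ∃ (s' : X → V →L[ℝ] V) (a' : X → ι → V →L[ℝ] V), D s' a' ∧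
      eLpNorm (s' - s k) 2 μ ≤ ((k : ENNReal) + 1)⁻¹ ∧
      eLpNorm (a' - a k) 2 μ ≤ ((k : ENNReal) + 1)⁻¹ := by
    intro k
    obtain ⟨-, -, s', a', hs', e1, e2⟩ := hs k
    have hpos : (0 : ENNReal) < ((k : ENNReal) + 1)⁻¹ := by simp
    obtain ⟨j, hj, hj'⟩ := ((e1.eventually (ge_mem_nhds hpos)).and
      (e2.eventually (ge_mem_nhds hpos))).exists
    exact ⟨s' j, a' j, hs' j, hj, hj'⟩
  choose s' a' hD' e1 e2 using key
  have hlim : Tendsto (fun k : ℕ => ((k : ENNReal) + 1)⁻¹) atTop (𝓝 0) := by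
    have := (ENNReal.tendsto_inv_nat_nhds_zero).comp (tendsto_add_atTop_nat 1)
    simpa [Function.comp_def] using this
  refine ⟨hσ, hα, s', a', hD', ?_, ?_⟩
  · refine tendsto_of_tendsto_of_tendsto_of_le_of_le tendsto_const_nhds
      (by simpa using hlim.add h1) (fun k => zero_le) fun k => ?_
    have e : s' k - σ = (s' k - s k) + (s k - σ) := by abel
    beta_reduce
    rw [e]
    refine (eLpNorm_add_le ((hD.aesm_fst (hD' k)).sub (hs k).1) ((hs k).1.sub hσ)
      (by norm_num)).trans ?_
    gcongr
    exact e1 k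
  · refine tendsto_of_tendsto_of_tendsto_of_le_of_le tendsto_const_nhds
      (by simpa using hlim.add h2) (fun k => zero_le) fun k => ?_
    have e : a' k - α = (a' k - a k) + (a k - α) := by abel
    beta_reduce
    rw [e]
    refine (eLpNorm_add_le ((hD.aesm_snd (hD' k)).sub (hs k).2.1) ((hs k).2.1.sub hα)
      (by norm_num)).trans ?_
    gcongr
    exact e2 k

lemma continuous_star_pi : Continuous fun (α : ι → V →L[ℝ] V) a => star (α a) :=
  continuous_pi fun a => (continuous_apply a).star

lemma IsJetAlgebra.memClosure_star (hD : IsJetAlgebra μ D) (h : MemClosure μ D σ α) :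
    MemClosure μ D (fun x => star (σ x)) (fun x a => star (α x a)) := by
  obtain ⟨h1, h2, s, a, hs, ha, hb⟩ := h
  refine ⟨continuous_star.comp_aestronglyMeasurable h1,
    continuous_star_pi.comp_aestronglyMeasurable h2, _, _, fun k => hD.star_mem (hs k), ?_, ?_⟩
  · refine ha.congr fun k => eLpNorm_congr_norm_ae (Eventually.of_forall fun x => ?_)
    simp only [Pi.sub_apply]
    rw [← star_sub, norm_star_end]
  · refine hb.congr fun k => eLpNorm_congr_norm_ae (Eventually.of_forall fun x => ?_)
    have e : (fun i => star (a k x i)) - (fun i => star (α x i)) = fun i => star ((a k x - α x) i) := by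
      funext i
      simp
    simp only [Pi.sub_apply]
    rw [e, Pi.norm_def, Pi.norm_def]
    congr 2
    funext i
    ext
    simp only [coe_nnnorm, Pi.sub_apply]
    rw [norm_star_end]

end NoFinite

end Jets

end

section

/-! ### Bounded elements of the Sobolev space: approximation and products -/

section Jets

variable {X : Type*} [MeasurableSpace X] {μ : Measure X}
  {V : Type*} [NormedAddCommGroup V] [InnerProductSpace ℝ V] [FiniteDimensional ℝ V]
  {ι : Type*} [Fintype ι]
  {D : (X → V →L[ℝ] V) → (X → ι → V →L[ℝ] V) → Prop}
  {σ τ : X → V →L[ℝ] V} {α β : X → ι → V →L[ℝ] V}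

variable [IsFiniteMeasure μ]

lemma IsJetAlgebra.memLp_fst (hD : IsJetAlgebra μ D) (h : D σ α) : MemLp σ 2 μ := by
  obtain ⟨C, hC⟩ := hD.bdd h
  exact MemLp.of_bound (hD.aesm_fst h) C (Eventually.of_forall fun x => (hC x).1)

lemma IsJetAlgebra.memLp_snd (hD : IsJetAlgebra μ D) (h : D σ α) : MemLp α 2 μ := by
  obtain ⟨C, hC⟩ := hD.bdd h
  exact MemLp.of_bound (hD.aesm_snd h) C (Eventually.of_forall fun x => (hC x).2)

lemma IsJetAlgebra.memLp_fst_of_memClosure (hD : IsJetAlgebra μ D) (h : MemClosure μ D σ α) :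
    MemLp σ 2 μ := by
  obtain ⟨h1, h2, s, a, hs, ha, hb⟩ := h
  exact memLp_two_of_tendsto (fun k => hD.memLp_fst (hs k)) h1 ha

lemma IsJetAlgebra.memLp_snd_of_memClosure (hD : IsJetAlgebra μ D) (h : MemClosure μ D σ α) :
    MemLp α 2 μ := by
  obtain ⟨h1, h2, s, a, hs, ha, hb⟩ := h
  exact memLp_two_of_tendsto (fun k => hD.memLp_snd (hs k)) h2 hb

/-- A smooth cutoff of the line, with the bounds on its derivative. -/
lemma exists_cutoff {R : ℝ} (hR : 0 < R) : ∃ (χ : ℝ → ℝ) (K : ℝ), ContDiff ℝ ∞ χ ∧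
    (∀ t, |χ t| ≤ 1) ∧ (∀ t, |deriv χ t| ≤ K) ∧
    (∀ t, |t| < R → χ t = 1 ∧ deriv χ t = 0) ∧ ∀ t, R + 1 < |t| → χ t = 0 ∧ deriv χ t = 0 := by
  let f : ContDiffBump (0 : ℝ) := ⟨R, R + 1, hR, by linarith⟩
  have hs : ContDiff ℝ ∞ f := f.contDiff
  have hc : HasCompactSupport f := f.hasCompactSupport
  obtain ⟨K, hK⟩ := (hc.deriv).exists_bound_of_continuous (hs.continuous_deriv (by simp))
  refine ⟨f, K, hs, fun t => ?_, fun t => by simpa using hK t, fun t ht => ?_, fun t ht => ?_⟩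
  · rw [abs_of_nonneg f.nonneg]
    exact f.le_one
  · have h : (f : ℝ → ℝ) =ᶠ[𝓝 t] fun _ => 1 := by
      filter_upwards [Metric.isOpen_ball.mem_nhds (show t ∈ Metric.ball (0 : ℝ) R by simpa using ht)]
        with y hy
      exact f.one_of_mem_closedBall (Metric.ball_subset_closedBall hy)
    exact ⟨h.self_of_nhds, by rw [h.deriv_eq]; simp⟩
  · have h : (f : ℝ → ℝ) =ᶠ[𝓝 t] fun _ => 0 := by
      have ho : IsOpen {y : ℝ | R + 1 < |y|} := isOpen_lt continuous_const continuous_abs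
      filter_upwards [ho.mem_nhds ht] with y hy
      refine f.zero_of_le_dist ?_
      have : R + 1 < |y| := hy
      simpa [f] using this.le
    exact ⟨h.self_of_nhds, by rw [h.deriv_eq]; simp⟩

/-- The pointwise bounds for the truncation `χ(|σ|²) σ` and its derivative. -/
lemma truncation_bounds {R K : ℝ} {χ : ℝ → ℝ} (hR : 0 < R) (h1 : ∀ t, |χ t| ≤ 1)
    (h2 : ∀ t, |deriv χ t| ≤ K) (h3 : ∀ t, R + 1 < |t| → χ t = 0 ∧ deriv χ t = 0)
    (σ : V →L[ℝ] V) (α : ι → V →L[ℝ] V) :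
    ‖χ (traceL V (star σ * σ)) • σ‖ ≤ √(R + 1) ∧
    ‖χ (traceL V (star σ * σ)) • σ‖ ≤ 1 * ‖σ‖ ∧
    ‖(fun a => (deriv χ (traceL V (star σ * σ)) * traceL V (star (α a) * σ + star σ * α a)) • σ
      + χ (traceL V (star σ * σ)) • α a)‖
      ≤ (K * (Module.finrank ℝ V * (2 * √(R + 1))) * √(R + 1) + 1) * ‖α‖ := by
  set t := traceL V (star σ * σ) with ht
  have hK : 0 ≤ K := (abs_nonneg _).trans (h2 0)
  have hσt : ‖σ‖ ^ 2 ≤ t := norm_sq_le_hs σ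
  have hσ : |t| ≤ R + 1 → ‖σ‖ ≤ √(R + 1) := fun h =>
    Real.le_sqrt_of_sq_le (hσt.trans ((le_abs_self t).trans h))
  have e : ‖χ t • σ‖ ≤ 1 * ‖σ‖ := by
    rw [norm_smul]
    gcongr
    exact h1 t
  refine ⟨?_, e, ?_⟩
  · rcases le_or_gt |t| (R + 1) with h | h
    · rw [one_mul] at e
      exact e.trans (hσ h)
    · rw [(h3 t h).1, zero_smul, norm_zero]
      positivity
  · refine (pi_norm_le_iff_of_nonneg (by positivity)).2 fun a => ?_
    rcases le_or_gt |t| (R + 1) with h | h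
    · have hs := hσ h
      have hα := norm_le_pi_norm α a
      have htr : |traceL V (star (α a) * σ + star σ * α a)|
          ≤ Module.finrank ℝ V * (2 * √(R + 1)) * ‖α‖ := by
        refine (abs_traceL_le _).trans ?_
        rw [mul_assoc]
        gcongr
        have n1 : ‖star (α a) * σ‖ ≤ ‖α‖ * √(R + 1) := by
          refine (norm_mul_le _ _).trans ?_
          rw [norm_star_end]
          gcongr
        have n2 : ‖star σ * α a‖ ≤ √(R + 1) * ‖α‖ := by
          refine (norm_mul_le _ _).trans ?_
          rw [norm_star_end]
          gcongr
        refine (norm_add_le _ _).trans ?_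
        linarith
      refine (norm_add_le _ _).trans ?_
      rw [norm_smul, norm_smul, norm_mul, Real.norm_eq_abs, Real.norm_eq_abs, Real.norm_eq_abs]
      have b1 : |deriv χ t| * |traceL V (star (α a) * σ + star σ * α a)| * ‖σ‖
          ≤ K * (Module.finrank ℝ V * (2 * √(R + 1)) * ‖α‖) * √(R + 1) := by
        gcongr
        exact h2 t
      have b2 : |χ t| * ‖α a‖ ≤ 1 * ‖α‖ := by
        gcongr
        exact h1 t
      linarith
    · rw [(h3 t h).1, (h3 t h).2]
      simp only [zero_mul, zero_smul, add_zero, norm_zero]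
      positivity

/-- A bounded element of the closure is the limit of uniformly bounded elements of `D`. -/
lemma IsJetAlgebra.exists_bdd_approx (hD : IsJetAlgebra μ D) (h : MemClosure μ D σ α) {C : ℝ}
    (hC : ∀ᵐ x ∂μ, ‖σ x‖ ≤ C) :
    ∃ (K : ℝ) (s : ℕ → X → V →L[ℝ] V) (a : ℕ → X → ι → V →L[ℝ] V), (∀ k, D (s k) (a k)) ∧
      (∀ k x, ‖s k x‖ ≤ K) ∧
      Tendsto (fun k => eLpNorm (s k - σ) 2 μ) atTop (𝓝 0) ∧
      Tendsto (fun k => eLpNorm (a k - α) 2 μ) atTop (𝓝 0) ∧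
      (∀ᵐ x ∂μ, Tendsto (fun k => s k x) atTop (𝓝 (σ x))) ∧
      ∀ᵐ x ∂μ, Tendsto (fun k => a k x) atTop (𝓝 (α x)) := by
  obtain ⟨s, a, hs, l1, l2, p1, p2⟩ := hD.exists_approx h
  have hR : 0 < (Module.finrank ℝ V : ℝ) * C ^ 2 + 1 := by positivity
  obtain ⟨χ, K, c0, c1, c2, c3, c4⟩ := exists_cutoff hR
  have hK : 0 ≤ K := (abs_nonneg _).trans (c2 0)
  set R := (Module.finrank ℝ V : ℝ) * C ^ 2 + 1
  have hs' : ∀ k, D _ _ := fun k => hD.trace_smul (hD.mul (hD.star_mem (hs k)) (hs k)) (hs k) c0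
  have hb := fun k x => truncation_bounds hR c1 c2 c4 (s k x) (a k x)
  -- near almost every point the truncation is eventually inactive
  have hev : ∀ᵐ x ∂μ, ∀ᶠ k in atTop, |traceL V (star (s k x) * s k x)| < R := by
    filter_upwards [p1, hC] with x hx hCx
    have ht : Tendsto (fun k => |traceL V (star (s k x) * s k x)|) atTop
        (𝓝 |traceL V (star (σ x) * σ x)|) :=
      (((traceL V).continuous.tendsto _).comp ((continuous_star.tendsto _ |>.comp hx).mul hx)).abs
    refine ht.eventually (gt_mem_nhds ?_)
    have h1 : traceL V (star (σ x) * σ x) ≤ Module.finrank ℝ V * ‖σ x‖ ^ 2 := hs_self_le (σ x)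
    have h2 : 0 ≤ traceL V (star (σ x) * σ x) := hs_self_nonneg (σ x)
    rw [abs_of_nonneg h2]
    calc _ ≤ (Module.finrank ℝ V : ℝ) * C ^ 2 := h1.trans (by gcongr)
      _ < R := by simp [R]
  have q1 : ∀ᵐ x ∂μ, Tendsto (fun k => χ (traceL V (star (s k x) * s k x)) • s k x) atTop
      (𝓝 (σ x)) := by
    filter_upwards [p1, hev] with x hx hxe
    refine hx.congr' ?_
    filter_upwards [hxe] with k hk
    rw [(c3 _ hk).1, one_smul]
  have q2 : ∀ᵐ x ∂μ, Tendsto (fun k i =>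
      (deriv χ (traceL V (star (s k x) * s k x))
        * traceL V (star (a k x i) * s k x + star (s k x) * a k x i)) • s k x
      + χ (traceL V (star (s k x) * s k x)) • a k x i) atTop (𝓝 (α x)) := by
    filter_upwards [p2, hev] with x hx hxe
    refine hx.congr' ?_
    filter_upwards [hxe] with k hk
    rw [(c3 _ hk).1, (c3 _ hk).2]
    simp
  refine ⟨√(R + 1), _, _, hs', fun k x => (hb k x).1, ?_, ?_, q1, q2⟩
  · exact tendsto_eLpNorm_sub_of_dominated zero_le_one (fun k => hD.aesm_fst (hs k))
      (hD.memLp_fst_of_memClosure h) l1 (fun k => hD.aesm_fst (hs' k))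
      (fun k => Eventually.of_forall fun x => (hb k x).2.1) p1 q1
  · exact tendsto_eLpNorm_sub_of_dominated (by positivity) (fun k => hD.aesm_snd (hs k))
      (hD.memLp_snd_of_memClosure h) l2 (fun k => hD.aesm_snd (hs' k))
      (fun k => Eventually.of_forall fun x => (hb k x).2.2) p2 q2

lemma norm_mul_tuple_le (σ : V →L[ℝ] V) (α : ι → V →L[ℝ] V) :
    ‖fun i => σ * α i‖ ≤ ‖σ‖ * ‖α‖ := by
  refine (pi_norm_le_iff_of_nonneg (by positivity)).2 fun i => (norm_mul_le _ _).trans ?_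
  gcongr
  exact norm_le_pi_norm α i

lemma norm_tuple_mul_le (σ : V →L[ℝ] V) (α : ι → V →L[ℝ] V) :
    ‖fun i => α i * σ‖ ≤ ‖σ‖ * ‖α‖ := by
  refine (pi_norm_le_iff_of_nonneg (by positivity)).2 fun i => (norm_mul_le _ _).trans ?_
  rw [mul_comm]
  gcongr
  exact norm_le_pi_norm α i

lemma aestronglyMeasurable_mul_tuple (hσ : AEStronglyMeasurable σ μ)
    (hα : AEStronglyMeasurable α μ) : AEStronglyMeasurable (fun x i => σ x * α x i) μ := by
  have hc : Continuous fun z : (V →L[ℝ] V) × (ι → V →L[ℝ] V) => fun i => z.1 * z.2 i :=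
    continuous_pi fun i => continuous_fst.mul ((continuous_apply i).comp continuous_snd)
  exact hc.comp_aestronglyMeasurable (hσ.prodMk hα)

lemma aestronglyMeasurable_tuple_mul (hσ : AEStronglyMeasurable σ μ)
    (hα : AEStronglyMeasurable α μ) : AEStronglyMeasurable (fun x i => α x i * σ x) μ := by
  have hc : Continuous fun z : (V →L[ℝ] V) × (ι → V →L[ℝ] V) => fun i => z.2 i * z.1 :=
    continuous_pi fun i => ((continuous_apply i).comp continuous_snd).mul continuous_fst
  exact hc.comp_aestronglyMeasurable (hσ.prodMk hα)

/-- The Leibniz rule for bounded elements of the closure. -/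
lemma IsJetAlgebra.memClosure_mul (hD : IsJetAlgebra μ D) (h : MemClosure μ D σ α)
    (h' : MemClosure μ D τ β) {C C' : ℝ} (hC : ∀ᵐ x ∂μ, ‖σ x‖ ≤ C) (hC' : ∀ᵐ x ∂μ, ‖τ x‖ ≤ C') :
    MemClosure μ D (fun x => σ x * τ x) (fun x a => α x a * τ x + σ x * β x a) := by
  obtain ⟨K, s, a, hs, hK, l1, l2, p1, p2⟩ := hD.exists_bdd_approx h hC
  obtain ⟨K', s', a', hs', hK', l1', l2', p1', p2'⟩ := hD.exists_bdd_approx h' hC'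
  have m := fun k => hD.aesm_fst (hs k)
  have m' := fun k => hD.aesm_fst (hs' k)
  have n := fun k => hD.aesm_snd (hs k)
  have n' := fun k => hD.aesm_snd (hs' k)
  have A1 := aestronglyMeasurable_tuple_mul h'.1 h.2.1
  have A2 := aestronglyMeasurable_mul_tuple h.1 h'.2.1
  have B1 := fun k => aestronglyMeasurable_tuple_mul (m' k) (n k)
  have B2 := fun k => aestronglyMeasurable_mul_tuple (m k) (n' k)
  refine ⟨h.1.mul h'.1, A1.add A2, _, _, fun k => hD.mul (hs k) (hs' k), ?_, ?_⟩
  · refine tendsto_eLpNorm_sub_of_dominated (C := max K' 0) (le_max_right _ _) m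
      (hD.memLp_fst_of_memClosure h) l1 (fun k => (m k).mul (m' k))
      (fun k => Eventually.of_forall fun x => ?_) p1 ?_
    · refine (norm_mul_le _ _).trans ?_
      rw [mul_comm]
      gcongr
      exact (hK' k x).trans (le_max_left _ _)
    · filter_upwards [p1, p1'] with x hx hx'
      exact hx.mul hx'
  · refine tendsto_eLpNorm_add B1 A1 B2 A2 ?_ ?_
    · refine tendsto_eLpNorm_sub_of_dominated (C := max K' 0) (le_max_right _ _) n
        (hD.memLp_snd_of_memClosure h) l2 B1 (fun k => Eventually.of_forall fun x => ?_) p2 ?_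
      · refine (norm_tuple_mul_le _ _).trans ?_
        gcongr
        exact (hK' k x).trans (le_max_left _ _)
      · filter_upwards [p2, p1'] with x hx hx'
        exact tendsto_pi_nhds.2 fun i => ((tendsto_pi_nhds.1 hx) i).mul hx'
    · refine tendsto_eLpNorm_sub_of_dominated (C := max K 0) (le_max_right _ _) n'
        (hD.memLp_snd_of_memClosure h') l2' B2 (fun k => Eventually.of_forall fun x => ?_) p2' ?_
      · refine (norm_mul_tuple_le _ _).trans ?_
        gcongr
        exact (hK k x).trans (le_max_left _ _)
      · filter_upwards [p2', p1] with x hx hx'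
        exact tendsto_pi_nhds.2 fun i => hx'.mul ((tendsto_pi_nhds.1 hx) i)

lemma IsJetAlgebra.ae_star_eq_neg (hD : IsJetAlgebra μ D) (h : MemClosure μ D σ α)
    (hσ : ∀ᵐ x ∂μ, star (σ x) = -σ x) : ∀ᵐ x ∂μ, ∀ i, star (α x i) = -α x i := by
  have h1 := (hD.memClosure_star h).congr (τ := fun x => (-1 : ℝ) • σ x) (β := _)
    (by filter_upwards [hσ] with x hx; simpa using hx) (EventuallyEq.refl _ _)
  filter_upwards [hD.ae_eq_of_memClosure h1 (hD.memClosure_smul (-1) h)] with x hx i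
  simpa using congrFun hx i

/-- The resolvent at `1` of a skew-symmetric element of the closure. -/
lemma IsJetAlgebra.memClosure_inverse (hD : IsJetAlgebra μ D) (h : MemClosure μ D σ α)
    (hσ : ∀ᵐ x ∂μ, star (σ x) = -σ x) :
    MemClosure μ D (fun x => Ring.inverse (1 - σ x))
      (fun x i => Ring.inverse (1 - σ x) * α x i * Ring.inverse (1 - σ x)) := by
  -- the approximations are made skew-symmetric at every point
  obtain ⟨s, a, hs, l1, l2, p1, p2⟩ := hD.exists_approx h
  have hα := hD.ae_star_eq_neg h hσ
  let s' : ℕ → X → V →L[ℝ] V := fun k x => (1 / 2 : ℝ) • (s k x + (-1 : ℝ) • star (s k x))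
  let a' : ℕ → X → ι → V →L[ℝ] V :=
    fun k x => (1 / 2 : ℝ) • (a k x + (-1 : ℝ) • fun i => star (a k x i))
  have hs' : ∀ k, D (s' k) (a' k) := fun k =>
    hD.smul _ (hD.add (hs k) (hD.smul _ (hD.star_mem (hs k))))
  have hsk : ∀ k x, star (s' k x) = -s' k x := fun k x => by
    simp only [s', star_smul, star_add, star_star, star_trivial]
    module
  have q1 : ∀ᵐ x ∂μ, Tendsto (fun k => s' k x) atTop (𝓝 (σ x)) := by
    filter_upwards [p1, hσ] with x hx hx'
    have e : σ x = (1 / 2 : ℝ) • (σ x + (-1 : ℝ) • star (σ x)) := by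
      rw [hx']
      module
    rw [e]
    exact (hx.add (((continuous_star.tendsto _).comp hx).const_smul _)).const_smul _
  have q2 : ∀ᵐ x ∂μ, Tendsto (fun k => a' k x) atTop (𝓝 (α x)) := by
    filter_upwards [p2, hα] with x hx hx'
    have e : α x = (1 / 2 : ℝ) • (α x + (-1 : ℝ) • fun i => star (α x i)) := by
      funext i
      simp only [Pi.smul_apply, Pi.add_apply, hx' i]
      module
    rw [e]
    exact (hx.add (((continuous_star_pi.tendsto _).comp hx).const_smul _)).const_smul _
  have l2' : Tendsto (fun k => eLpNorm (a' k - α) 2 μ) atTop (𝓝 0) := by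
    refine tendsto_eLpNorm_sub_of_dominated zero_le_one (fun k => hD.aesm_snd (hs k))
      (hD.memLp_snd_of_memClosure h) l2 (fun k => hD.aesm_snd (hs' k))
      (fun k => Eventually.of_forall fun x => ?_) p2 q2
    refine (pi_norm_le_iff_of_nonneg (by positivity)).2 fun i => ?_
    have n1 : ‖a k x i‖ ≤ ‖a k x‖ := norm_le_pi_norm _ i
    have n2 : ‖(-1 : ℝ) • star (a k x i)‖ ≤ ‖a k x‖ := by
      rw [norm_smul, norm_star_end]
      simpa using n1
    calc ‖(1 / 2 : ℝ) • (a k x i + (-1 : ℝ) • star (a k x i))‖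
        = 1 / 2 * ‖a k x i + (-1 : ℝ) • star (a k x i)‖ := by
          rw [norm_smul]
          norm_num
      _ ≤ 1 / 2 * (‖a k x‖ + ‖a k x‖) := by
          gcongr
          exact (norm_add_le _ _).trans (by gcongr)
      _ = 1 * ‖a k x‖ := by ring
  have hG : ∀ k, D (fun x => Ring.inverse ((1 : V →L[ℝ] V) + (-1 : ℝ) • s' k x)) _ := fun k =>
    hD.inv (hD.add hD.one (hD.smul (-1) (hs' k))) fun x => by
      have := isUnit_one_sub_skew (hsk k x)
      simpa [sub_eq_add_neg] using this
  have eG : ∀ k x, Ring.inverse ((1 : V →L[ℝ] V) + (-1 : ℝ) • s' k x)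
      = Ring.inverse (1 - s' k x) := fun k x => by
    simp [sub_eq_add_neg]
  have hGn : ∀ k x, ‖Ring.inverse (1 - s' k x)‖ ≤ 1 := fun k x =>
    norm_inverse_one_sub_skew_le (hsk k x)
  have hG' : ∀ k, D (fun x => Ring.inverse (1 - s' k x))
      (fun x i => Ring.inverse (1 - s' k x) * a' k x i * Ring.inverse (1 - s' k x)) := fun k => by
    have := hG k
    simp only [eG] at this
    convert this using 3 with x i
    simp
  have q3 : ∀ᵐ x ∂μ, Tendsto (fun k => Ring.inverse (1 - s' k x)) atTop
      (𝓝 (Ring.inverse (1 - σ x))) := by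
    filter_upwards [q1, hσ] with x hx hx'
    obtain ⟨u, hu⟩ := isUnit_one_sub_skew hx'
    have hc := NormedRing.inverse_continuousAt u
    rw [hu] at hc
    exact hc.tendsto.comp (tendsto_const_nhds.sub hx)
  have q4 : ∀ᵐ x ∂μ, Tendsto (fun k i =>
      Ring.inverse (1 - s' k x) * a' k x i * Ring.inverse (1 - s' k x)) atTop
      (𝓝 fun i => Ring.inverse (1 - σ x) * α x i * Ring.inverse (1 - σ x)) := by
    filter_upwards [q2, q3] with x hx hx'
    exact tendsto_pi_nhds.2 fun i => (hx'.mul ((tendsto_pi_nhds.1 hx) i)).mul hx'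
  refine ⟨aestronglyMeasurable_of_tendsto_ae atTop (fun k => hD.aesm_fst (hG' k)) q3,
    aestronglyMeasurable_of_tendsto_ae atTop (fun k => hD.aesm_snd (hG' k)) q4, _, _, hG', ?_, ?_⟩
  · refine tendsto_eLpNorm_sub_of_dominated (u := fun _ _ => (1 : ℝ)) (u₀ := fun _ => (1 : ℝ))
      zero_le_one (fun k => aestronglyMeasurable_const) (memLp_const _)
      (tendsto_const_nhds.congr fun _ => (eLpNorm_sub_self _).symm)
      (fun k => hD.aesm_fst (hG' k)) (fun k => Eventually.of_forall fun x => ?_)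
      (Eventually.of_forall fun x => tendsto_const_nhds) q3
    simpa using hGn k x
  · refine tendsto_eLpNorm_sub_of_dominated zero_le_one (fun k => hD.aesm_snd (hs' k))
      (hD.memLp_snd_of_memClosure h) l2'
      (fun k => hD.aesm_snd (hG' k)) (fun k => Eventually.of_forall fun x => ?_) q2 q4
    refine (norm_tuple_mul_le _ (fun i => Ring.inverse (1 - s' k x) * a' k x i)).trans ?_
    have := hGn k x
    have h2 := norm_mul_tuple_le (Ring.inverse (1 - s' k x)) (a' k x)
    calc _ ≤ 1 * (1 * ‖a' k x‖) := by gcongr; exact h2.trans (by gcongr)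
      _ = _ := by ring

end Jets

end

section

/-! ### The Euler–Lagrange equation -/

section Cayley

variable {R : Type*} [Ring R] [StarRing R]

lemma cayley_aux {s G : R} (hs : star s = -s) (h1 : G * (1 - s) = 1) (h2 : (1 - s) * G = 1) :
    star G * G + star G * G = G + star G ∧ G * star G + G * star G = G + star G := by
  have h1' : (1 + s) * star G = 1 := by
    have := congrArg star h1
    simpa [star_mul, hs] using this
  have h2' : star G * (1 + s) = 1 := by
    have := congrArg star h2
    simpa [star_mul, hs] using this
  constructor
  · calc star G * G + star G * G = (star G * (1 + s)) * G + star G * ((1 - s) * G) := by noncomm_ring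
      _ = G + star G := by rw [h2', h2, one_mul, mul_one]
  · calc G * star G + G * star G = G * ((1 + s) * star G) + (G * (1 - s)) * star G := by noncomm_ring
      _ = G + star G := by rw [h1', h1, one_mul, mul_one]

lemma cayley_mul_star {G : R} (h : G * star G + G * star G = G + star G) :
    (G + G - 1) * star (G + G - 1) = 1 := by
  have e : (G + G - 1) * star (G + G - 1) = (G * star G + G * star G) + (G * star G + G * star G)
      - (G + star G) - (G + star G) + 1 := by
    simp only [star_sub, star_add, star_one]
    noncomm_ring
  rw [e, h]
  noncomm_ring

lemma cayley_star_mul {G : R} (h : star G * G + star G * G = G + star G) :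
    star (G + G - 1) * (G + G - 1) = 1 := by
  have e : star (G + G - 1) * (G + G - 1) = (star G * G + star G * G) + (star G * G + star G * G)
      - (G + star G) - (G + star G) + 1 := by
    simp only [star_sub, star_add, star_one]
    noncomm_ring
  rw [e, h]
  noncomm_ring

lemma star_mul_cayley {G : R} (h : star G * G + star G * G = G + star G) :
    star G * (G + G - 1) = G := by
  have e : star G * (G + G - 1) = star G * G + star G * G - star G := by noncomm_ring
  rw [e, h]
  noncomm_ring

lemma star_cayley_mul {G : R} (h : star G * G + star G * G = G + star G) :
    star (G + G - 1) * G = star G := by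
  have e : star (G + G - 1) * G = star G * G + star G * G - G := by
    simp only [star_sub, star_add, star_one]
    noncomm_ring
  rw [e, h]
  noncomm_ring

/-- The derivative of `C⋆ J C`, for `C = 2 G - 1` the Cayley transform of a skew-symmetric element
with derivative `b`, conjugated back by `C`. -/
lemma cayley_derivative {G J a b : R} (h : star G * G + star G * G = G + star G)
    (hb : star b = -b) :
    (star (G * b * G + G * b * G) * J + star (G + G - 1) * a) * (G + G - 1)
        + star (G + G - 1) * J * (G * b * G + G * b * G)
      = star (G + G - 1) * (a + ((J * (G * b * star G) - G * b * star G * J)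
        + (J * (G * b * star G) - G * b * star G * J))) * (G + G - 1) := by
  have e1 := star_mul_cayley h
  have e2 := star_cayley_mul h
  have e3 : star (G * b * G + G * b * G) = -(star G * b * star G) - star G * b * star G := by
    simp only [star_add, star_mul, hb]
    noncomm_ring
  set C := G + G - 1
  have e4 : star C * (a + ((J * (G * b * star G) - G * b * star G * J)
        + (J * (G * b * star G) - G * b * star G * J))) * C
      = star C * a * C + (star C * J * G * b * (star G * C) + star C * J * G * b * (star G * C))
        - ((star C * G) * b * star G * J * C + (star C * G) * b * star G * J * C) := by
    noncomm_ring
  rw [e4, e1, e2, e3]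
  noncomm_ring

end Cayley

section Jets

variable {X : Type*} [MeasurableSpace X] {μ : Measure X}
  {V : Type*} [NormedAddCommGroup V] [InnerProductSpace ℝ V] [FiniteDimensional ℝ V]
  {ι : Type*} [Fintype ι]
  {D : (X → V →L[ℝ] V) → (X → ι → V →L[ℝ] V) → Prop}
  {J : X → V →L[ℝ] V} {a : X → ι → V →L[ℝ] V}

/-- An orthogonal complex structure of an inner product space. -/
def IsOrthogonalStructure (J : V →L[ℝ] V) : Prop := star J = -J ∧ J * J = -1

lemma IsOrthogonalStructure.norm_le {J : V →L[ℝ] V} (h : IsOrthogonalStructure J) : ‖J‖ ≤ 1 := by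
  refine J.opNorm_le_bound zero_le_one fun v => ?_
  have h1 : inner ℝ (J v) (J v) = inner ℝ v v := by
    rw [← ContinuousLinearMap.adjoint_inner_right, ← ContinuousLinearMap.star_eq_adjoint, h.1,
      neg_apply, ← mul_apply_eq_comp, h.2]
    simp
  rw [real_inner_self_eq_norm_sq, real_inner_self_eq_norm_sq] at h1
  rw [one_mul]
  exact le_of_sq_le_sq h1.le (norm_nonneg _)

variable (μ D) in
/-- The abstract admissible pairs `(J, ∇J)`. -/
def MemStructures (J : X → V →L[ℝ] V) (a : X → ι → V →L[ℝ] V) : Prop :=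
  MemClosure μ D J a ∧ ∀ᵐ x ∂μ, IsOrthogonalStructure (J x)

lemma aestronglyMeasurable_hsGrad {α β : X → ι → V →L[ℝ] V} (hα : AEStronglyMeasurable α μ)
    (hβ : AEStronglyMeasurable β μ) : AEStronglyMeasurable (fun x => hsGrad (α x) (β x)) μ := by
  have hc : Continuous fun z : (ι → V →L[ℝ] V) × (ι → V →L[ℝ] V) => hsGrad z.1 z.2 :=
    continuous_hsGrad continuous_fst continuous_snd
  have h := hc.comp_aestronglyMeasurable (hα.prodMk hβ)
  exact h

lemma aestronglyMeasurable_hs {σ τ : X → V →L[ℝ] V} (hσ : AEStronglyMeasurable σ μ)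
    (hτ : AEStronglyMeasurable τ μ) : AEStronglyMeasurable (fun x => hs (σ x) (τ x)) μ := by
  have hc : Continuous fun z : (V →L[ℝ] V) × (V →L[ℝ] V) => hs z.1 z.2 :=
    continuous_hs continuous_fst continuous_snd
  have h := hc.comp_aestronglyMeasurable (hσ.prodMk hτ)
  exact h

lemma integrable_hsGrad {α β : X → ι → V →L[ℝ] V} (hα : MemLp α 2 μ) (hβ : MemLp β 2 μ) :
    Integrable (fun x => hsGrad (α x) (β x)) μ := by
  refine Integrable.mono' ((hα.norm.integrable_mul hβ.norm).const_mul
    (Fintype.card ι * Module.finrank ℝ V : ℝ)) (aestronglyMeasurable_hsGrad hα.1 hβ.1)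
    (Eventually.of_forall fun x => ?_)
  exact abs_hsGrad_le _ _

variable [IsFiniteMeasure μ]

/-- The derivative of a complex structure anticommutes with it and is skew-symmetric. -/
lemma IsJetAlgebra.anticomm (hD : IsJetAlgebra μ D) (h : MemStructures μ D J a) :
    ∀ᵐ x ∂μ, ∀ i, star (a x i) = -a x i ∧ a x i * J x = -(J x * a x i) := by
  have hn : ∀ᵐ x ∂μ, ‖J x‖ ≤ 1 := h.2.mono fun x hx => hx.norm_le
  have h1 := (hD.memClosure_mul h.1 h.1 hn hn).congr (τ := fun _ => (-1 : ℝ) • (1 : V →L[ℝ] V))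
    (by filter_upwards [h.2] with x hx; simpa using hx.2) (EventuallyEq.refl _ _)
  have h2 := hD.ae_eq_of_memClosure h1 (hD.memClosure_smul (-1) (hD.memClosure hD.one))
  filter_upwards [hD.ae_star_eq_neg h.1 (h.2.mono fun x hx => hx.1), h2] with x hx hx2 i
  refine ⟨hx i, ?_⟩
  have := congrFun hx2 i
  simp only [smul_zero, Pi.zero_apply] at this
  exact eq_neg_of_add_eq_zero_left this

/-- The variation `C⋆ J C` of a complex structure by the Cayley transform `C = (1 + B)(1 - B)⁻¹`
of a skew-symmetric field `B`. -/
lemma IsJetAlgebra.memStructures_cayley (hD : IsJetAlgebra μ D) (h : MemStructures μ D J a)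
    {B : X → V →L[ℝ] V} {b : X → ι → V →L[ℝ] V} (hB : MemClosure μ D B b)
    (hsk : ∀ᵐ x ∂μ, star (B x) = -B x) :
    ∃ (K : X → V →L[ℝ] V) (k : X → ι → V →L[ℝ] V), MemStructures μ D K k ∧
      ∀ᵐ x ∂μ, hsGrad (k x) (k x) = hsGrad (a x + (2 : ℝ) • fun i =>
        J x * (Ring.inverse (1 - B x) * b x i * star (Ring.inverse (1 - B x)))
          - Ring.inverse (1 - B x) * b x i * star (Ring.inverse (1 - B x)) * J x)
        (a x + (2 : ℝ) • fun i =>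
        J x * (Ring.inverse (1 - B x) * b x i * star (Ring.inverse (1 - B x)))
          - Ring.inverse (1 - B x) * b x i * star (Ring.inverse (1 - B x)) * J x) := by
  have hG := hD.memClosure_inverse hB hsk
  have hC := hD.memClosure_sub (hD.memClosure_add hG hG) (hD.memClosure hD.one)
  set G := fun x => Ring.inverse (1 - B x) with hGdef
  have hGx : ∀ x, Ring.inverse (1 - B x) = G x := fun x => rfl
  simp only [hGx] at hC ⊢
  have hb := hD.ae_star_eq_neg hB hsk
  have hcay : ∀ᵐ x ∂μ, star (G x) * G x + star (G x) * G x = G x + star (G x) ∧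
      G x * star (G x) + G x * star (G x) = G x + star (G x) := by
    filter_upwards [hsk] with x hx
    have hu := isUnit_one_sub_skew hx
    exact cayley_aux hx (Ring.inverse_mul_cancel _ hu) (Ring.mul_inverse_cancel _ hu)
  have hGn : ∀ᵐ x ∂μ, ‖G x‖ ≤ 1 := hsk.mono fun x hx => norm_inverse_one_sub_skew_le hx
  have hCn : ∀ᵐ x ∂μ, ‖G x + G x - 1‖ ≤ 3 := by
    filter_upwards [hGn] with x hx
    have h1 : ‖(1 : V →L[ℝ] V)‖ ≤ 1 := ContinuousLinearMap.norm_id_le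
    refine (norm_sub_le _ _).trans ?_
    have := norm_add_le (G x) (G x)
    linarith
  have hCn' : ∀ᵐ x ∂μ, ‖star (G x + G x - 1)‖ ≤ 3 := hCn.mono fun x hx => by
    rwa [norm_star_end]
  have hJn : ∀ᵐ x ∂μ, ‖J x‖ ≤ 1 := h.2.mono fun x hx => hx.norm_le
  have h1 := hD.memClosure_mul (hD.memClosure_star hC) h.1 hCn' hJn
  have hn1 : ∀ᵐ x ∂μ, ‖star (G x + G x - 1) * J x‖ ≤ 3 * 1 := by
    filter_upwards [hCn', hJn] with x h1 h2
    exact (norm_mul_le _ _).trans (by gcongr)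
  have h2 := hD.memClosure_mul h1 hC hn1 hCn
  refine ⟨_, _, ⟨h2, ?_⟩, ?_⟩
  · filter_upwards [h.2, hcay] with x hx hc
    have e := cayley_mul_star hc.2
    refine ⟨?_, ?_⟩
    · simp only [star_mul, star_star, hx.1]
      noncomm_ring
    · calc star (G x + G x - 1) * J x * (G x + G x - 1) * (star (G x + G x - 1) * J x * (G x + G x - 1))
          = star (G x + G x - 1) * J x * ((G x + G x - 1) * star (G x + G x - 1))
            * J x * (G x + G x - 1) := by
            simp only [mul_assoc]
        _ = star (G x + G x - 1) * (J x * J x) * (G x + G x - 1) := by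
            rw [e]
            simp only [mul_assoc, one_mul]
        _ = -(star (G x + G x - 1) * (G x + G x - 1)) := by
            rw [hx.2, mul_neg, mul_one, neg_mul]
        _ = -1 := by
            rw [cayley_star_mul hc.1]
  · filter_upwards [hcay, hb] with x hc hbx
    have e := cayley_mul_star hc.2
    refine Finset.sum_congr rfl fun i _ => ?_
    have hd := cayley_derivative (J := J x) (a := a x i) hc.1 (hbx i)
    simp only [Pi.add_apply, Pi.sub_apply, Pi.zero_apply, sub_zero] at *
    rw [hd]
    have := hs_conj (C := star (G x + G x - 1)) (by rw [star_star]; exact e)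
    rw [star_star] at this
    rw [this]
    simp only [Pi.smul_apply, two_smul]

end Jets

end

section

section Jets

variable {X : Type*} [MeasurableSpace X] {μ : Measure X}
  {V : Type*} [NormedAddCommGroup V] [InnerProductSpace ℝ V] [FiniteDimensional ℝ V]
  {ι : Type*} [Fintype ι]
  {D : (X → V →L[ℝ] V) → (X → ι → V →L[ℝ] V) → Prop}
  {J : X → V →L[ℝ] V} {a : X → ι → V →L[ℝ] V}

variable (μ D) in
/-- `(J, a)` has the least energy among the abstract admissible pairs. -/
def IsMinimalStructure (J : X → V →L[ℝ] V) (a : X → ι → V →L[ℝ] V) : Prop :=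
  MemStructures μ D J a ∧
    ∀ K k, MemStructures μ D K k → ∫ x, hsGrad (a x) (a x) ∂μ ≤ ∫ x, hsGrad (k x) (k x) ∂μ

lemma norm_bracket_le {J G b : V →L[ℝ] V} (hJ : ‖J‖ ≤ 1) (hG : ‖G‖ ≤ 1) :
    ‖J * (G * b * star G) - G * b * star G * J‖ ≤ 2 * ‖b‖ := by
  have h1 : ‖G * b * star G‖ ≤ ‖b‖ := by
    calc ‖G * b * star G‖ ≤ ‖G‖ * ‖b‖ * ‖star G‖ :=
          (norm_mul_le _ _).trans (by gcongr; exact norm_mul_le _ _)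
      _ ≤ 1 * ‖b‖ * 1 := by
          rw [norm_star_end]
          gcongr
      _ = ‖b‖ := by ring
  have h2 : ‖J * (G * b * star G)‖ ≤ 1 * ‖b‖ := (norm_mul_le _ _).trans (by gcongr)
  have h3 : ‖G * b * star G * J‖ ≤ ‖b‖ * 1 := (norm_mul_le _ _).trans (by gcongr)
  refine (norm_sub_le _ _).trans ?_
  linarith

/-- For a complex structure `J` and skew-symmetric `a` anticommuting with `J`, the inner product of
`a` with the bracket of `J` and the skew-symmetric part of `c`. -/
lemma hs_bracket {J a c : V →L[ℝ] V} (hJ : star J = -J) (ha : star a = -a)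
    (haJ : a * J = -(J * a)) :
    hs a (J * (c + (-1 : ℝ) • star c) - (c + (-1 : ℝ) • star c) * J) = 4 * hs (a * J) c := by
  have e1 : ∀ b, hs a (J * b) = hs (a * J) b := fun b => by
    rw [hs_mul_left, hJ, haJ, neg_mul]
  have e2 : ∀ b, hs a (b * J) = -hs (a * J) b := fun b => by
    rw [hs_mul_right, hJ, mul_neg, hs_neg_left]
  have e3 : star (a * J) = -(a * J) := by
    rw [star_mul, ha, hJ, neg_mul_neg, haJ, neg_neg]
  have e4 : hs (a * J) (star c) = -hs (a * J) c := by
    rw [← hs_star_star (a * J) c, e3, hs_neg_left, neg_neg]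
  rw [hs_sub_right, e1, e2, hs_add_right, hs_smul_right, e4]
  ring

lemma hs_leibniz {J a u U : V →L[ℝ] V} (hJ : star J = -J) (hJJ : J * J = -1) (ha : star a = -a)
    (haJ : a * J = -(J * a)) :
    hs (a * J) (a * U + J * u) = -(hs a u + hs (J * a * a) U) := by
  have e1 : hs (a * J) (a * U) = -hs (J * a * a) U := by
    rw [hs_mul_left, ha, haJ, neg_mul_neg, ← mul_assoc, haJ, neg_mul, hs_neg_left]
  have e2 : hs (a * J) (J * u) = -hs a u := by
    rw [hs_mul_left, hJ, haJ, neg_mul_neg, ← mul_assoc, hJJ, neg_one_mul, hs_neg_left]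
  rw [hs_add_right, e1, e2]
  ring

variable [IsFiniteMeasure μ]

/-- The one-sided first variation: the derivative of the energy at `t = 0⁺` along the conjugations
by the Cayley transforms of `t B`. -/
lemma IsJetAlgebra.first_variation_nonneg (hD : IsJetAlgebra μ D)
    (h : IsMinimalStructure μ D J a) {B : X → V →L[ℝ] V} {b : X → ι → V →L[ℝ] V}
    (hB : MemClosure μ D B b) (hsk : ∀ᵐ x ∂μ, star (B x) = -B x) :
    0 ≤ ∫ x, hsGrad (a x) (fun i => J x * b x i - b x i * J x) ∂μ := by
  have ma := hD.memLp_snd_of_memClosure h.1.1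
  have mb := hD.memLp_snd_of_memClosure hB
  have hJn : ∀ᵐ x ∂μ, ‖J x‖ ≤ 1 := h.1.2.mono fun x hx => hx.norm_le
  let G : ℝ → X → V →L[ℝ] V := fun t x => Ring.inverse (1 - t • B x)
  let R : ℝ → X → ι → V →L[ℝ] V := fun t x i =>
    J x * (G t x * b x i * star (G t x)) - G t x * b x i * star (G t x) * J x
  have hskt : ∀ t : ℝ, ∀ᵐ x ∂μ, star (t • B x) = -(t • B x) := fun t => by
    filter_upwards [hsk] with x hx
    rw [star_smul, hx, star_trivial, smul_neg]
  have hG : ∀ t : ℝ, ∀ᵐ x ∂μ, ‖G t x‖ ≤ 1 := fun t => (hskt t).mono fun x hx =>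
    norm_inverse_one_sub_skew_le hx
  have hGm : ∀ t, AEStronglyMeasurable (G t) μ := fun t =>
    (hD.memClosure_inverse (hD.memClosure_smul t hB) (hskt t)).1
  have hRm : ∀ t, AEStronglyMeasurable (R t) μ := fun t => by
    have h1 := aestronglyMeasurable_tuple_mul (continuous_star.comp_aestronglyMeasurable (hGm t))
      (aestronglyMeasurable_mul_tuple (hGm t) hB.2.1)
    exact (aestronglyMeasurable_mul_tuple h.1.1.1 h1).sub
      (aestronglyMeasurable_tuple_mul h.1.1.1 h1)
  have hRb : ∀ t, ∀ᵐ x ∂μ, ‖R t x‖ ≤ 2 * ‖b x‖ := fun t => by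
    filter_upwards [hJn, hG t] with x h1 h2
    refine (pi_norm_le_iff_of_nonneg (by positivity)).2 fun i => (norm_bracket_le h1 h2).trans ?_
    gcongr
    exact norm_le_pi_norm _ i
  have hRL : ∀ t, MemLp (R t) 2 μ := fun t => by
    exact MemLp.of_le_mul (c := 2) mb (hRm t) (hRb t)
  -- the energy inequality for the competitor with parameter `t`
  have key : ∀ t : ℝ, 0 < t → 0 ≤ ∫ x, hsGrad (a x) (R t x) ∂μ + t * ∫ x, hsGrad (R t x) (R t x) ∂μ := by
    intro t ht
    obtain ⟨K, k, hK, hk⟩ := hD.memStructures_cayley h.1 (hD.memClosure_smul t hB) (hskt t)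
    have hmin := h.2 K k hK
    have i1 := integrable_hsGrad ma ma
    have i2 := integrable_hsGrad ma (hRL t)
    have i3 := integrable_hsGrad (hRL t) (hRL t)
    have e : ∫ x, hsGrad (k x) (k x) ∂μ = ∫ x, hsGrad (a x) (a x) ∂μ
        + 4 * t * ∫ x, hsGrad (a x) (R t x) ∂μ + 4 * t ^ 2 * ∫ x, hsGrad (R t x) (R t x) ∂μ := by
      have i4 : Integrable (fun x => hsGrad (a x) (a x) + 4 * t * hsGrad (a x) (R t x)) μ :=
        i1.add (i2.const_mul _)
      rw [← integral_const_mul, ← integral_const_mul, ← integral_add i1 (i2.const_mul _),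
        ← integral_add i4 (i3.const_mul _)]
      refine integral_congr_ae ?_
      filter_upwards [hk] with x hx
      have e1 : (a x + (2 : ℝ) • fun i => J x * (Ring.inverse (1 - t • B x) * (t • b x) i
          * star (Ring.inverse (1 - t • B x))) - Ring.inverse (1 - t • B x) * (t • b x) i
          * star (Ring.inverse (1 - t • B x)) * J x) = a x + (2 * t) • R t x := by
        funext i
        simp only [Pi.add_apply, Pi.smul_apply, R, G, mul_smul_comm, smul_mul_assoc, mul_smul,
          smul_sub]
      rw [e1] at hx
      rw [hx, hsGrad_add_smul]
      ring
    rw [e] at hmin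
    have : 0 ≤ t * (∫ x, hsGrad (a x) (R t x) ∂μ + t * ∫ x, hsGrad (R t x) (R t x) ∂μ) := by
      nlinarith
    exact nonneg_of_mul_nonneg_right this ht
  set N : ℝ := Fintype.card ι * Module.finrank ℝ V
  let T : ℕ → ℝ := fun n => 1 / ((n : ℝ) + 1)
  have hT : Tendsto T atTop (𝓝 0) := tendsto_one_div_add_atTop_nhds_zero_nat
  have hT0 : ∀ n, 0 < T n := fun n => by positivity
  have hlim1 : Tendsto (fun n => ∫ x, hsGrad (a x) (R (T n) x) ∂μ) atTop
      (𝓝 (∫ x, hsGrad (a x) (fun i => J x * b x i - b x i * J x) ∂μ)) := by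
    refine tendsto_integral_of_dominated_convergence (fun x => N * (‖a x‖ * (2 * ‖b x‖)))
      (fun n => aestronglyMeasurable_hsGrad ma.1 (hRm _))
      ((ma.norm.integrable_mul (mb.norm.const_mul 2)).const_mul N)
      (fun n => ?_) ?_
    · filter_upwards [hRb (T n)] with x hx
      refine (abs_hsGrad_le _ _).trans ?_
      gcongr
    · filter_upwards with x
      have h1 : Tendsto (fun n => 1 - T n • B x) atTop (𝓝 1) := by
        simpa using tendsto_const_nhds.sub (hT.smul_const (B x))
      have h2 : Tendsto (fun n => G (T n) x) atTop (𝓝 1) := by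
        have := (NormedRing.inverse_continuousAt (1 : (V →L[ℝ] V)ˣ)).tendsto
        simp only [Units.val_one, Ring.inverse_one] at this
        exact this.comp h1
      have h3 : Tendsto (fun n => star (G (T n) x)) atTop (𝓝 1) := by
        have := (continuous_star.tendsto _).comp h2
        rw [star_one] at this
        exact this
      have h4 : Tendsto (fun n => R (T n) x) atTop (𝓝 fun i => J x * b x i - b x i * J x) := by
        refine tendsto_pi_nhds.2 fun i => ?_
        have h5 := (h2.mul_const (b x i)).mul h3
        simp only [one_mul, mul_one] at h5
        exact (h5.const_mul (J x)).sub (h5.mul_const (J x))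
      have hc : Continuous fun r : ι → V →L[ℝ] V => hsGrad (a x) r :=
        continuous_hsGrad continuous_const continuous_id
      exact (hc.tendsto _).comp h4
  have hbound : ∀ n, ∫ x, hsGrad (R (T n) x) (R (T n) x) ∂μ ≤ ∫ x, N * (2 * ‖b x‖) ^ 2 ∂μ := fun n => by
    refine integral_mono_ae (integrable_hsGrad (hRL _) (hRL _)) ?_ ?_
    · exact ((mb.norm.const_mul 2).integrable_sq).const_mul N
    · filter_upwards [hRb (T n)] with x hx
      refine (hsGrad_self_le _).trans ?_
      gcongr
  have hlim2 : Tendsto (fun n => ∫ x, hsGrad (a x) (R (T n) x) ∂μ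
      + T n * ∫ x, N * (2 * ‖b x‖) ^ 2 ∂μ) atTop
      (𝓝 (∫ x, hsGrad (a x) (fun i => J x * b x i - b x i * J x) ∂μ)) := by
    simpa using hlim1.add (hT.mul_const _)
  refine ge_of_tendsto' hlim2 fun n => (key (T n) (hT0 n)).trans ?_
  exact add_le_add le_rfl (mul_le_mul_of_nonneg_left (hbound n) (hT0 n).le)

set_option maxHeartbeats 400000 in
/-- The Euler–Lagrange equation, tested against bounded fields. -/
lemma IsJetAlgebra.euler_lagrange (hD : IsJetAlgebra μ D) (h : IsMinimalStructure μ D J a)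
    {U : X → V →L[ℝ] V} {u : X → ι → V →L[ℝ] V} (hU : MemClosure μ D U u) {C : ℝ}
    (hC : ∀ᵐ x ∂μ, ‖U x‖ ≤ C) :
    Integrable (fun x => hsGrad (a x) (u x)) μ ∧
    Integrable (fun x => ∑ i, hs (J x * a x i * a x i) (U x)) μ ∧
    ∫ x, hsGrad (a x) (u x) ∂μ + ∫ x, ∑ i, hs (J x * a x i * a x i) (U x) ∂μ = 0 := by
  have ma := hD.memLp_snd_of_memClosure h.1.1
  have hJn : ∀ᵐ x ∂μ, ‖J x‖ ≤ 1 := h.1.2.mono fun x hx => hx.norm_le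
  have I1 := integrable_hsGrad ma (hD.memLp_snd_of_memClosure hU)
  have hmeas : AEStronglyMeasurable (fun x => ∑ i, hs (J x * a x i * a x i) (U x)) μ := by
    have hc : Continuous fun z : (V →L[ℝ] V) × (ι → V →L[ℝ] V) × (V →L[ℝ] V) =>
        ∑ i, hs (z.1 * z.2.1 i * z.2.1 i) z.2.2 := by
      refine continuous_finsetSum _ fun i _ => ?_
      refine continuous_hs ?_ (continuous_snd.comp continuous_snd)
      have := (continuous_apply i).comp
        ((continuous_fst (X := ι → V →L[ℝ] V) (Y := V →L[ℝ] V)).comp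
          (continuous_snd (X := V →L[ℝ] V)))
      exact (continuous_fst.mul this).mul this
    have h := hc.comp_aestronglyMeasurable (h.1.1.1.prodMk (h.1.1.2.1.prodMk hU.1))
    exact h
  have I2 : Integrable (fun x => ∑ i, hs (J x * a x i * a x i) (U x)) μ := by
    refine Integrable.mono' ((ma.norm.integrable_sq).const_mul
      (Fintype.card ι * (Module.finrank ℝ V * |C|) : ℝ)) hmeas ?_
    filter_upwards [hJn, hC] with x h1 h2
    refine (norm_sum_le _ _).trans ((Finset.sum_le_card_nsmul _ _
      (Module.finrank ℝ V * |C| * ‖a x‖ ^ 2) fun i _ => ?_).trans ?_)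
    · refine (abs_hs_le _ _).trans ?_
      have n1 : ‖J x * a x i * a x i‖ ≤ 1 * ‖a x‖ * ‖a x‖ := by
        refine (norm_mul_le _ _).trans ?_
        gcongr
        · exact (norm_mul_le _ _).trans (by gcongr; exact norm_le_pi_norm _ i)
        · exact norm_le_pi_norm _ i
      calc Module.finrank ℝ V * (‖J x * a x i * a x i‖ * ‖U x‖)
          ≤ Module.finrank ℝ V * ((1 * ‖a x‖ * ‖a x‖) * |C|) := by
            gcongr
            exact h2.trans (le_abs_self C)
        _ = _ := by ring
    · rw [nsmul_eq_mul, Finset.card_univ]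
      exact le_of_eq (by ring)
  refine ⟨I1, I2, ?_⟩
  -- the variation is generated by the skew-symmetric part of `W = J U`
  have hW := hD.memClosure_mul h.1.1 hU hJn hC
  have hB := hD.memClosure_add hW (hD.memClosure_smul (-1) (hD.memClosure_star hW))
  have hsk : ∀ᵐ x ∂μ, star (J x * U x + (-1 : ℝ) • star (J x * U x))
      = -(J x * U x + (-1 : ℝ) • star (J x * U x)) := Eventually.of_forall fun x => by
    simp only [star_add, star_smul, star_star, star_trivial]
    module
  have hsk' : ∀ᵐ x ∂μ, star ((-1 : ℝ) • (J x * U x + (-1 : ℝ) • star (J x * U x)))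
      = -((-1 : ℝ) • (J x * U x + (-1 : ℝ) • star (J x * U x))) := by
    filter_upwards [hsk] with x hx
    rw [star_smul, hx, star_trivial, smul_neg]
  have v1 := hD.first_variation_nonneg h hB hsk
  have v2 := hD.first_variation_nonneg h (hD.memClosure_smul (-1) hB) hsk'
  have e : ∀ᵐ x ∂μ, hsGrad (a x) (fun i =>
      J x * ((fun i => a x i * U x + J x * u x i) + (-1 : ℝ) •
          fun i => star (a x i * U x + J x * u x i)) i
        - ((fun i => a x i * U x + J x * u x i) + (-1 : ℝ) •
          fun i => star (a x i * U x + J x * u x i)) i * J x)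
      = (-4) * (hsGrad (a x) (u x) + ∑ i, hs (J x * a x i * a x i) (U x)) := by
    filter_upwards [h.1.2, hD.anticomm h.1] with x hx hx'
    rw [hsGrad, hsGrad, ← Finset.sum_add_distrib, Finset.mul_sum]
    refine Finset.sum_congr rfl fun i _ => ?_
    have := hs_bracket (c := a x i * U x + J x * u x i) hx.1 (hx' i).1 (hx' i).2
    simp only [Pi.add_apply, Pi.smul_apply]
    rw [this, hs_leibniz hx.1 hx.2 (hx' i).1 (hx' i).2]
    ring
  have e' : ∀ x, hsGrad (a x) (fun i =>
      J x * ((-1 : ℝ) • ((fun i => a x i * U x + J x * u x i) + (-1 : ℝ) •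
          fun i => star (a x i * U x + J x * u x i))) i
        - ((-1 : ℝ) • ((fun i => a x i * U x + J x * u x i) + (-1 : ℝ) •
          fun i => star (a x i * U x + J x * u x i))) i * J x)
      = -hsGrad (a x) (fun i =>
      J x * ((fun i => a x i * U x + J x * u x i) + (-1 : ℝ) •
          fun i => star (a x i * U x + J x * u x i)) i
        - ((fun i => a x i * U x + J x * u x i) + (-1 : ℝ) •
          fun i => star (a x i * U x + J x * u x i)) i * J x) := fun x => by
    simp only [hsGrad, ← Finset.sum_neg_distrib, ← hs_neg_right]
    refine Finset.sum_congr rfl fun i _ => ?_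
    congr 1
    simp only [Pi.smul_apply, neg_smul, one_smul]
    noncomm_ring
  rw [← integral_add I1 I2]
  beta_reduce at v1 v2
  simp only [e'] at v2
  rw [integral_neg] at v2
  rw [integral_congr_ae e, integral_const_mul] at v1 v2
  simp only [Pi.add_apply] at *
  linarith

end Jets

end

section

/-! ### Compactness of minimizing sequences -/

/-- In a Hilbert space, a sequence whose norms converge to `d` converges in norm if no limit of
convex combinations of its tails has norm less than `d`. -/
lemma exists_tendsto_of_convexHull {H : Type*} [NormedAddCommGroup H] [InnerProductSpace ℝ H]
    [CompleteSpace H] {x : ℕ → H} {d : ℝ} (hx : Tendsto (fun i => ‖x i‖) atTop (𝓝 d))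
    (hd : ∀ (z : ℕ → H) (y : H), (∀ n, z n ∈ convexHull ℝ (x '' Set.Ici n)) →
      Tendsto z atTop (𝓝 y) → d ≤ ‖y‖) : ∃ y, Tendsto x atTop (𝓝 y) := by
  let K : ℕ → Set H := fun n => closure (convexHull ℝ (x '' Set.Ici n))
  have hKx : ∀ n i, n ≤ i → x i ∈ K n := fun n i h =>
    subset_closure (subset_convexHull ℝ _ ⟨i, h, rfl⟩)
  have hconv : ∀ n, Convex ℝ (K n) := fun n => (convex_convexHull ℝ _).closure
  have hmono : ∀ n k, n ≤ k → K k ⊆ K n := fun n k h =>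
    closure_mono (convexHull_mono (Set.image_mono (Set.Ici_subset_Ici.2 h)))
  -- the elements of least norm of the closed convex hulls of the tails
  have hy : ∀ n, ∃ y ∈ K n, ∀ w ∈ K n, ‖w - y‖ ^ 2 ≤ ‖w‖ ^ 2 - ‖y‖ ^ 2 := by
    intro n
    obtain ⟨y, hyK, hy⟩ := exists_norm_eq_iInf_of_complete_convex ⟨x n, hKx n n le_rfl⟩
      isClosed_closure.isComplete (hconv n) 0
    refine ⟨y, hyK, fun w hw => ?_⟩
    have h := (norm_eq_iInf_iff_real_inner_le_zero (hconv n) hyK).1 hy w hw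
    rw [zero_sub, inner_neg_left, inner_sub_right, real_inner_self_eq_norm_sq] at h
    rw [norm_sub_sq_real, real_inner_comm]
    linarith
  choose y hyK hyle using hy
  have hle : ∀ n k, n ≤ k → ‖y n‖ ^ 2 ≤ ‖y k‖ ^ 2 := fun n k h => by
    have := hyle n (y k) (hmono n k h (hyK k))
    nlinarith [sq_nonneg ‖y k - y n‖]
  have hd0 : 0 ≤ d := ge_of_tendsto' hx fun i => norm_nonneg _
  have hyd : ∀ n, ‖y n‖ ^ 2 ≤ d ^ 2 := fun n => by
    refine ge_of_tendsto (hx.pow 2) ?_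
    filter_upwards [eventually_ge_atTop n] with i hi
    have := hyle n (x i) (hKx n i hi)
    nlinarith [sq_nonneg ‖x i - y n‖]
  have hlim : ∃ L, Tendsto (fun n => ‖y n‖ ^ 2) atTop (𝓝 L) :=
    ⟨_, tendsto_atTop_ciSup (fun n k h => hle n k h) ⟨d ^ 2, by rintro _ ⟨n, rfl⟩; exact hyd n⟩⟩
  obtain ⟨L, hL⟩ := hlim
  have hcau : CauchySeq y := by
    rw [Metric.cauchySeq_iff']
    intro ε hε
    obtain ⟨N, hN⟩ := Metric.cauchySeq_iff'.1 hL.cauchySeq (ε ^ 2) (by positivity)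
    refine ⟨N, fun n hn => ?_⟩
    have h1 := hyle N (y n) (hmono N n hn (hyK n))
    have h2 := hN n hn
    rw [Real.dist_eq] at h2
    rw [dist_eq_norm]
    exact lt_of_pow_lt_pow_left₀ 2 hε.le (h1.trans_lt ((le_abs_self _).trans_lt h2))
  obtain ⟨Y, hY⟩ := cauchySeq_tendsto_of_complete hcau
  have hz : ∀ n : ℕ, ∃ z ∈ convexHull ℝ (x '' Set.Ici n), ‖z - y n‖ < 1 / ((n : ℝ) + 1) := fun n => by
    obtain ⟨z, hz, hzn⟩ := Metric.mem_closure_iff.1 (hyK n) (1 / ((n : ℝ) + 1)) (by positivity)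
    exact ⟨z, hz, by rwa [dist_comm, dist_eq_norm] at hzn⟩
  choose z hz hzy using hz
  have hzlim : Tendsto z atTop (𝓝 Y) := by
    have h0 : Tendsto (fun n => z n - y n) atTop (𝓝 0) :=
      squeeze_zero_norm (fun n => (hzy n).le) tendsto_one_div_add_atTop_nhds_zero_nat
    simpa using h0.add hY
  have hYd := hd z Y hz hzlim
  have hYn : Tendsto (fun n => ‖y n‖ ^ 2) atTop (𝓝 (‖Y‖ ^ 2)) := hY.norm.pow 2
  have hYd2 : ‖Y‖ ^ 2 = d ^ 2 :=
    le_antisymm (le_of_tendsto' hYn hyd) (by gcongr)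
  refine ⟨Y, ?_⟩
  have h1 : Tendsto (fun i => ‖x i - y i‖ ^ 2) atTop (𝓝 0) := by
    have h2 : Tendsto (fun i => ‖x i‖ ^ 2 - ‖y i‖ ^ 2) atTop (𝓝 0) := by
      have := (hx.pow 2).sub hYn
      rwa [hYd2, sub_self] at this
    exact squeeze_zero (fun i => by positivity) (fun i => hyle i (x i) (hKx i i le_rfl)) h2
  have h3 : Tendsto (fun i => x i - y i) atTop (𝓝 0) := by
    rw [tendsto_zero_iff_norm_tendsto_zero]
    have := h1.sqrt
    simpa [Real.sqrt_sq] using this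
  simpa using h3.add hY

section Jets

variable {X : Type*} [MeasurableSpace X] {μ : Measure X}
  {V : Type*} [NormedAddCommGroup V] [InnerProductSpace ℝ V] [FiniteDimensional ℝ V]
  {ι : Type*} [Fintype ι]
  {D : (X → V →L[ℝ] V) → (X → ι → V →L[ℝ] V) → Prop}

variable (V ι) in
/-- The tuples of endomorphisms of `V`, written as vectors of a Euclidean space. -/
abbrev TupleSpace := PiLp 2 (fun _ : ι × Fin (Module.finrank ℝ V) => V)

variable (V ι) in
/-- The matrix entries of a tuple of endomorphisms; this is an isometry for `hsGrad`. -/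
def tupleEquiv : (ι → V →L[ℝ] V) ≃L[ℝ] TupleSpace V ι :=
  LinearEquiv.toContinuousLinearEquiv
    { toFun := fun α => WithLp.toLp 2 fun p => α p.1 (stdOrthonormalBasis ℝ V p.2)
      map_add' := fun α β => rfl
      map_smul' := fun c α => rfl
      invFun := fun w i => LinearMap.toContinuousLinearMap
        ((stdOrthonormalBasis ℝ V).toBasis.constr ℝ fun j => w (i, j))
      left_inv := fun α => by
        funext i
        refine ContinuousLinearMap.coe_injective
          ((stdOrthonormalBasis ℝ V).toBasis.ext fun j => ?_)
        rw [LinearMap.coe_toContinuousLinearMap, Module.Basis.constr_basis]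
        simp
      right_inv := fun w => by
        ext p
        simp }

lemma inner_tupleEquiv (α β : ι → V →L[ℝ] V) :
    inner ℝ (tupleEquiv V ι α) (tupleEquiv V ι β) = hsGrad α β := by
  rw [PiLp.inner_apply, Fintype.sum_prod_type, hsGrad]
  refine Finset.sum_congr rfl fun i _ => ?_
  rw [hs_eq_sum (stdOrthonormalBasis ℝ V)]
  rfl

lemma norm_sq_toLp_tupleEquiv {α : X → ι → V →L[ℝ] V}
    (h : MemLp (fun x => tupleEquiv V ι (α x)) 2 μ) :
    ‖h.toLp‖ ^ 2 = ∫ x, hsGrad (α x) (α x) ∂μ := by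
  rw [← real_inner_self_eq_norm_sq, L2.inner_def]
  refine integral_congr_ae ?_
  filter_upwards [h.coeFn_toLp] with x hx
  rw [hx, inner_tupleEquiv]

lemma memLp_tupleEquiv {α : X → ι → V →L[ℝ] V} (h : MemLp α 2 μ) :
    MemLp (fun x => tupleEquiv V ι (α x)) 2 μ :=
  (tupleEquiv V ι).toContinuousLinearMap.comp_memLp' h

lemma eLpNorm_tupleEquiv_symm_le : ∃ K : NNReal, ∀ f g : X → TupleSpace V ι,
    eLpNorm ((fun x => (tupleEquiv V ι).symm (f x)) - fun x => (tupleEquiv V ι).symm (g x)) 2 μ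
      ≤ K * eLpNorm (f - g) 2 μ := by
  refine ⟨‖(tupleEquiv V ι).symm.toContinuousLinearMap‖₊, fun f g => ?_⟩
  have := eLpNorm_le_nnreal_smul_eLpNorm_of_ae_le_mul
    (f := (fun x => (tupleEquiv V ι).symm (f x)) - fun x => (tupleEquiv V ι).symm (g x))
    (g := f - g) (c := ‖(tupleEquiv V ι).symm.toContinuousLinearMap‖₊) (μ := μ)
    (Eventually.of_forall fun x => ?_) 2
  · simpa [ENNReal.smul_def] using this
  · simp only [Pi.sub_apply]
    rw [← map_sub]
    exact (tupleEquiv V ι).symm.toContinuousLinearMap.le_opNNNorm _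

lemma eLpNorm_convexCombination_sub_le {E : Type*} [NormedAddCommGroup E] [NormedSpace ℝ E]
    {f g h : X → E} (hf : AEStronglyMeasurable f μ) (hg : AEStronglyMeasurable g μ)
    (hh : AEStronglyMeasurable h μ) {c c' : ℝ} (hc : 0 ≤ c) (hc' : 0 ≤ c') (hcc : c + c' = 1)
    {ε : ENNReal} (h1 : eLpNorm (f - h) 2 μ ≤ ε) (h2 : eLpNorm (g - h) 2 μ ≤ ε) :
    eLpNorm ((fun x => c • f x + c' • g x) - h) 2 μ ≤ ε := by
  have e : (fun x => c • f x + c' • g x) - h = c • (f - h) + c' • (g - h) := by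
    funext x
    simp only [Pi.sub_apply, Pi.add_apply, Pi.smul_apply]
    have : h x = c • h x + c' • h x := by rw [← add_smul, hcc, one_smul]
    rw [smul_sub, smul_sub]
    nth_rewrite 1 [this]
    abel
  rw [e]
  refine (eLpNorm_add_le ((hf.sub hh).const_smul c) ((hg.sub hh).const_smul c')
    (by norm_num)).trans ?_
  rw [eLpNorm_const_smul, eLpNorm_const_smul]
  calc ‖c‖ₑ * eLpNorm (f - h) 2 μ + ‖c'‖ₑ * eLpNorm (g - h) 2 μ
      ≤ ‖c‖ₑ * ε + ‖c'‖ₑ * ε := by gcongr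
    _ = (‖c‖ₑ + ‖c'‖ₑ) * ε := by rw [add_mul]
    _ = ε := by
      rw [Real.enorm_of_nonneg hc, Real.enorm_of_nonneg hc', ← ENNReal.ofReal_add hc hc', hcc]
      simp

/-- Convex combinations of elements of the closure of `D` close to a given field. -/
lemma IsJetAlgebra.exists_of_mem_convexHull (hD : IsJetAlgebra μ D) {σ₀ : X → V →L[ℝ] V}
    {ε : ENNReal} {S : Set (Lp (TupleSpace V ι) 2 μ)}
    (hS : ∀ z ∈ S, ∃ σ α, MemClosure μ D σ α ∧ (z =ᵐ[μ] fun x => tupleEquiv V ι (α x)) ∧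
      eLpNorm (σ - σ₀) 2 μ ≤ ε) (hσ₀ : AEStronglyMeasurable σ₀ μ)
    {z : Lp (TupleSpace V ι) 2 μ} (hz : z ∈ convexHull ℝ S) :
    ∃ σ α, MemClosure μ D σ α ∧ (z =ᵐ[μ] fun x => tupleEquiv V ι (α x)) ∧
      eLpNorm (σ - σ₀) 2 μ ≤ ε := by
  have hc : Convex ℝ {z : Lp (TupleSpace V ι) 2 μ | ∃ σ α, MemClosure μ D σ α ∧
      (z =ᵐ[μ] fun x => tupleEquiv V ι (α x)) ∧ eLpNorm (σ - σ₀) 2 μ ≤ ε} := by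
    rintro z ⟨σ, α, h, hz, he⟩ z' ⟨σ', α', h', hz', he'⟩ c c' hc hc' hcc
    refine ⟨_, _, hD.memClosure_add (hD.memClosure_smul c h) (hD.memClosure_smul c' h'), ?_, ?_⟩
    · filter_upwards [Lp.coeFn_add (c • z) (c' • z'), Lp.coeFn_smul c z, Lp.coeFn_smul c' z', hz,
        hz'] with x h1 h2 h3 h4 h5
      rw [h1, Pi.add_apply, h2, h3, Pi.smul_apply, Pi.smul_apply, h4, h5, map_add, map_smul,
        map_smul]
    · exact eLpNorm_convexCombination_sub_le h.1 h'.1 hσ₀ hc hc' hcc he he'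
  exact convexHull_min hS hc hz

/-- Limits of convex combinations of the tails of a sequence of derivatives are derivatives of the
limit of the fields. -/
lemma IsJetAlgebra.memClosure_of_convexHull (hD : IsJetAlgebra μ D) {σ : ℕ → X → V →L[ℝ] V}
    {α : ℕ → X → ι → V →L[ℝ] V} (h : ∀ k, MemClosure μ D (σ k) (α k)) {σ₀ : X → V →L[ℝ] V}
    (hσm : AEStronglyMeasurable σ₀ μ)
    (hσ : Tendsto (fun k => eLpNorm (σ k - σ₀) 2 μ) atTop (𝓝 0))
    {x : ℕ → Lp (TupleSpace V ι) 2 μ} (hx : ∀ k, x k =ᵐ[μ] fun p => tupleEquiv V ι (α k p))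
    {z : ℕ → Lp (TupleSpace V ι) 2 μ} {y : Lp (TupleSpace V ι) 2 μ}
    (hz : ∀ n, z n ∈ convexHull ℝ (x '' Set.Ici n)) (hzy : Tendsto z atTop (𝓝 y)) :
    MemClosure μ D σ₀ (fun p => (tupleEquiv V ι).symm (y p)) ∧
      Tendsto (fun n => eLpNorm ((fun p => (tupleEquiv V ι).symm (z n p))
        - fun p => (tupleEquiv V ι).symm (y p)) 2 μ) atTop (𝓝 0) := by
  obtain ⟨K, hK⟩ := eLpNorm_tupleEquiv_symm_le (μ := μ) (V := V) (ι := ι)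
  have hε : Tendsto (fun n => ⨆ i : ℕ, eLpNorm (σ (n + i) - σ₀) 2 μ) atTop (𝓝 0) := by
    rw [ENNReal.tendsto_atTop_zero] at hσ ⊢
    intro ε hε
    obtain ⟨N, hN⟩ := hσ ε hε
    exact ⟨N, fun n hn => iSup_le fun i => hN _ (by omega)⟩
  have hzy' : Tendsto (fun n => eLpNorm ((fun p => (tupleEquiv V ι).symm (z n p))
      - fun p => (tupleEquiv V ι).symm (y p)) 2 μ) atTop (𝓝 0) := by
    have h1 := (Lp.tendsto_Lp_iff_tendsto_eLpNorm' z y).1 hzy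
    have h2 : Tendsto (fun n => (K : ENNReal) * eLpNorm (⇑(z n) - ⇑y) 2 μ) atTop (𝓝 0) := by
      simpa using ENNReal.Tendsto.const_mul h1 (Or.inr ENNReal.coe_ne_top)
    exact tendsto_of_tendsto_of_tendsto_of_le_of_le tendsto_const_nhds h2 (fun n => zero_le)
      fun n => hK (z n) y
  refine ⟨?_, hzy'⟩
  have hex : ∀ n, ∃ τ β, MemClosure μ D τ β ∧ (z n =ᵐ[μ] fun p => tupleEquiv V ι (β p)) ∧
      eLpNorm (τ - σ₀) 2 μ ≤ ⨆ i : ℕ, eLpNorm (σ (n + i) - σ₀) 2 μ := by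
    intro n
    refine hD.exists_of_mem_convexHull ?_ hσm (hz n)
    rintro _ ⟨i, hi, rfl⟩
    refine ⟨σ i, α i, h i, hx i, ?_⟩
    obtain ⟨j, rfl⟩ := Nat.exists_eq_add_of_le (show n ≤ i from hi)
    exact le_iSup (fun j => eLpNorm (σ (n + j) - σ₀) 2 μ) j
  choose t β ht hβ hte using hex
  have hβ' : ∀ n, MemClosure μ D (t n) (fun p => (tupleEquiv V ι).symm (z n p)) := fun n =>
    (ht n).congr (EventuallyEq.refl _ _) (by
      filter_upwards [hβ n] with p hp
      rw [hp, ContinuousLinearEquiv.symm_apply_apply])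
  have hym : AEStronglyMeasurable (fun p => (tupleEquiv V ι).symm (y p)) μ :=
    (tupleEquiv V ι).symm.continuous.comp_aestronglyMeasurable (Lp.aestronglyMeasurable y)
  exact hD.memClosure_of_tendsto hβ' hσm hym
    (tendsto_of_tendsto_of_tendsto_of_le_of_le tendsto_const_nhds hε (fun n => zero_le) hte) hzy'

variable [IsFiniteMeasure μ]

set_option maxHeartbeats 800000 in
/-- A minimizing sequence of abstract complex structures has a strongly convergent subsequence,
whose limit is a minimizer. -/
lemma IsJetAlgebra.exists_subseq_tendsto (hD : IsJetAlgebra μ D) {J : ℕ → X → V →L[ℝ] V}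
    {a : ℕ → X → ι → V →L[ℝ] V} (h : ∀ k, MemStructures μ D (J k) (a k)) {I : ℝ}
    (hI : Tendsto (fun k => ∫ x, hsGrad (a k x) (a k x) ∂μ) atTop (𝓝 I))
    (hmin : ∀ K k, MemStructures μ D K k → I ≤ ∫ x, hsGrad (k x) (k x) ∂μ) :
    ∃ (φ : ℕ → ℕ) (J₀ : X → V →L[ℝ] V) (a₀ : X → ι → V →L[ℝ] V), StrictMono φ ∧
      MemStructures μ D J₀ a₀ ∧ ∫ x, hsGrad (a₀ x) (a₀ x) ∂μ = I ∧
      Tendsto (fun k => eLpNorm (J (φ k) - J₀) 2 μ) atTop (𝓝 0) ∧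
      Tendsto (fun k => eLpNorm (a (φ k) - a₀) 2 μ) atTop (𝓝 0) := by
  have ma : ∀ k, MemLp (a k) 2 μ := fun k => hD.memLp_snd_of_memClosure (h k).1
  have hJn : ∀ k, ∀ᵐ x ∂μ, ‖J k x‖ ≤ 1 := fun k => (h k).2.mono fun x hx => hx.norm_le
  have hJL : ∀ k, eLpNorm (J k) 2 μ ≤ eLpNorm (fun _ : X => (1 : ℝ)) 2 μ := fun k =>
    eLpNorm_mono_ae (by filter_upwards [hJn k] with x hx; simpa using hx)
  obtain ⟨E, hE⟩ := hI.bddAbove_range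
  have haL : ∀ k, eLpNorm (a k) 2 μ ≤ ENNReal.ofReal √E := fun k => by
    have h1 : eLpNorm (a k) 2 μ ^ 2 ≤ ENNReal.ofReal E := by
      rw [eLpNorm_two_sq]
      have h2 : ∫⁻ x, ‖a k x‖ₑ ^ 2 ∂μ ≤ ∫⁻ x, ENNReal.ofReal (hsGrad (a k x) (a k x)) ∂μ := by
        refine lintegral_mono fun x => ?_
        rw [← ofReal_norm, ← ENNReal.ofReal_pow (norm_nonneg _)]
        exact ENNReal.ofReal_le_ofReal (norm_sq_le_hsGrad _)
      rw [← ofReal_integral_eq_lintegral_ofReal (integrable_hsGrad (ma k) (ma k))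
        (Eventually.of_forall fun x => hsGrad_self_nonneg _)] at h2
      exact h2.trans (ENNReal.ofReal_le_ofReal (hE ⟨k, rfl⟩))
    have hE0 : 0 ≤ E := (integral_nonneg fun x => hsGrad_self_nonneg (a k x)).trans (hE ⟨k, rfl⟩)
    rw [← Real.sq_sqrt hE0, ENNReal.ofReal_pow (Real.sqrt_nonneg _)] at h1
    exact (ENNReal.pow_le_pow_left_iff two_ne_zero).1 h1
  -- approximation by elements of `D`, to which Rellich's theorem applies
  have happ : ∀ k : ℕ, ∃ s α, D s α ∧ eLpNorm (s - J k) 2 μ ≤ ((k : ENNReal) + 1)⁻¹ ∧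
      eLpNorm (α - a k) 2 μ ≤ ((k : ENNReal) + 1)⁻¹ := by
    intro k
    obtain ⟨-, -, s', a', hs', e1, e2⟩ := (h k).1
    have hpos : (0 : ENNReal) < ((k : ENNReal) + 1)⁻¹ := by simp
    obtain ⟨j, hj, hj'⟩ := ((e1.eventually (ge_mem_nhds hpos)).and
      (e2.eventually (ge_mem_nhds hpos))).exists
    exact ⟨s' j, a' j, hs' j, hj, hj'⟩
  choose s α hs e1 e2 using happ
  have hle1 : ∀ k : ℕ, ((k : ENNReal) + 1)⁻¹ ≤ 1 := fun k => by
    rw [ENNReal.inv_le_one]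
    exact le_add_self
  have hlim : Tendsto (fun k : ℕ => ((k : ENNReal) + 1)⁻¹) atTop (𝓝 0) := by
    have := (ENNReal.tendsto_inv_nat_nhds_zero).comp (tendsto_add_atTop_nat 1)
    simpa [Function.comp_def] using this
  set C : ENNReal := eLpNorm (fun _ : X => (1 : ℝ)) 2 μ + ENNReal.ofReal √E + 1
  have hC : C ≠ ⊤ := by
    have : eLpNorm (fun _ : X => (1 : ℝ)) 2 μ ≠ ⊤ := (memLp_const (1 : ℝ)).2.ne
    simp [C, this]
  obtain ⟨φ₁, hφ₁, σ₀, hσ₀⟩ := hD.rellich hs hC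
    (fun k => by
      have e : s k = J k + (s k - J k) := by abel
      rw [e]
      refine (eLpNorm_add_le (h k).1.1 ((hD.aesm_fst (hs k)).sub (h k).1.1) (by norm_num)).trans ?_
      refine (add_le_add (hJL k) ((e1 k).trans (hle1 k))).trans ?_
      simp only [C]
      gcongr
      exact le_self_add)
    (fun k => by
      have e : α k = a k + (α k - a k) := by abel
      rw [e]
      refine (eLpNorm_add_le (h k).1.2.1 ((hD.aesm_snd (hs k)).sub (h k).1.2.1)
        (by norm_num)).trans ?_
      refine (add_le_add (haL k) ((e2 k).trans (hle1 k))).trans ?_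
      simp only [C]
      gcongr
      exact le_add_self)
  have hd0 : Tendsto (fun k => eLpNorm ((s (φ₁ k) - J (φ₁ k)) - 0) 2 μ) atTop (𝓝 0) := by
    simp only [sub_zero]
    exact tendsto_of_tendsto_of_tendsto_of_le_of_le tendsto_const_nhds
      (hlim.comp hφ₁.tendsto_atTop) (fun k => zero_le) fun k => e1 _
  obtain ⟨φ₂, hφ₂, hd⟩ := exists_subseq_tendsto_ae
    (fun k => (hD.aesm_fst (hs (φ₁ k))).sub (h (φ₁ k)).1.1) aestronglyMeasurable_const hd0
  set φ : ℕ → ℕ := fun k => φ₁ (φ₂ k)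
  have hφ : StrictMono φ := hφ₁.comp hφ₂
  have hJae : ∀ᵐ x ∂μ, Tendsto (fun k => J (φ k) x) atTop (𝓝 (σ₀ x)) := by
    filter_upwards [hσ₀, hd] with x h1 h2
    have h3 : Tendsto (fun k => s (φ k) x - J (φ k) x) atTop (𝓝 0) := h2
    have h4 := (h1.comp hφ₂.tendsto_atTop).sub h3
    rw [sub_zero] at h4
    exact h4.congr fun k => sub_sub_cancel _ _
  have hσm : AEStronglyMeasurable σ₀ μ :=
    aestronglyMeasurable_of_tendsto_ae atTop (fun k => (h (φ k)).1.1) hJae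
  have hJ2 : Tendsto (fun k => eLpNorm (J (φ k) - σ₀) 2 μ) atTop (𝓝 0) :=
    tendsto_eLpNorm_sub_of_dominated (u := fun _ _ => (1 : ℝ)) (u₀ := fun _ => (1 : ℝ))
      zero_le_one (fun k => aestronglyMeasurable_const) (memLp_const _)
      (tendsto_const_nhds.congr fun _ => (eLpNorm_sub_self _).symm)
      (fun k => (h (φ k)).1.1) (fun k => by filter_upwards [hJn (φ k)] with x hx; simpa using hx)
      (Eventually.of_forall fun x => tendsto_const_nhds) hJae
  have hσs : ∀ᵐ x ∂μ, IsOrthogonalStructure (σ₀ x) := by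
    filter_upwards [hJae, ae_all_iff.2 fun k => (h (φ k)).2] with x h1 h2
    refine ⟨tendsto_nhds_unique ((continuous_star.tendsto _).comp h1)
      (h1.neg.congr fun k => (h2 k).1.symm), ?_⟩
    exact tendsto_nhds_unique (h1.mul h1) (tendsto_const_nhds.congr fun k => (h2 k).2.symm)
  -- strong convergence of the derivatives, in the Hilbert space `L²`
  let x : ℕ → Lp (TupleSpace V ι) 2 μ := fun k => (memLp_tupleEquiv (ma (φ k))).toLp
  have hxn : ∀ k, ‖x k‖ = √(∫ x, hsGrad (a (φ k) x) (a (φ k) x) ∂μ) := fun k => by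
    rw [← norm_sq_toLp_tupleEquiv (memLp_tupleEquiv (ma (φ k))), Real.sqrt_sq (norm_nonneg _)]
  have hx : Tendsto (fun k => ‖x k‖) atTop (𝓝 √I) := by
    simp only [hxn]
    exact (hI.comp hφ.tendsto_atTop).sqrt
  have hclos := fun z y => hD.memClosure_of_convexHull (fun k => (h (φ k)).1) hσm hJ2
    (x := x) (fun k => MemLp.coeFn_toLp _) (z := z) (y := y)
  have hnorm : ∀ y : Lp (TupleSpace V ι) 2 μ, ‖y‖ ^ 2
      = ∫ p, hsGrad ((tupleEquiv V ι).symm (y p)) ((tupleEquiv V ι).symm (y p)) ∂μ := fun y => by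
    rw [← real_inner_self_eq_norm_sq, L2.inner_def]
    refine integral_congr_ae (Eventually.of_forall fun p => ?_)
    beta_reduce
    rw [← inner_tupleEquiv, ContinuousLinearEquiv.apply_symm_apply]
  obtain ⟨y, hy⟩ := exists_tendsto_of_convexHull hx fun z y hz hzy => by
    have h1 := hmin _ _ ⟨(hclos z y hz hzy).1, hσs⟩
    rw [← hnorm] at h1
    exact Real.sqrt_le_iff.2 ⟨norm_nonneg _, h1⟩
  obtain ⟨hy1, hy2⟩ := hclos x y (fun n => subset_convexHull ℝ _ ⟨n, Set.self_mem_Ici, rfl⟩) hy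
  refine ⟨φ, σ₀, _, hφ, ⟨hy1, hσs⟩, ?_, hJ2, hy2.congr fun n => eLpNorm_congr_ae ?_⟩
  · rw [← hnorm, tendsto_nhds_unique hy.norm hx]
    refine Real.sq_sqrt (ge_of_tendsto' hI fun k => integral_nonneg fun x => hsGrad_self_nonneg _)
  · filter_upwards [MemLp.coeFn_toLp (memLp_tupleEquiv (ma (φ n)))] with p hp
    simp only [Pi.sub_apply, x, hp, ContinuousLinearEquiv.symm_apply_apply]

/-- The direct method: if there are complex structures in the closure of `D`, then there is one of
least energy. -/
lemma IsJetAlgebra.exists_minimal (hD : IsJetAlgebra μ D)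
    (h : ∃ J a, MemStructures μ D J a) : ∃ J a, IsMinimalStructure μ D J a := by
  let S : Set ℝ := {r | ∃ J a, MemStructures μ D J a ∧ r = ∫ x, hsGrad (a x) (a x) ∂μ}
  have hne : S.Nonempty := by
    obtain ⟨J, a, hJ⟩ := h
    exact ⟨_, J, a, hJ, rfl⟩
  have hbd : BddBelow S := ⟨0, by
    rintro _ ⟨J, a, -, rfl⟩
    exact integral_nonneg fun x => hsGrad_self_nonneg _⟩
  obtain ⟨u, -, hu, hmem⟩ := exists_seq_tendsto_sInf hne hbd
  choose J a hJ hu' using hmem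
  have hmin : ∀ K k, MemStructures μ D K k → sInf S ≤ ∫ x, hsGrad (k x) (k x) ∂μ :=
    fun K k hK => csInf_le hbd ⟨K, k, hK, rfl⟩
  obtain ⟨φ, J₀, a₀, -, h1, h2, -⟩ := hD.exists_subseq_tendsto hJ
    (by simpa only [← hu'] using hu) hmin
  exact ⟨J₀, a₀, h1, fun K k hK => by rw [h2]; exact hmin K k hK⟩

end Jets

end

section

/-! ### Rellich's theorem in Euclidean space -/

section Rellich

open scoped FourierTransform SchwartzMap LineDeriv

lemma integral_norm_sq_le_toReal {X E : Type*} [MeasurableSpace X] {μ : Measure X}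
    [NormedAddCommGroup E] {f : X → E} (hf : AEStronglyMeasurable f μ) {A : ENNReal} (hA : A ≠ ⊤)
    (h : ∫⁻ x, ‖f x‖ₑ ^ 2 ∂μ ≤ A) : ∫ x, ‖f x‖ ^ 2 ∂μ ≤ A.toReal := by
  rw [integral_eq_lintegral_of_nonneg_ae (Eventually.of_forall fun x => by positivity)
    (show AEStronglyMeasurable (fun x => ‖f x‖ ^ 2) μ from hf.norm.pow 2)]
  refine ENNReal.toReal_mono hA (le_trans (le_of_eq ?_) h)
  refine lintegral_congr fun x => ?_
  rw [ENNReal.ofReal_pow (norm_nonneg _), ofReal_norm]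

lemma norm_sq_toLp_two {X E : Type*} [MeasurableSpace X] {μ : Measure X}
    [NormedAddCommGroup E] [InnerProductSpace ℂ E] {f : X → E} (h : MemLp f 2 μ) :
    ‖h.toLp‖ ^ 2 = ∫ x, ‖f x‖ ^ 2 ∂μ := by
  have h1 : ((‖h.toLp‖ ^ 2 : ℝ) : ℂ) = ((∫ x, ‖f x‖ ^ 2 ∂μ : ℝ) : ℂ) := by
    have h2 := inner_self_eq_norm_sq_to_K (𝕜 := ℂ) h.toLp
    rw [L2.inner_def] at h2
    push_cast
    refine Eq.trans h2.symm ?_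
    rw [← integral_complex_ofReal]
    refine integral_congr_ae ?_
    filter_upwards [h.coeFn_toLp] with x hx
    rw [hx, inner_self_eq_norm_sq_to_K]
    simp
  exact_mod_cast h1

variable {m : ℕ}

/-- The plane wave of frequency `ξ`, cut off outside `K`. -/
def planeWave (K : Set (Model m)) (ξ x : Model m) : ℂ :=
  K.indicator (fun x => Complex.exp (2 * Real.pi * inner ℝ x ξ * Complex.I)) x

lemma norm_planeWave (K : Set (Model m)) (ξ x : Model m) :
    ‖planeWave K ξ x‖ = ‖K.indicator (fun _ => (1 : ℝ)) x‖ := by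
  by_cases hx : x ∈ K
  · have : (2 * Real.pi * inner ℝ x ξ * Complex.I : ℂ)
        = ((2 * Real.pi * inner ℝ x ξ : ℝ) : ℂ) * Complex.I := by push_cast; ring
    simp only [planeWave, Set.indicator_of_mem hx, this, Complex.norm_exp_ofReal_mul_I, norm_one]
  · simp [planeWave, hx]

lemma memLp_planeWave {K : Set (Model m)} (hK : IsCompact K) (ξ : Model m) :
    MemLp (planeWave K ξ) 2 volume := by
  have h1 : MemLp (K.indicator fun _ : Model m => (1 : ℝ)) 2 volume :=
    memLp_indicator_const 2 hK.measurableSet 1 (Or.inr hK.measure_lt_top.ne)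
  refine MemLp.of_le h1 ?_ (Eventually.of_forall fun x => (norm_planeWave K ξ x).le)
  refine (Continuous.aestronglyMeasurable ?_).indicator hK.measurableSet
  fun_prop

lemma fourier_eq_inner {K : Set (Model m)} (hK : IsCompact K) (ξ : Model m) (f : 𝓢(Model m, ℂ))
    (hf : ∀ x, x ∉ K → f x = 0) :
    𝓕 f ξ = inner ℂ (memLp_planeWave hK ξ).toLp (f.toLp 2 volume) := by
  rw [L2.inner_def, SchwartzMap.fourier_coe, Real.fourier_eq']
  refine integral_congr_ae ?_
  filter_upwards [(memLp_planeWave hK ξ).coeFn_toLp, f.coeFn_toLp 2 volume] with x h1 h2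
  rw [h1, h2, RCLike.inner_apply]
  by_cases hx : x ∈ K
  · rw [planeWave, Set.indicator_of_mem hx, ← Complex.exp_conj, smul_eq_mul, mul_comm]
    congr 2
    simp only [map_mul, Complex.conj_I, Complex.conj_ofReal]
    rw [← Complex.ofReal_ofNat, Complex.conj_ofReal]
    push_cast
    ring
  · simp [hf x hx]

lemma integral_norm_sq_mul_fourier (f : 𝓢(Model m, ℂ)) :
    (2 * Real.pi) ^ 2 * ∫ ξ, ‖ξ‖ ^ 2 * ‖𝓕 f ξ‖ ^ 2
      = ∑ i : Fin m, ∫ x, ‖(∂_{EuclideanSpace.single i (1 : ℝ)} f : 𝓢(Model m, ℂ)) x‖ ^ 2 ∧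
    Integrable (fun ξ => ‖ξ‖ ^ 2 * ‖𝓕 f ξ‖ ^ 2) := by
  have h : ∀ (i : Fin m) ξ, ‖𝓕 (∂_{EuclideanSpace.single i (1 : ℝ)} f : 𝓢(Model m, ℂ)) ξ‖ ^ 2
      = (2 * Real.pi) ^ 2 * (‖ξ i‖ ^ 2 * ‖𝓕 f ξ‖ ^ 2) := fun i ξ => by
    have ht : (fun x : Model m => inner ℝ x (EuclideanSpace.single i (1 : ℝ))).HasTemperateGrowth :=
      ((innerSL ℝ).flip (EuclideanSpace.single i (1 : ℝ))).hasTemperateGrowth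
    rw [SchwartzMap.fourier_lineDerivOp_eq, smul_apply,
      SchwartzMap.smulLeftCLM_apply_apply ht, norm_smul, norm_smul, mul_pow, mul_pow]
    congr 1
    · simp [abs_of_pos Real.pi_pos]
    · have : inner ℝ ξ (EuclideanSpace.single i (1 : ℝ)) = ξ i := by
        rw [EuclideanSpace.inner_single_right]
        simp
      rw [this]
  have hi : ∀ i : Fin m, Integrable (fun ξ : Model m => ‖ξ i‖ ^ 2 * ‖𝓕 f ξ‖ ^ 2) := fun i => by
    have h1 := ((𝓕 (∂_{EuclideanSpace.single i (1 : ℝ)} f : 𝓢(Model m, ℂ))).memLp 2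
      volume).norm.integrable_sq
    simp only [h] at h1
    have h2 := h1.const_mul ((2 * Real.pi) ^ 2)⁻¹
    refine h2.congr (Eventually.of_forall fun ξ => ?_)
    have : (2 * Real.pi) ^ 2 ≠ 0 := by positivity
    simp only
    rw [inv_mul_cancel_left₀ this]
  have hn : ∀ ξ : Model m, ‖ξ‖ ^ 2 * ‖𝓕 f ξ‖ ^ 2 = ∑ i, ‖ξ i‖ ^ 2 * ‖𝓕 f ξ‖ ^ 2 := fun ξ => by
    rw [EuclideanSpace.norm_sq_eq, Finset.sum_mul]
  simp only [hn]
  refine ⟨?_, integrable_finsetSum _ fun i _ => hi i⟩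
  rw [integral_finsetSum _ fun i _ => hi i, Finset.mul_sum]
  refine Finset.sum_congr rfl fun i _ => ?_
  rw [← SchwartzMap.integral_norm_sq_fourier, ← integral_const_mul]
  simp only [h]

/-- The part of the Fourier transform outside a ball is controlled by the derivative. -/
lemma integral_norm_sq_le_fourier_ball (f : 𝓢(Model m, ℂ)) {R : ℝ} (hR : 0 < R) :
    ∫ x, ‖f x‖ ^ 2 ≤ (∫ ξ in Metric.ball 0 R, ‖𝓕 f ξ‖ ^ 2)
      + (R ^ 2)⁻¹ * ∑ i : Fin m, ∫ x, ‖(∂_{EuclideanSpace.single i (1 : ℝ)} f : 𝓢(Model m, ℂ)) x‖ ^ 2 := by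
  obtain ⟨e, hint⟩ := integral_norm_sq_mul_fourier f
  have hF : Integrable (fun ξ => ‖𝓕 f ξ‖ ^ 2) := ((𝓕 f).memLp 2 volume).norm.integrable_sq
  rw [← SchwartzMap.integral_norm_sq_fourier,
    ← integral_add_compl (Metric.isOpen_ball (x := (0 : Model m)) (ε := R)).measurableSet hF, ← e]
  gcongr
  have h0 : 0 ≤ ∫ ξ, ‖ξ‖ ^ 2 * ‖𝓕 f ξ‖ ^ 2 := integral_nonneg fun ξ => by positivity
  have h1 : ∫ ξ in (Metric.ball 0 R)ᶜ, ‖𝓕 f ξ‖ ^ 2 ≤ (R ^ 2)⁻¹ * ∫ ξ, ‖ξ‖ ^ 2 * ‖𝓕 f ξ‖ ^ 2 := by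
    rw [← integral_const_mul]
    refine (setIntegral_mono_on hF.integrableOn (hint.const_mul _).integrableOn
      Metric.isOpen_ball.measurableSet.compl fun ξ hξ => ?_).trans
      (setIntegral_le_integral (hint.const_mul _) (Eventually.of_forall fun ξ => by positivity))
    have : R ≤ ‖ξ‖ := by simpa using hξ
    rw [← mul_assoc]
    refine le_mul_of_one_le_left (by positivity) ?_
    rw [inv_mul_eq_div, one_le_div (by positivity)]
    gcongr
  refine h1.trans ?_
  gcongr
  refine le_mul_of_one_le_left h0 ?_
  nlinarith [Real.pi_gt_three]

/-- Rellich's theorem for Schwartz functions. -/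
lemma rellich_schwartz {f : ℕ → 𝓢(Model m, ℂ)} {K : Set (Model m)} (hK : IsCompact K)
    (hf : ∀ k x, x ∉ K → f k x = 0) {A : ℝ} (hA : ∀ k, ∫ x, ‖f k x‖ ^ 2 ≤ A)
    (hA' : ∀ k (i : Fin m), ∫ x, ‖(∂_{EuclideanSpace.single i (1 : ℝ)} (f k) : 𝓢(Model m, ℂ)) x‖ ^ 2 ≤ A) :
    ∃ φ : ℕ → ℕ, StrictMono φ ∧ ∃ f₀ : Model m → ℂ,
      ∀ᵐ x, Tendsto (fun k => f (φ k) x) atTop (𝓝 (f₀ x)) := by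
  have hfact : Fact ((1 : ENNReal) ≤ 2) := ⟨by norm_num⟩
  let u : ℕ → Lp ℂ 2 (volume : Measure (Model m)) := fun k => (f k).toLp 2 volume
  have hu : ∀ k, ‖u k‖ ≤ √A := fun k =>
    Real.le_sqrt_of_sq_le ((norm_sq_toLp_two ((f k).memLp 2 volume)).le.trans (hA k))
  -- weak compactness gives pointwise convergence of the Fourier transforms
  let w : ℕ → WeakDual ℂ (Lp ℂ 2 (volume : Measure (Model m))) := fun k =>
    StrongDual.toWeakDual (innerSL ℂ (u k))
  have : Fact ((2 : ENNReal) ≠ ⊤) := ⟨by norm_num⟩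
  obtain ⟨w₀, -, φ, hφ, hw⟩ := WeakDual.isSeqCompact_closedBall ℂ
    (Lp ℂ 2 (volume : Measure (Model m))) 0 √A (x := w) (fun k => by
      rw [Set.mem_preimage, mem_closedBall_zero_iff]
      exact (innerSL_apply_norm (𝕜 := ℂ) (u k)).le.trans (hu k))
  have hpt : ∀ ξ, ∃ L, Tendsto (fun k => 𝓕 (f (φ k)) ξ) atTop (𝓝 L) := fun ξ => by
    have h1 := ((WeakDual.eval_continuous ((memLp_planeWave hK ξ).toLp)).tendsto w₀).comp hw
    have h2 := (Complex.continuous_conj.tendsto _).comp h1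
    refine ⟨_, h2.congr fun k => ?_⟩
    rw [fourier_eq_inner hK ξ (f (φ k)) (hf _)]
    change (starRingEnd ℂ) (inner ℂ (u (φ k)) (memLp_planeWave hK ξ).toLp) = _
    exact inner_conj_symm _ _
  choose F₀ hF₀ using hpt
  set B : ℝ := (eLpNorm (K.indicator fun _ : Model m => (1 : ℝ)) 2 volume).toReal * √A
  have hFb : ∀ k ξ, ‖𝓕 (f k) ξ‖ ≤ B := fun k ξ => by
    rw [fourier_eq_inner hK ξ (f k) (hf _)]
    refine (norm_inner_le_norm _ _).trans ?_
    refine mul_le_mul ?_ (hu k) (norm_nonneg _) ENNReal.toReal_nonneg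
    rw [Lp.norm_toLp]
    exact le_of_eq (congrArg _ (eLpNorm_congr_norm_ae (Eventually.of_forall (norm_planeWave K ξ))))
  have hball : ∀ R : ℝ, Tendsto (fun p : ℕ × ℕ => ∫ ξ in Metric.ball 0 R,
      ‖𝓕 (f (φ p.1)) ξ - 𝓕 (f (φ p.2)) ξ‖ ^ 2) atTop (𝓝 0) := fun R => by
    have hz : ∫ _ξ in Metric.ball (0 : Model m) R, (0 : ℝ) = 0 := by simp
    rw [← hz]
    refine tendsto_integral_filter_of_dominated_convergence (fun _ => (B + B) ^ 2) ?_ ?_ ?_ ?_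
    · exact Eventually.of_forall fun p => (((𝓕 (f (φ p.1))).continuous.sub
        (𝓕 (f (φ p.2))).continuous).norm.pow 2).aestronglyMeasurable
    · refine Eventually.of_forall fun p => Eventually.of_forall fun ξ => ?_
      rw [Real.norm_of_nonneg (by positivity)]
      gcongr
      exact (norm_sub_le _ _).trans (add_le_add (hFb _ _) (hFb _ _))
    · exact integrableOn_const (Metric.isBounded_ball.measure_lt_top).ne
    · refine Eventually.of_forall fun ξ => ?_
      have h1 : Tendsto (fun p : ℕ × ℕ => 𝓕 (f (φ p.1)) ξ - 𝓕 (f (φ p.2)) ξ) atTop (𝓝 0) := by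
        rw [← prod_atTop_atTop_eq, ← sub_self (F₀ ξ)]
        exact ((hF₀ ξ).comp tendsto_fst).sub ((hF₀ ξ).comp tendsto_snd)
      simpa using h1.norm.pow 2
  have hA0 : 0 ≤ A := (integral_nonneg fun x => by positivity).trans (hA 0)
  have hmain : ∀ (R : ℝ), 0 < R → ∀ k j, ‖u k - u j‖ ^ 2 ≤
      (∫ ξ in Metric.ball 0 R, ‖𝓕 (f k) ξ - 𝓕 (f j) ξ‖ ^ 2) + (R ^ 2)⁻¹ * (m * (4 * A)) := by
    intro R hR k j
    have e1 : u k - u j = (f k - f j).toLp 2 volume := rfl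
    have e2 : ‖u k - u j‖ ^ 2 = ∫ x, ‖(f k - f j) x‖ ^ 2 := by
      rw [e1]
      exact norm_sq_toLp_two ((f k - f j).memLp 2 volume)
    rw [e2]
    refine (integral_norm_sq_le_fourier_ball (f k - f j) hR).trans ?_
    have e3 : 𝓕 (f k - f j) = 𝓕 (f k) - 𝓕 (f j) :=
      map_sub (AddMonoidHom.mk' (𝓕 : 𝓢(Model m, ℂ) → 𝓢(Model m, ℂ)) FourierTransform.fourier_add) _ _
    rw [e3]
    refine add_le_add le_rfl ?_
    gcongr
    refine (Finset.sum_le_card_nsmul _ _ (4 * A) fun i _ => ?_).trans (by simp)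
    set a : 𝓢(Model m, ℂ) := ∂_{EuclideanSpace.single i (1 : ℝ)} (f k)
    set b : 𝓢(Model m, ℂ) := ∂_{EuclideanSpace.single i (1 : ℝ)} (f j)
    have e4 : (∂_{EuclideanSpace.single i (1 : ℝ)} (f k - f j) : 𝓢(Model m, ℂ)) = a - b :=
      map_sub (AddMonoidHom.mk' (fun g : 𝓢(Model m, ℂ) =>
        (∂_{EuclideanSpace.single i (1 : ℝ)} g : 𝓢(Model m, ℂ)))
        (LineDeriv.lineDerivOp_add _)) _ _
    rw [e4]
    have ia : Integrable fun x => ‖a x‖ ^ 2 := (a.memLp 2 volume).norm.integrable_sq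
    have ib : Integrable fun x => ‖b x‖ ^ 2 := (b.memLp 2 volume).norm.integrable_sq
    calc ∫ x, ‖(a - b) x‖ ^ 2 ≤ ∫ x, (2 * ‖a x‖ ^ 2 + 2 * ‖b x‖ ^ 2) := by
          refine integral_mono ((a - b).memLp 2 volume).norm.integrable_sq
            ((ia.const_mul 2).add (ib.const_mul 2)) fun x => ?_
          have h1 := norm_sub_le (a x) (b x)
          have h2 := norm_nonneg (a x - b x)
          simp only [sub_apply]
          nlinarith [sq_nonneg (‖a x‖ - ‖b x‖)]
      _ = 2 * (∫ x, ‖a x‖ ^ 2) + 2 * ∫ x, ‖b x‖ ^ 2 := by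
          rw [integral_add (ia.const_mul 2) (ib.const_mul 2), integral_const_mul, integral_const_mul]
      _ ≤ 4 * A := by linarith [hA' k i, hA' j i]
  have hcau : CauchySeq fun k => u (φ k) := by
    rw [cauchySeq_iff_tendsto_dist_atTop_0]
    have hsq : Tendsto (fun p : ℕ × ℕ => ‖u (φ p.1) - u (φ p.2)‖ ^ 2) atTop (𝓝 0) := by
      rw [Metric.tendsto_nhds]
      intro ε hε
      obtain ⟨R, hR, hRε⟩ : ∃ R : ℝ, 0 < R ∧ (R ^ 2)⁻¹ * (m * (4 * A)) < ε / 2 := by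
        have h1 : Tendsto (fun R : ℝ => (R ^ 2)⁻¹ * (m * (4 * A))) atTop (𝓝 0) := by
          have := (tendsto_inv_atTop_zero.comp (tendsto_pow_atTop (α := ℝ) two_ne_zero)).mul_const
            (m * (4 * A))
          simpa [Function.comp_def] using this
        exact ((eventually_gt_atTop 0).and (h1.eventually (gt_mem_nhds (half_pos hε)))).exists
      filter_upwards [(hball R).eventually (gt_mem_nhds (half_pos hε))] with p hp
      rw [Real.dist_eq, sub_zero, abs_of_nonneg (by positivity)]
      linarith [hmain R hR (φ p.1) (φ p.2)]
    have := hsq.sqrt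
    simpa [dist_eq_norm, Real.sqrt_sq] using this
  obtain ⟨u₀, hu₀⟩ := cauchySeq_tendsto_of_complete hcau
  obtain ⟨ψ, hψ, hae⟩ := exists_subseq_tendsto_ae (fun k => Lp.aestronglyMeasurable (u (φ k)))
    (Lp.aestronglyMeasurable u₀) ((Lp.tendsto_Lp_iff_tendsto_eLpNorm' _ u₀).1 hu₀)
  refine ⟨φ ∘ ψ, hφ.comp hψ, u₀, ?_⟩
  filter_upwards [hae, ae_all_iff.2 fun k => (f k).coeFn_toLp 2 volume] with x h1 h2
  exact h1.congr fun k => h2 _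

/-- Successive extraction of subsequences, over a finite index set. -/
lemma exists_common_subseq {κ : Type*} (S : Finset κ) (P : κ → (ℕ → ℕ) → Prop)
    (hP : ∀ a ∈ S, ∀ φ : ℕ → ℕ, StrictMono φ → ∃ ψ : ℕ → ℕ, StrictMono ψ ∧ P a (φ ∘ ψ))
    (hmono : ∀ a, ∀ φ ψ : ℕ → ℕ, StrictMono ψ → P a φ → P a (φ ∘ ψ)) :
    ∃ φ : ℕ → ℕ, StrictMono φ ∧ ∀ a ∈ S, P a φ := by
  classical
  induction S using Finset.induction_on with
  | empty => exact ⟨id, strictMono_id, by simp⟩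
  | insert a S ha ih =>
    obtain ⟨φ, hφ, h⟩ := ih fun b hb => hP b (Finset.mem_insert_of_mem hb)
    obtain ⟨ψ, hψ, h'⟩ := hP a (Finset.mem_insert_self a S) φ hφ
    refine ⟨φ ∘ ψ, hφ.comp hψ, fun b hb => ?_⟩
    rcases Finset.mem_insert.1 hb with rfl | hb
    · exact h'
    · exact hmono b φ ψ hψ (h b hb)

/-- Rellich's theorem for smooth real functions supported in a fixed compact set. -/
lemma rellich_real {f : ℕ → Model m → ℝ} {K : Set (Model m)} (hK : IsCompact K)
    (hf : ∀ k x, x ∉ K → f k x = 0) (hs : ∀ k, ContDiff ℝ ∞ (f k)) {A : ENNReal} (hA : A ≠ ⊤)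
    (h1 : ∀ k, ∫⁻ x, ‖f k x‖ₑ ^ 2 ≤ A) (h2 : ∀ k, ∫⁻ x, ‖fderiv ℝ (f k) x‖ₑ ^ 2 ≤ A) :
    ∃ φ : ℕ → ℕ, StrictMono φ ∧ ∃ f₀ : Model m → ℝ,
      ∀ᵐ x, Tendsto (fun k => f (φ k) x) atTop (𝓝 (f₀ x)) := by
  have hc : ∀ k, HasCompactSupport fun x => (f k x : ℂ) := fun k =>
    HasCompactSupport.intro hK fun x hx => by simp [hf k x hx]
  have hs' : ∀ k, ContDiff ℝ ∞ fun x => (f k x : ℂ) := fun k =>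
    Complex.ofRealCLM.contDiff.comp (hs k)
  let F : ℕ → 𝓢(Model m, ℂ) := fun k => (hc k).toSchwartzMap (hs' k)
  have hF : ∀ k x, F k x = (f k x : ℂ) := fun k x => rfl
  have hd : ∀ k (i : Fin m) x, ‖(∂_{EuclideanSpace.single i (1 : ℝ)} (F k) : 𝓢(Model m, ℂ)) x‖
      ≤ ‖fderiv ℝ (f k) x‖ := fun k i x => by
    rw [SchwartzMap.lineDerivOp_apply_eq_fderiv]
    have e : fderiv ℝ (F k) x = Complex.ofRealCLM.comp (fderiv ℝ (f k) x) :=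
      (Complex.ofRealCLM.hasFDerivAt.comp x
        ((hs k).differentiable (by simp) x).hasFDerivAt).fderiv
    rw [e, ContinuousLinearMap.comp_apply, Complex.ofRealCLM_apply, Complex.norm_real]
    refine (ContinuousLinearMap.le_opNorm _ _).trans (le_of_eq ?_)
    simp
  obtain ⟨φ, hφ, f₀, h⟩ := rellich_schwartz (f := F) hK (fun k x hx => by rw [hF, hf k x hx]; simp)
    (A := A.toReal)
    (fun k => integral_norm_sq_le_toReal (F k).continuous.aestronglyMeasurable hA (by
      refine le_trans (le_of_eq (lintegral_congr fun x => ?_)) (h1 k)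
      rw [hF, ← ofReal_norm, Complex.norm_real, ofReal_norm]))
    (fun k i => integral_norm_sq_le_toReal (SchwartzMap.continuous _).aestronglyMeasurable hA (by
      refine (lintegral_mono fun x => ?_).trans (h2 k)
      rw [← ofReal_norm, ← ofReal_norm]
      gcongr
      exact hd k i x))
  refine ⟨φ, hφ, fun x => (f₀ x).re, ?_⟩
  filter_upwards [h] with x hx
  exact (Complex.continuous_re.tendsto _).comp hx

/-- Rellich's theorem for smooth maps to a finite-dimensional space, supported in a fixed compact
set. -/
lemma rellich_vector {E : Type*} [NormedAddCommGroup E] [NormedSpace ℝ E] [FiniteDimensional ℝ E]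
    {f : ℕ → Model m → E} {K : Set (Model m)} (hK : IsCompact K)
    (hf : ∀ k x, x ∉ K → f k x = 0) (hs : ∀ k, ContDiff ℝ ∞ (f k)) {A : ENNReal} (hA : A ≠ ⊤)
    (h1 : ∀ k, ∫⁻ x, ‖f k x‖ₑ ^ 2 ≤ A) (h2 : ∀ k, ∫⁻ x, ‖fderiv ℝ (f k) x‖ₑ ^ 2 ≤ A) :
    ∃ φ : ℕ → ℕ, StrictMono φ ∧ ∃ f₀ : Model m → E,
      ∀ᵐ x, Tendsto (fun k => f (φ k) x) atTop (𝓝 (f₀ x)) := by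
  let b := Module.finBasis ℝ E
  let ℓ : Fin (Module.finrank ℝ E) → E →L[ℝ] ℝ := fun a => LinearMap.toContinuousLinearMap (b.coord a)
  obtain ⟨φ, hφ, h⟩ := exists_common_subseq Finset.univ
    (fun a φ => ∃ g : Model m → ℝ, ∀ᵐ x, Tendsto (fun k => ℓ a (f (φ k) x)) atTop (𝓝 (g x)))
    (fun a _ φ hφ => by
      have hfd : ∀ k x, ‖fderiv ℝ (fun y => ℓ a (f k y)) x‖ₑ ≤ ‖ℓ a‖ₑ * ‖fderiv ℝ (f k) x‖ₑ := by
        intro k x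
        have e : fderiv ℝ (fun y => ℓ a (f k y)) x = (ℓ a).comp (fderiv ℝ (f k) x) :=
          ((ℓ a).hasFDerivAt.comp x ((hs k).differentiable (by simp) x).hasFDerivAt).fderiv
        rw [e, ← ofReal_norm, ← ofReal_norm, ← ofReal_norm, ← ENNReal.ofReal_mul (norm_nonneg _)]
        exact ENNReal.ofReal_le_ofReal (ContinuousLinearMap.opNorm_comp_le _ _)
      obtain ⟨ψ, hψ, g, hg⟩ := rellich_real (f := fun k x => ℓ a (f (φ k) x)) hK
        (fun k x hx => by simp [hf _ x hx]) (fun k => (ℓ a).contDiff.comp (hs _))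
        (A := ‖ℓ a‖ₑ ^ 2 * A) (ENNReal.mul_ne_top (by simp) hA)
        (fun k => by
          calc ∫⁻ x, ‖ℓ a (f (φ k) x)‖ₑ ^ 2 ≤ ∫⁻ x, ‖ℓ a‖ₑ ^ 2 * ‖f (φ k) x‖ₑ ^ 2 := by
                refine lintegral_mono fun x => ?_
                rw [← mul_pow]
                gcongr
                exact (ℓ a).le_opENorm _
            _ = ‖ℓ a‖ₑ ^ 2 * ∫⁻ x, ‖f (φ k) x‖ₑ ^ 2 := lintegral_const_mul' _ _ (by simp)
            _ ≤ _ := by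
                gcongr
                exact h1 _)
        (fun k => by
          calc ∫⁻ x, ‖fderiv ℝ (fun y => ℓ a (f (φ k) y)) x‖ₑ ^ 2
              ≤ ∫⁻ x, ‖ℓ a‖ₑ ^ 2 * ‖fderiv ℝ (f (φ k)) x‖ₑ ^ 2 := by
                refine lintegral_mono fun x => ?_
                rw [← mul_pow]
                gcongr
                exact hfd _ _
            _ = ‖ℓ a‖ₑ ^ 2 * ∫⁻ x, ‖fderiv ℝ (f (φ k)) x‖ₑ ^ 2 := lintegral_const_mul' _ _ (by simp)
            _ ≤ _ := by
                gcongr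
                exact h2 _)
      exact ⟨ψ, hψ, g, hg⟩)
    (fun a φ ψ hψ ⟨g, hg⟩ => ⟨g, hg.mono fun x hx => hx.comp hψ.tendsto_atTop⟩)
  choose g hg using fun a => h a (Finset.mem_univ a)
  refine ⟨φ, hφ, fun x => ∑ a, g a x • b a, ?_⟩
  filter_upwards [ae_all_iff.2 hg] with x hx
  have e : ∀ k, f (φ k) x = ∑ a, ℓ a (f (φ k) x) • b a := fun k => (b.sum_repr _).symm
  exact (tendsto_finsetSum Finset.univ fun a _ => (hx a).smul_const (b a)).congr
    fun k => (e k).symm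

end Rellich

end

section

/-! ### The Riemannian volume in charts -/

section Volume

variable {m : ℕ} {M : Type*} [TopologicalSpace M] [ChartedSpace (Model m) M]
  [IsManifold (𝓡 m) ∞ M] [T2Space M] [CompactSpace M] [MeasurableSpace M] [BorelSpace M]

lemma map_withDensity_of_measurable {X Y : Type*} [MeasurableSpace X] [MeasurableSpace Y]
    {ν : Measure X} {φ : X → Y} (hφ : Measurable φ) {r : Y → ENNReal} (hr : Measurable r) :
    (Measure.map φ ν).withDensity r = Measure.map φ (ν.withDensity fun x => r (φ x)) := by
  ext s hs
  rw [withDensity_apply _ hs, Measure.map_apply hφ hs, withDensity_apply _ (hφ hs),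
    setLIntegral_map hs hr hφ]

lemma tsupport_chartPartition_subset (p : M) :
    tsupport (chartPartition m M p) ⊆ (chartAt (Model m) p).source :=
  (SmoothPartitionOfUnity.exists_isSubordinate_chartAt_source (𝓡 m) M).choose_spec p

variable (m M) in
/-- The finitely many centres of charts whose partition function does not vanish. -/
def chartCenters : Finset M :=
  ((chartPartition m M).locallyFinite.finite_nonempty_of_compact).toFinset

lemma chartPartition_eq_zero {p : M} (hp : p ∉ chartCenters m M) (x : M) :
    chartPartition m M p x = 0 := by
  by_contra h
  exact hp (by
    rw [chartCenters, Set.Finite.mem_toFinset]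
    exact ⟨x, h⟩)

lemma exists_chartPartition_ne_zero (x : M) : ∃ p ∈ chartCenters m M, 0 < chartPartition m M p x := by
  obtain ⟨p, hp⟩ := (chartPartition m M).exists_pos_of_mem (Set.mem_univ x)
  exact ⟨p, by_contra fun h => hp.ne' (chartPartition_eq_zero h x), hp⟩

open Classical in
/-- The inverse of the chart around `p`, extended by a constant outside of the image of the
chart. -/
def chartInv (p : M) : Model m → M :=
  (extChartAt (𝓡 m) p).target.piecewise (extChartAt (𝓡 m) p).symm fun _ => p

lemma chartInv_apply {p : M} {y : Model m} (hy : y ∈ (extChartAt (𝓡 m) p).target) :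
    chartInv p y = (extChartAt (𝓡 m) p).symm y := by
  classical
  rw [chartInv]
  convert Set.piecewise_eq_of_mem _ _ _ hy

lemma measurableSet_target (p : M) : MeasurableSet (extChartAt (𝓡 m) p).target :=
  (isOpen_extChartAt_target p).measurableSet

lemma measurable_chartInv (p : M) : Measurable (chartInv (m := m) p) := by
  classical
  have := (continuousOn_extChartAt_symm (I := 𝓡 m) p).measurable_piecewise
    (continuousOn_const (c := p) (s := (extChartAt (𝓡 m) p).targetᶜ)) (measurableSet_target p)
  rw [chartInv]
  convert this

/-- The part of the image of the chart around `p` where the partition function is positive. -/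
def chartDomain (p : M) : Set (Model m) :=
  {y ∈ (extChartAt (𝓡 m) p).target | chartPartition m M p ((extChartAt (𝓡 m) p).symm y) ≠ 0}

lemma continuous_chartPartition (p : M) : Continuous (chartPartition m M p) :=
  ((chartPartition m M) p).2.continuous

lemma continuousOn_chartPartition (p : M) : ContinuousOn
    (fun y => chartPartition m M p ((extChartAt (𝓡 m) p).symm y)) (extChartAt (𝓡 m) p).target :=
  (continuous_chartPartition p).comp_continuousOn (continuousOn_extChartAt_symm p)

lemma isOpen_chartDomain (p : M) : IsOpen (chartDomain (m := m) p) :=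
  (continuousOn_chartPartition p).isOpen_inter_preimage (isOpen_extChartAt_target p)
    isOpen_compl_singleton

lemma chartDomain_subset (p : M) : chartDomain (m := m) p ⊆ (extChartAt (𝓡 m) p).target :=
  fun _ h => h.1

/-- The image in the chart around `p` of the support of the partition function. -/
def chartSupport (p : M) : Set (Model m) := extChartAt (𝓡 m) p '' tsupport (chartPartition m M p)

lemma isCompact_chartSupport (p : M) : IsCompact (chartSupport (m := m) p) := by
  refine (isClosed_tsupport _).isCompact.image_of_continuousOn ?_
  refine (continuousOn_extChartAt p).mono ?_
  rw [extChartAt_source]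
  exact tsupport_chartPartition_subset p

lemma chartSupport_subset (p : M) : chartSupport (m := m) p ⊆ (extChartAt (𝓡 m) p).target := by
  rintro _ ⟨x, hx, rfl⟩
  exact mem_extChartAt_target (tsupport_chartPartition_subset p hx)

lemma chartDomain_subset_chartSupport (p : M) : chartDomain (m := m) p ⊆ chartSupport p :=
  fun _ hy => ⟨_, subset_tsupport _ hy.2, (extChartAt (𝓡 m) p).right_inv hy.1⟩

/-- The density of the contribution of the chart around `p` to the Riemannian volume. -/
def chartWeight (g : RMetric m M) (p : M) (y : Model m) : ENNReal :=
  ENNReal.ofReal (√(gram g p y).det)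
    * ENNReal.ofReal (chartPartition m M p ((extChartAt (𝓡 m) p).symm y))

/-- The contribution of the chart around `p` to the Riemannian volume, in coordinates. -/
def chartMeasure (g : RMetric m M) (p : M) : Measure (Model m) :=
  (volume.restrict (extChartAt (𝓡 m) p).target).withDensity (chartWeight g p)

lemma continuousOn_det_gram (g : RMetric m M) (p : M) :
    ContinuousOn (fun y => √(gram g p y).det) (extChartAt (𝓡 m) p).target := by
  refine ContinuousOn.sqrt ?_
  simp only [Matrix.det_apply']
  exact continuousOn_finsetSum _ fun σ _ => continuousOn_const.mul
    (continuousOn_finsetProd _ fun i _ => (contDiffOn_gram g p _ _).continuousOn)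

lemma aemeasurable_sqrt_det (g : RMetric m M) (p : M) :
    AEMeasurable (fun y => ENNReal.ofReal (√(gram g p y).det))
      (volume.restrict (extChartAt (𝓡 m) p).target) :=
  ((continuousOn_det_gram g p).aemeasurable (measurableSet_target p)).ennreal_ofReal

lemma aemeasurable_partition (p : M) :
    AEMeasurable (fun y => ENNReal.ofReal (chartPartition m M p ((extChartAt (𝓡 m) p).symm y)))
      (volume.restrict (extChartAt (𝓡 m) p).target) :=
  ((continuousOn_chartPartition p).aemeasurable (measurableSet_target p)).ennreal_ofReal

lemma aemeasurable_chartWeight (g : RMetric m M) (p : M) :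
    AEMeasurable (chartWeight g p) (volume.restrict (extChartAt (𝓡 m) p).target) :=
  (aemeasurable_sqrt_det g p).mul (aemeasurable_partition p)

lemma chartVolume_withDensity (g : RMetric m M) (p : M) :
    (chartVolume g p).withDensity (fun x => ENNReal.ofReal (chartPartition m M p x))
      = Measure.map (chartInv p) (chartMeasure g p) := by
  have h1 : chartVolume g p = Measure.map (chartInv p)
      ((volume.restrict (extChartAt (𝓡 m) p).target).withDensity
        fun y => ENNReal.ofReal (√(gram g p y).det)) := by
    refine Measure.map_congr ((withDensity_absolutelyContinuous _ _).ae_le ?_)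
    filter_upwards [ae_restrict_mem (measurableSet_target p)] with y hy
    exact (chartInv_apply hy).symm
  rw [h1, map_withDensity_of_measurable (measurable_chartInv p)
    (continuous_chartPartition p).measurable.ennreal_ofReal, chartMeasure]
  congr 1
  rw [show chartWeight g p = (fun y => ENNReal.ofReal (√(gram g p y).det))
    * (fun y => ENNReal.ofReal (chartPartition m M p ((extChartAt (𝓡 m) p).symm y))) from rfl,
    withDensity_mul₀ (aemeasurable_sqrt_det g p) (aemeasurable_partition p)]
  refine withDensity_congr_ae ((withDensity_absolutelyContinuous _ _).ae_le ?_)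
  filter_upwards [ae_restrict_mem (measurableSet_target p)] with y hy
  rw [chartInv_apply hy]

lemma chartMeasure_eq_zero (g : RMetric m M) {p : M} (hp : p ∉ chartCenters m M) :
    chartMeasure g p = 0 := by
  have : chartWeight g p = 0 := by
    funext y
    simp [chartWeight, chartPartition_eq_zero hp]
  rw [chartMeasure, this, withDensity_zero]

lemma vol_eq_sum (g : RMetric m M) :
    vol g = Measure.sum fun p : chartCenters m M => Measure.map (chartInv p.1) (chartMeasure g p.1) := by
  ext s hs
  rw [vol, Measure.sum_apply _ hs, Measure.sum_apply _ hs]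
  simp only [chartVolume_withDensity]
  refine (tsum_subtype_eq_of_support_subset (f := fun p : M =>
    Measure.map (chartInv p) (chartMeasure g p) s) (s := chartCenters m M) fun p hp => ?_).symm
  by_contra h
  exact hp (by simp [chartMeasure_eq_zero g h])

lemma map_chartMeasure_le (g : RMetric m M) (p : M) :
    Measure.map (chartInv p) (chartMeasure g p) ≤ vol g := by
  by_cases hp : p ∈ chartCenters m M
  · rw [vol_eq_sum]
    exact Measure.le_sum (fun p : chartCenters m M => Measure.map (chartInv p.1)
      (chartMeasure g p.1)) ⟨p, hp⟩
  · rw [chartMeasure_eq_zero g hp, Measure.map_zero]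
    exact Measure.zero_le _

lemma chartWeight_eq_zero (g : RMetric m M) {p : M} {y : Model m}
    (hy : y ∈ (extChartAt (𝓡 m) p).target) (h : y ∉ chartDomain p) : chartWeight g p y = 0 := by
  have : chartPartition m M p ((extChartAt (𝓡 m) p).symm y) = 0 := by
    by_contra h'
    exact h ⟨hy, h'⟩
  rw [chartWeight, this, ENNReal.ofReal_zero, mul_zero]

lemma chartPartition_pos {p : M} {y : Model m} (h : y ∈ chartDomain p) :
    0 < chartPartition m M p ((extChartAt (𝓡 m) p).symm y) :=
  ((chartPartition m M).nonneg p _).lt_of_ne' h.2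

lemma sqrt_det_gram_pos (g : RMetric m M) {p : M} {y : Model m}
    (hy : y ∈ (extChartAt (𝓡 m) p).target) : 0 < √(gram g p y).det :=
  Real.sqrt_pos.2 (gram_posDef g hy).det_pos

lemma chartWeight_ne_zero (g : RMetric m M) {p : M} {y : Model m} (h : y ∈ chartDomain p) :
    chartWeight g p y ≠ 0 := by
  refine mul_ne_zero ?_ ?_
  · simpa using sqrt_det_gram_pos g h.1
  · simpa using chartPartition_pos h

/-- A property holding almost everywhere on the manifold holds almost everywhere in charts. -/
lemma ae_chart_of_ae_vol (g : RMetric m M) {P : M → Prop} (h : ∀ᵐ x ∂vol g, P x) (p : M) :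
    ∀ᵐ y, y ∈ chartDomain p → P ((extChartAt (𝓡 m) p).symm y) := by
  have h1 := ae_of_ae_map (measurable_chartInv p).aemeasurable
    ((map_chartMeasure_le g p).absolutelyContinuous.ae_le h)
  rw [chartMeasure, ae_withDensity_iff' (aemeasurable_chartWeight g p),
    ae_restrict_iff' (measurableSet_target p)] at h1
  filter_upwards [h1] with y hy hyd
  rw [← chartInv_apply hyd.1]
  exact hy hyd.1 (chartWeight_ne_zero g hyd)

/-- A property holding almost everywhere in charts holds almost everywhere on the manifold. -/
lemma ae_vol_of_ae_chart (g : RMetric m M) {P : M → Prop}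
    (h : ∀ p ∈ chartCenters m M, ∀ᵐ y, y ∈ chartDomain p → P ((extChartAt (𝓡 m) p).symm y)) :
    ∀ᵐ x ∂vol g, P x := by
  rw [vol_eq_sum, Measure.ae_sum_iff]
  rintro ⟨p, hp⟩
  -- the exceptional set in the chart is enlarged to a measurable null set
  have hN := h p hp
  set N := toMeasurable volume {y | ¬(y ∈ chartDomain p → P ((extChartAt (𝓡 m) p).symm y))}
  have hN0 : volume N = 0 := by
    rw [measure_toMeasurable]
    exact hN
  have hNm : MeasurableSet N := measurableSet_toMeasurable _ _
  have hc : Measurable fun x : (chartAt (Model m) p).source => extChartAt (𝓡 m) p x := by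
    have h1 := continuousOn_extChartAt (I := 𝓡 m) p
    rw [extChartAt_source] at h1
    exact h1.domRestrict.measurable
  have hsrc : MeasurableSet (chartAt (Model m) p).source := (chartAt (Model m) p).open_source.measurableSet
  let A : Set M := Subtype.val '' ((fun x : (chartAt (Model m) p).source =>
    extChartAt (𝓡 m) p x) ⁻¹' N)
  have hA : MeasurableSet A := (MeasurableEmbedding.subtype_coe hsrc).measurableSet_image.2 (hc hNm)
  have hmem : ∀ y, y ∈ chartDomain p → y ∉ N → P ((extChartAt (𝓡 m) p).symm y) := fun y hy hyN => by
    by_contra hP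
    exact hyN (subset_toMeasurable _ _ fun h => hP (h hy))
  let B : Set M := {x | chartPartition m M p x = 0}
  have hB : MeasurableSet B := (isClosed_singleton.preimage (continuous_chartPartition p)).measurableSet
  have hsub : {x | ¬P x} ⊆ A ∪ B := by
    intro x hx
    by_cases hxB : x ∈ B
    · exact Or.inr hxB
    have hxs : x ∈ (chartAt (Model m) p).source :=
      tsupport_chartPartition_subset p (subset_tsupport _ hxB)
    have hxs' : x ∈ (extChartAt (𝓡 m) p).source := by simpa using hxs
    refine Or.inl ⟨⟨x, hxs⟩, ?_, rfl⟩
    by_contra hxN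
    refine hx ?_
    have e := (extChartAt (𝓡 m) p).left_inv hxs'
    rw [← e]
    refine hmem _ ⟨mem_extChartAt_target hxs, ?_⟩ hxN
    rw [e]
    exact hxB
  refine measure_mono_null hsub ?_
  have h0 : ∀ᵐ y ∂chartMeasure g p, chartInv p y ∉ A ∪ B := by
    rw [chartMeasure, ae_withDensity_iff' (aemeasurable_chartWeight g p),
      ae_restrict_iff' (measurableSet_target p)]
    have : ∀ᵐ y, y ∉ N := measure_eq_zero_iff_ae_notMem.1 hN0
    filter_upwards [this] with y hyN hyt hyw
    rw [chartInv_apply hyt]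
    have hyd : y ∈ chartDomain p := by
      by_contra h
      exact hyw (chartWeight_eq_zero g hyt h)
    rintro (⟨⟨x, hxs⟩, hxN, hx⟩ | hyB)
    · refine hyN ?_
      have hx' : x = (extChartAt (𝓡 m) p).symm y := hx
      have : extChartAt (𝓡 m) p x ∈ N := hxN
      rwa [hx', (extChartAt (𝓡 m) p).right_inv hyt] at this
    · exact hyd.2 hyB
  rw [Measure.map_apply (measurable_chartInv p) (hA.union hB)]
  rw [ae_iff] at h0
  simp only [not_not] at h0
  exact h0

/-- The part of an integral over the manifold which is carried by the chart around `p`. -/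
lemma exists_lintegral_chart_le (g : RMetric m M) (p : M) : ∃ C : ENNReal, C ≠ ⊤ ∧
    ∀ f : M → ENNReal, AEMeasurable f (vol g) →
      ∫⁻ y in (extChartAt (𝓡 m) p).target,
        ENNReal.ofReal (chartPartition m M p ((extChartAt (𝓡 m) p).symm y))
          * f ((extChartAt (𝓡 m) p).symm y) ≤ C * ∫⁻ x, f x ∂vol g := by
  obtain ⟨c, hc, hcd⟩ : ∃ c : ℝ, 0 < c ∧ ∀ y ∈ chartSupport p, c ≤ √(gram g p y).det := by
    rcases (chartSupport (m := m) p).eq_empty_or_nonempty with h | h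
    · exact ⟨1, one_pos, by simp [h]⟩
    · obtain ⟨y, hy, hmin⟩ := (isCompact_chartSupport p).exists_isMinOn h
        ((continuousOn_det_gram g p).mono (chartSupport_subset p))
      exact ⟨_, sqrt_det_gram_pos g (chartSupport_subset p hy), fun z hz => hmin hz⟩
  refine ⟨ENNReal.ofReal c⁻¹, ENNReal.ofReal_ne_top, fun f hf => ?_⟩
  have hf1 : AEMeasurable f (Measure.map (chartInv p) (chartMeasure g p)) :=
    hf.mono_measure (map_chartMeasure_le g p)
  have hf2 : AEMeasurable (fun y => f (chartInv p y)) (chartMeasure g p) :=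
    hf1.comp_measurable (measurable_chartInv p)
  have h1 : ∫⁻ y in (extChartAt (𝓡 m) p).target, chartWeight g p y * f (chartInv p y)
      ≤ ∫⁻ x, f x ∂vol g := by
    have h2 := lintegral_withDensity_eq_lintegral_mul₀' (aemeasurable_chartWeight g p) hf2
    refine h2.symm.le.trans ?_
    change ∫⁻ y, f (chartInv p y) ∂chartMeasure g p ≤ _
    rw [← lintegral_map' hf1 (measurable_chartInv p).aemeasurable]
    exact lintegral_mono' (map_chartMeasure_le g p) le_rfl
  refine le_trans ?_ (mul_le_mul_right h1 _)
  rw [← lintegral_const_mul' _ _ ENNReal.ofReal_ne_top]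
  refine setLIntegral_mono' (measurableSet_target p) fun y hy => ?_
  rw [chartInv_apply hy, chartWeight]
  by_cases hyd : y ∈ chartDomain p
  · have h2 := hcd y (chartDomain_subset_chartSupport p hyd)
    have h3 : 1 ≤ ENNReal.ofReal c⁻¹ * ENNReal.ofReal √(gram g p y).det := by
      rw [← ENNReal.ofReal_mul (by positivity)]
      rw [ENNReal.one_le_ofReal, inv_mul_eq_div, one_le_div hc]
      exact h2
    rw [mul_assoc, ← mul_assoc (ENNReal.ofReal c⁻¹)]
    exact le_mul_of_one_le_left' h3
  · have : chartPartition m M p ((extChartAt (𝓡 m) p).symm y) = 0 := by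
      by_contra h'
      exact hyd ⟨hy, h'⟩
    rw [this, ENNReal.ofReal_zero, zero_mul]
    exact zero_le

/-- On compact subsets of the domain of positivity of the partition function, Lebesgue measure is
controlled by the Riemannian volume. -/
lemma exists_lintegral_compact_le (g : RMetric m M) (p : M) {K : Set (Model m)} (hK : IsCompact K)
    (hKp : K ⊆ chartDomain p) : ∃ C : ENNReal, C ≠ ⊤ ∧ ∀ f : M → ENNReal, AEMeasurable f (vol g) →
      ∫⁻ y in K, f ((extChartAt (𝓡 m) p).symm y) ≤ C * ∫⁻ x, f x ∂vol g := by
  obtain ⟨c, hc, hcd⟩ : ∃ c : ℝ, 0 < c ∧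
      ∀ y ∈ K, c ≤ chartPartition m M p ((extChartAt (𝓡 m) p).symm y) := by
    rcases K.eq_empty_or_nonempty with h | h
    · exact ⟨1, one_pos, by simp [h]⟩
    · obtain ⟨y, hy, hmin⟩ := hK.exists_isMinOn h
        ((continuousOn_chartPartition p).mono (hKp.trans (chartDomain_subset p)))
      exact ⟨_, chartPartition_pos (hKp hy), fun z hz => hmin hz⟩
  obtain ⟨C, hC, h⟩ := exists_lintegral_chart_le g p
  refine ⟨ENNReal.ofReal c⁻¹ * C, ENNReal.mul_ne_top ENNReal.ofReal_ne_top hC, fun f hf => ?_⟩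
  rw [mul_assoc]
  refine le_trans ?_ (mul_le_mul_right (h f hf) _)
  rw [← lintegral_const_mul' _ _ ENNReal.ofReal_ne_top]
  refine le_trans ?_ (lintegral_mono_set (hKp.trans (chartDomain_subset p)))
  refine setLIntegral_mono' hK.measurableSet fun y hy => ?_
  rw [← mul_assoc, ← ENNReal.ofReal_mul (by positivity)]
  refine le_mul_of_one_le_left' ?_
  rw [ENNReal.one_le_ofReal, inv_mul_eq_div, one_le_div hc]
  exact hcd y hy

instance isFiniteMeasure_vol (g : RMetric m M) : IsFiniteMeasure (vol g) := by
  rw [vol_eq_sum]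
  refine ⟨?_⟩
  rw [Measure.sum_apply _ MeasurableSet.univ, tsum_fintype]
  refine ENNReal.sum_lt_top.2 fun p _ => ?_
  rw [Measure.map_apply (measurable_chartInv _) MeasurableSet.univ, Set.preimage_univ, chartMeasure,
    withDensity_apply _ MeasurableSet.univ, Measure.restrict_univ]
  obtain ⟨C, hC⟩ := (isCompact_chartSupport p.1).exists_bound_of_continuousOn
    ((continuousOn_det_gram g p.1).mono (chartSupport_subset p.1))
  have h1 : ∀ y ∈ (extChartAt (𝓡 m) p.1).target,
      chartWeight g p.1 y ≤ (chartSupport p.1).indicator (fun _ => ENNReal.ofReal C) y := by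
    intro y hy
    by_cases hyd : y ∈ chartDomain p.1
    · have hys := chartDomain_subset_chartSupport p.1 hyd
      rw [Set.indicator_of_mem hys, chartWeight]
      refine (mul_le_mul' (ENNReal.ofReal_le_ofReal ((le_abs_self _).trans (hC y hys)))
        (ENNReal.ofReal_le_one.2 ((chartPartition m M).le_one _ _))).trans_eq (mul_one _)
    · rw [chartWeight_eq_zero g hy hyd]
      exact zero_le
  refine (setLIntegral_mono' (measurableSet_target _) h1).trans_lt ?_
  refine (lintegral_mono_set (Set.subset_univ _)).trans_lt ?_
  rw [Measure.restrict_univ, lintegral_indicator (isCompact_chartSupport p.1).measurableSet,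
    setLIntegral_const]
  exact ENNReal.mul_lt_top ENNReal.ofReal_lt_top (isCompact_chartSupport p.1).measure_lt_top

/-- Almost everywhere measurable functions stay so in charts. -/
lemma aestronglyMeasurable_chart (g : RMetric m M) (p : M) {E : Type*} [TopologicalSpace E]
    {f : M → E} (hf : AEStronglyMeasurable f (vol g)) :
    AEStronglyMeasurable (fun y => f ((extChartAt (𝓡 m) p).symm y))
      (volume.restrict (chartDomain p)) := by
  obtain ⟨f', hf', h⟩ := hf
  refine ⟨fun y => f' (chartInv p y), hf'.comp_measurable (measurable_chartInv p), ?_⟩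
  rw [EventuallyEq, ae_restrict_iff' (isOpen_chartDomain p).measurableSet]
  filter_upwards [ae_chart_of_ae_vol g h p] with y hy hyd
  rw [hy hyd, chartInv_apply hyd.1]

end Volume

end

section

/-! ### Measurable orthonormal frames -/

section GramSchmidt

variable {m : ℕ}

/-- The Gram–Schmidt process for a bilinear form on `ℝ^m`, applied to the standard basis. -/
def gsVec (B : Model m →L[ℝ] Model m →L[ℝ] ℝ) (i : Fin m) : Model m :=
  let w := stdVec m i - ∑ j : Fin m,
    if _h : j < i then B (stdVec m i) (gsVec B j) • gsVec B j else 0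
  (√(B w w))⁻¹ • w
termination_by i

/-- The `i`-th vector of the Gram–Schmidt process before normalization. -/
def gsPre (B : Model m →L[ℝ] Model m →L[ℝ] ℝ) (i : Fin m) : Model m :=
  stdVec m i - ∑ j : Fin m, if j < i then B (stdVec m i) (gsVec B j) • gsVec B j else 0

lemma gsVec_eq (B : Model m →L[ℝ] Model m →L[ℝ] ℝ) (i : Fin m) :
    gsVec B i = (√(B (gsPre B i) (gsPre B i)))⁻¹ • gsPre B i := by
  rw [gsVec]
  simp only [gsPre, dite_eq_ite]

lemma measurable_bilin_apply {f g : (Model m →L[ℝ] Model m →L[ℝ] ℝ) → Model m} (hf : Measurable f)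
    (hg : Measurable g) : Measurable fun B : Model m →L[ℝ] Model m →L[ℝ] ℝ => B (f B) (g B) := by
  have h1 : Continuous fun z : (Model m →L[ℝ] Model m →L[ℝ] ℝ) × Model m × Model m =>
      z.1 z.2.1 z.2.2 :=
    (continuous_fst.clm_apply (continuous_fst.comp continuous_snd)).clm_apply
      (continuous_snd.comp continuous_snd)
  exact h1.measurable.comp (measurable_id.prodMk (hf.prodMk hg))

lemma measurable_gsVec (i : Fin m) : Measurable fun B => gsVec (m := m) B i := by
  induction i using WellFoundedLT.induction with
  | ind i ih =>
    have h1 : Measurable fun B => gsPre (m := m) B i := by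
      refine measurable_const.sub (Finset.measurable_sum _ fun j _ => ?_)
      by_cases h : j < i
      · simp only [h, if_true]
        exact (measurable_bilin_apply measurable_const (ih j h)).smul (ih j h)
      · simp only [h, if_false]
        exact measurable_const
    simp only [gsVec_eq]
    exact (measurable_bilin_apply h1 h1).sqrt.inv.smul h1

variable {B : Model m →L[ℝ] Model m →L[ℝ] ℝ}

lemma gsPre_coord (h : ∀ j k : Fin m, j < k → gsVec B j k = 0) (i : Fin m) :
    gsPre B i i = 1 ∧ ∀ k, i < k → gsPre B i k = 0 := by
  have key : ∀ k, i ≤ k → gsPre B i k = stdVec m i k := fun k hk => by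
    have : (∑ j : Fin m, if j < i then B (stdVec m i) (gsVec B j) • gsVec B j else 0) k = 0 := by
      rw [WithLp.ofLp_sum, Finset.sum_apply]
      refine Finset.sum_eq_zero fun j _ => ?_
      split_ifs with hj
      · simp [h j k (hj.trans_le hk)]
      · rfl
    rw [gsPre, PiLp.sub_apply, this, sub_zero]
  refine ⟨by simp [key i le_rfl, stdVec], fun k hk => ?_⟩
  rw [key k hk.le]
  simp [stdVec, hk.ne']

lemma gsVec_coord (j k : Fin m) (h : j < k) : gsVec B j k = 0 := by
  induction j using WellFoundedLT.induction generalizing k with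
  | ind j ih =>
    have : gsPre B j k = 0 := by
      have : (∑ l : Fin m, if l < j then B (stdVec m j) (gsVec B l) • gsVec B l else 0) k = 0 := by
        rw [WithLp.ofLp_sum, Finset.sum_apply]
        refine Finset.sum_eq_zero fun l _ => ?_
        split_ifs with hl
        · simp [ih l hl k (hl.trans h)]
        · rfl
      rw [gsPre, PiLp.sub_apply, this, sub_zero]
      simp [stdVec, h.ne']
    rw [gsVec_eq]
    simp [this]

lemma gsPre_ne_zero (i : Fin m) : gsPre B i ≠ 0 := fun h => by
  have := (gsPre_coord (B := B) gsVec_coord i).1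
  rw [h] at this
  simp at this

lemma gsVec_self (hB : ∀ v, v ≠ 0 → 0 < B v v) (i : Fin m) : B (gsVec B i) (gsVec B i) = 1 := by
  have h := hB _ (gsPre_ne_zero (B := B) i)
  rw [gsVec_eq, map_smul, map_smul, smul_apply, smul_eq_mul, smul_eq_mul, ← mul_assoc, ← mul_inv,
    Real.mul_self_sqrt h.le, inv_mul_cancel₀ h.ne']

lemma gsVec_of_lt (hB : ∀ v, v ≠ 0 → 0 < B v v) (hs : ∀ v w, B v w = B w v) (i j : Fin m)
    (hji : j < i) : B (gsVec B i) (gsVec B j) = 0 := by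
  induction i using WellFoundedLT.induction generalizing j with
  | ind i ih =>
    have hpair : ∀ l, l < i → l ≠ j → B (gsVec B l) (gsVec B j) = 0 := fun l hl hlj => by
      rcases lt_or_gt_of_ne hlj with h | h
      · rw [hs]
        exact ih j hji l h
      · exact ih l hl j h
    have h1 : B (gsPre B i) (gsVec B j) = 0 := by
      rw [gsPre, map_sub, sub_apply, map_sum, sum_apply, Finset.sum_eq_single j]
      · rw [if_pos hji, map_smul, smul_apply, gsVec_self hB, smul_eq_mul, mul_one, sub_self]
      · intro l _ hlj
        split_ifs with hl
        · rw [map_smul, smul_apply, hpair l hl hlj, smul_zero]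
        · simp
      · simp
    rw [gsVec_eq (i := i), map_smul, smul_apply, h1, smul_zero]

lemma gsVec_orthonormal (hB : ∀ v, v ≠ 0 → 0 < B v v) (hs : ∀ v w, B v w = B w v) (i j : Fin m) :
    B (gsVec B i) (gsVec B j) = if i = j then 1 else 0 := by
  split_ifs with h
  · rw [h, gsVec_self hB]
  · rcases lt_or_gt_of_ne h with h | h
    · rw [hs, gsVec_of_lt hB hs j i h]
    · exact gsVec_of_lt hB hs i j h

/-- The linear map taking the standard basis to the Gram–Schmidt basis of a bilinear form. -/
def gsMap (B : Model m →L[ℝ] Model m →L[ℝ] ℝ) : Model m →L[ℝ] Model m :=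
  ∑ i, ContinuousLinearMap.smulRight (EuclideanSpace.proj i : Model m →L[ℝ] ℝ) (gsVec B i)

lemma gsMap_apply (v : Model m) : gsMap B v = ∑ i, v i • gsVec B i := by
  simp [gsMap]

lemma measurable_gsMap : Measurable (gsMap (m := m)) := by
  refine Finset.measurable_sum _ fun i _ => ?_
  have h : Continuous fun v : Model m =>
      ContinuousLinearMap.smulRight (EuclideanSpace.proj i : Model m →L[ℝ] ℝ) v :=
    (ContinuousLinearMap.smulRightL ℝ (Model m) (Model m)
      (EuclideanSpace.proj i : Model m →L[ℝ] ℝ)).continuous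
  exact h.measurable.comp (measurable_gsVec i)

lemma bilin_gsMap (hB : ∀ v, v ≠ 0 → 0 < B v v) (hs : ∀ v w, B v w = B w v) (v w : Model m) :
    B (gsMap B v) (gsMap B w) = inner ℝ v w := by
  simp only [gsMap_apply, map_sum, map_smul, sum_apply, smul_apply, gsVec_orthonormal hB hs,
    smul_eq_mul, PiLp.inner_apply, mul_ite, mul_one, mul_zero]
  refine Finset.sum_congr rfl fun i _ => ?_
  rw [Finset.sum_ite_eq' Finset.univ i]
  simp

/-- A linear map taking the Euclidean inner product to a bilinear form is invertible. -/
lemma isUnit_of_bilin {T : Model m →L[ℝ] Model m} (h : ∀ v w, B (T v) (T w) = inner ℝ v w) :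
    IsUnit T := by
  rw [ContinuousLinearMap.isUnit_iff_isUnit_toLinearMap, LinearMap.isUnit_iff_ker_eq_bot,
    LinearMap.ker_eq_bot']
  intro v hv
  have h1 := h v v
  have hv' : T v = 0 := hv
  rw [hv', map_zero] at h1
  exact inner_self_eq_zero.1 h1.symm

lemma measurable_ringInverse :
    Measurable (Ring.inverse : (Model m →L[ℝ] Model m) → Model m →L[ℝ] Model m) := by
  classical
  obtain ⟨U, hU⟩ : ∃ U : Set (Model m →L[ℝ] Model m), ∀ T, T ∈ U ↔ IsUnit T :=
    ⟨{T | IsUnit T}, fun _ => Iff.rfl⟩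
  have ho : IsOpen U := by
    have : U = {T | IsUnit T} := Set.ext hU
    rw [this]
    exact Units.isOpen
  have h := ContinuousOn.measurable_piecewise (s := U)
    (f := Ring.inverse) (g := fun _ => (0 : Model m →L[ℝ] Model m))
    (fun T hT => by
      obtain ⟨u, rfl⟩ := (hU T).1 hT
      exact (NormedRing.inverse_continuousAt u).continuousWithinAt)
    continuousOn_const ho.measurableSet
  convert h using 1
  funext T
  by_cases hT : T ∈ U
  · rw [Set.piecewise_eq_of_mem _ _ _ hT]
  · rw [Set.piecewise_eq_of_notMem _ _ _ hT, Ring.inverse_non_unit _ fun h => hT ((hU T).2 h)]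

end GramSchmidt

/-- A continuous family of positive definite forms over a compact set is uniformly comparable to
the square of the norm. -/
lemma exists_form_bounds {E Y : Type*} [NormedAddCommGroup E] [NormedSpace ℝ E]
    [FiniteDimensional ℝ E] [TopologicalSpace Y] {K : Set Y} (hK : IsCompact K)
    {B : Y → E →L[ℝ] E →L[ℝ] ℝ} (hB : ContinuousOn B K) (hpos : ∀ y ∈ K, ∀ v, v ≠ 0 → 0 < B y v v) :
    ∃ c C : ℝ, 0 < c ∧ 0 ≤ C ∧ ∀ y ∈ K, ∀ v, c * ‖v‖ ^ 2 ≤ B y v v ∧ B y v v ≤ C * ‖v‖ ^ 2 := by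
  have hS : IsCompact (K ×ˢ Metric.sphere (0 : E) 1) := hK.prod (isCompact_sphere 0 1)
  have hf : ContinuousOn (fun z : Y × E => B z.1 z.2 z.2) (K ×ˢ Metric.sphere (0 : E) 1) :=
    ((hB.comp continuousOn_fst fun z hz => hz.1).clm_apply continuousOn_snd).clm_apply
      continuousOn_snd
  obtain ⟨c, C, hc0, hC0, hcb⟩ : ∃ c C : ℝ, 0 < c ∧ 0 ≤ C ∧
      ∀ y ∈ K, ∀ v : E, ‖v‖ = 1 → c ≤ B y v v ∧ B y v v ≤ C := by
    rcases (K ×ˢ Metric.sphere (0 : E) 1).eq_empty_or_nonempty with h | h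
    · refine ⟨1, 1, one_pos, zero_le_one, fun y hy v hv => ?_⟩
      have : (y, v) ∈ K ×ˢ Metric.sphere (0 : E) 1 := ⟨hy, by simpa using hv⟩
      rw [h] at this
      exact this.elim
    · obtain ⟨z, hz, hmin⟩ := hS.exists_isMinOn h hf
      obtain ⟨C, hC⟩ := hS.exists_bound_of_continuousOn hf
      have hz0 : z.2 ≠ 0 := fun h0 => by
        have := hz.2
        rw [h0] at this
        simp at this
      refine ⟨_, C, hpos _ hz.1 z.2 hz0, (norm_nonneg _).trans (hC z hz), fun y hy v hv => ?_⟩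
      have hm : (y, v) ∈ K ×ˢ Metric.sphere (0 : E) 1 := ⟨hy, by simpa using hv⟩
      exact ⟨hmin hm, (le_abs_self _).trans (hC _ hm)⟩
  refine ⟨c, C, hc0, hC0, fun y hy v => ?_⟩
  by_cases hv : v = 0
  · simp [hv]
  have hn : ‖v‖ ≠ 0 := norm_ne_zero_iff.2 hv
  have h1 := hcb y hy (‖v‖⁻¹ • v) (by rw [norm_smul, norm_inv, norm_norm, inv_mul_cancel₀ hn])
  have h2 : B y v v = B y (‖v‖⁻¹ • v) (‖v‖⁻¹ • v) * ‖v‖ ^ 2 := by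
    rw [map_smul, map_smul, smul_apply, smul_eq_mul, smul_eq_mul]
    field_simp
  rw [h2]
  exact ⟨mul_le_mul_of_nonneg_right h1.1 (by positivity),
    mul_le_mul_of_nonneg_right h1.2 (by positivity)⟩


section Frame

variable {m : ℕ} {M : Type*} [TopologicalSpace M] [ChartedSpace (Model m) M]
  [IsManifold (𝓡 m) ∞ M] [T2Space M] [CompactSpace M] [MeasurableSpace M] [BorelSpace M]

lemma exists_measurable_center : ∃ c : M → M, (∀ x, c x ∈ chartCenters m M) ∧
    (∀ x, chartPartition m M (c x) x ≠ 0) ∧ ∀ p, MeasurableSet {x | c x = p} := by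
  classical
  obtain ⟨idx, hidx⟩ : ∃ idx : M → ℕ, Set.InjOn idx (chartCenters m M) :=
    Set.countable_iff_exists_injOn.1 (chartCenters m M).countable_toSet
  let Q : ℕ → M → Prop := fun n x => ∃ q ∈ chartCenters m M, idx q = n ∧ chartPartition m M q x ≠ 0
  have hQ : ∀ x, ∃ n, Q n x := fun x => by
    obtain ⟨q, hq, h⟩ := exists_chartPartition_ne_zero (m := m) x
    exact ⟨_, q, hq, rfl, h.ne'⟩
  choose c hc1 hc2 hc3 using fun x => Nat.find_spec (hQ x)
  refine ⟨c, hc1, hc3, fun p => ?_⟩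
  by_cases hp : p ∈ chartCenters m M
  · have hQm : ∀ n, MeasurableSet {x | Q n x} := fun n => by
      have : {x | Q n x} = ⋃ q ∈ chartCenters m M, {x | idx q = n ∧ chartPartition m M q x ≠ 0} := by
        ext x
        simp only [Q, Set.mem_iUnion, Set.mem_ofPred_eq, exists_prop]
      rw [this]
      refine Finset.measurableSet_biUnion _ fun q _ => ?_
      exact (MeasurableSet.const _).inter
        (isOpen_compl_singleton.preimage (continuous_chartPartition q)).measurableSet
    have hfind : Measurable fun x => Nat.find (hQ x) := measurable_find hQ hQm
    have : {x | c x = p} = (fun x => Nat.find (hQ x)) ⁻¹' {idx p} := by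
      ext x
      simp only [Set.mem_ofPred_eq, Set.mem_preimage, Set.mem_singleton_iff]
      rw [← hc2 x]
      exact ⟨fun h => by rw [h], fun h => hidx (hc1 x) hp h⟩
    rw [this]
    exact hfind (measurableSet_singleton _)
  · have : {x | c x = p} = ∅ := by
      ext x
      simp only [Set.mem_ofPred_eq, Set.mem_empty_iff_false, iff_false]
      rintro rfl
      exact hp (hc1 x)
    rw [this]
    exact MeasurableSet.empty

variable (m) in
/-- A measurable choice of one of finitely many charts around each point. -/
def frameCenter (x : M) : M := (exists_measurable_center (m := m) (M := M)).choose x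

lemma frameCenter_mem (x : M) : frameCenter m x ∈ chartCenters m M :=
  (exists_measurable_center (m := m) (M := M)).choose_spec.1 x

lemma frameCenter_ne_zero (x : M) : chartPartition m M (frameCenter m x) x ≠ 0 :=
  (exists_measurable_center (m := m) (M := M)).choose_spec.2.1 x

lemma measurableSet_frameCenter (p : M) : MeasurableSet {x | frameCenter m x = p} :=
  (exists_measurable_center (m := m) (M := M)).choose_spec.2.2 p

lemma mem_source_of_ne_zero {p x : M} (h : chartPartition m M p x ≠ 0) :
    x ∈ (chartAt (Model m) p).source :=
  tsupport_chartPartition_subset p (subset_tsupport _ h)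

lemma mem_source_frameCenter (x : M) : x ∈ (chartAt (Model m) (frameCenter m x)).source :=
  mem_source_of_ne_zero (frameCenter_ne_zero x)

/-- A measurable orthonormal frame of the tangent bundle. -/
def frame (g : RMetric m M) (x : M) : Model m →L[ℝ] TangentSpace (𝓡 m) x :=
  (ofCoord (frameCenter m x) x).comp
    (gsMap (metricForm g (frameCenter m x) (extChartAt (𝓡 m) (frameCenter m x) x)))

lemma inner_frame (g : RMetric m M) (x : M) (v w : Model m) :
    g.inner x (frame g x v) (frame g x w) = inner ℝ v w := by
  have hx := mem_source_frameCenter (m := m) x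
  have hy := mem_extChartAt_target hx
  rw [← bilin_gsMap (fun v hv => metricForm_pos g hy hv) (metricForm_symm g hy),
    metricForm_apply g hx]
  rfl

/-- The components of a tangent vector in the orthonormal frame. -/
def frameInv (g : RMetric m M) (x : M) : TangentSpace (𝓡 m) x →L[ℝ] Model m :=
  (Ring.inverse (gsMap (metricForm g (frameCenter m x)
    (extChartAt (𝓡 m) (frameCenter m x) x)))).comp (toCoord (frameCenter m x) x)

lemma isUnit_gsMap (g : RMetric m M) {p x : M} (hx : x ∈ (chartAt (Model m) p).source) :
    IsUnit (gsMap (metricForm g p (extChartAt (𝓡 m) p x))) :=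
  isUnit_of_bilin (bilin_gsMap (fun _ hv => metricForm_pos g (mem_extChartAt_target hx) hv)
    (metricForm_symm g (mem_extChartAt_target hx)))

lemma frameInv_frame (g : RMetric m M) (x : M) (v : Model m) : frameInv g x (frame g x v) = v := by
  have hx := mem_source_frameCenter (m := m) x
  rw [frameInv, frame, ContinuousLinearMap.comp_apply, ContinuousLinearMap.comp_apply,
    toCoord_ofCoord hx, ← mul_apply_eq_comp, Ring.inverse_mul_cancel _ (isUnit_gsMap g hx),
    one_apply_eq_self]

lemma frame_frameInv (g : RMetric m M) (x : M) (v : TangentSpace (𝓡 m) x) :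
    frame g x (frameInv g x v) = v := by
  have hx := mem_source_frameCenter (m := m) x
  rw [frameInv, frame, ContinuousLinearMap.comp_apply, ContinuousLinearMap.comp_apply,
    ← mul_apply_eq_comp, Ring.mul_inverse_cancel _ (isUnit_gsMap g hx), one_apply_eq_self,
    ofCoord_toCoord hx]

/-- The matrix of the orthonormal frame in the chart around `p`. -/
def frameMat (g : RMetric m M) (p x : M) : Model m →L[ℝ] Model m :=
  (toCoord p x).comp (frame g x)

lemma metricForm_frameMat (g : RMetric m M) {p x : M} (hx : x ∈ (chartAt (Model m) p).source)
    (v w : Model m) :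
    metricForm g p (extChartAt (𝓡 m) p x) (frameMat g p x v) (frameMat g p x w) = inner ℝ v w := by
  rw [metricForm_apply g hx, frameMat, ContinuousLinearMap.comp_apply,
    ContinuousLinearMap.comp_apply, ofCoord_toCoord hx, ofCoord_toCoord hx, inner_frame]

lemma isUnit_frameMat (g : RMetric m M) {p x : M} (hx : x ∈ (chartAt (Model m) p).source) :
    IsUnit (frameMat g p x) := isUnit_of_bilin (metricForm_frameMat g hx)

lemma inverse_frameMat (g : RMetric m M) {p x : M} (hx : x ∈ (chartAt (Model m) p).source) :
    Ring.inverse (frameMat g p x) = (frameInv g x).comp (ofCoord p x) := by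
  have h1 : frameMat g p x * (frameInv g x).comp (ofCoord p x) = 1 := by
    ext1 v
    rw [mul_apply_eq_comp, frameMat, ContinuousLinearMap.comp_apply,
      ContinuousLinearMap.comp_apply, frame_frameInv, toCoord_ofCoord hx, one_apply_eq_self]
  calc Ring.inverse (frameMat g p x)
      = Ring.inverse (frameMat g p x) * (frameMat g p x * (frameInv g x).comp (ofCoord p x)) := by
        rw [h1, mul_one]
    _ = _ := by
        rw [← mul_assoc, Ring.inverse_mul_cancel _ (isUnit_frameMat g hx), one_mul]

lemma continuousOn_metricForm_chart (g : RMetric m M) (p : M) :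
    ContinuousOn (fun x => metricForm g p (extChartAt (𝓡 m) p x)) (chartAt (Model m) p).source := by
  refine (contDiffOn_metricForm g p).continuousOn.comp ?_ fun x hx => mem_extChartAt_target hx
  have := continuousOn_extChartAt (I := 𝓡 m) p
  rwa [extChartAt_source] at this

lemma continuousOn_toCoord_ofCoord (p q : M) :
    ContinuousOn (fun x => (toCoord p x).comp (ofCoord q x) : M → Model m →L[ℝ] Model m)
      ((chartAt (Model m) p).source ∩ (chartAt (Model m) q).source) := by
  refine (continuousOn_tangentCoordChange (I := 𝓡 m) q p).congr_mono (fun x hx => ?_) ?_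
  · ext1 v
    exact toCoord_ofCoord_eq hx.1 hx.2 v
  · rw [extChartAt_source, extChartAt_source, Set.inter_comm]

lemma aestronglyMeasurable_frameMat (g : RMetric m M) (p : M) {μ : Measure M} :
    AEStronglyMeasurable (frameMat g p) (μ.restrict (chartAt (Model m) p).source) := by
  have hp : MeasurableSet (chartAt (Model m) p).source :=
    (chartAt (Model m) p).open_source.measurableSet
  have hU : (chartAt (Model m) p).source = ⋃ q : chartCenters m M,
      (chartAt (Model m) p).source ∩ {x | frameCenter m x = q.1} := by
    ext x
    simp only [Set.mem_iUnion, Set.mem_inter_iff, Set.mem_ofPred_eq]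
    exact ⟨fun h => ⟨⟨_, frameCenter_mem x⟩, h, rfl⟩, fun ⟨_, h, _⟩ => h⟩
  rw [hU, aestronglyMeasurable_iUnion_iff]
  rintro ⟨q, hq⟩
  have hsub : (chartAt (Model m) p).source ∩ {x | frameCenter m x = q}
      ⊆ (chartAt (Model m) p).source ∩ (chartAt (Model m) q).source := by
    rintro x ⟨h1, rfl⟩
    exact ⟨h1, mem_source_frameCenter x⟩
  have hm : MeasurableSet ((chartAt (Model m) p).source ∩ {x | frameCenter m x = q}) :=
    hp.inter (measurableSet_frameCenter q)
  have h1 : AEMeasurable (fun x => (toCoord p x).comp (ofCoord q x) : M → Model m →L[ℝ] Model m)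
      (μ.restrict ((chartAt (Model m) p).source ∩ {x | frameCenter m x = q})) :=
    ((continuousOn_toCoord_ofCoord p q).mono hsub).aemeasurable hm
  have h2 : AEMeasurable (fun x => gsMap (metricForm g q (extChartAt (𝓡 m) q x)))
      (μ.restrict ((chartAt (Model m) p).source ∩ {x | frameCenter m x = q})) :=
    measurable_gsMap.comp_aemeasurable (((continuousOn_metricForm_chart g q).mono
      (hsub.trans Set.inter_subset_right)).aemeasurable hm)
  refine (h1.aestronglyMeasurable.mul h2.aestronglyMeasurable).congr ?_
  filter_upwards [ae_restrict_mem hm] with x hx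
  obtain ⟨-, rfl⟩ := hx
  rfl

lemma aestronglyMeasurable_inverse_frameMat (g : RMetric m M) (p : M) {μ : Measure M} :
    AEStronglyMeasurable (fun x => Ring.inverse (frameMat g p x))
      (μ.restrict (chartAt (Model m) p).source) :=
  (measurable_ringInverse.comp_aemeasurable
    (aestronglyMeasurable_frameMat g p).aemeasurable).aestronglyMeasurable

/-- The matrices of the frame and their inverses are bounded on compact subsets of the
chart. -/
lemma exists_frameMat_bound (g : RMetric m M) (p : M) {K : Set (Model m)} (hK : IsCompact K)
    (hKp : K ⊆ (extChartAt (𝓡 m) p).target) : ∃ C : ℝ, 0 ≤ C ∧ ∀ x ∈ (chartAt (Model m) p).source,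
      extChartAt (𝓡 m) p x ∈ K → ‖frameMat g p x‖ ≤ C ∧ ‖Ring.inverse (frameMat g p x)‖ ≤ C := by
  obtain ⟨c, C, hc0, hC0, hcb⟩ := exists_form_bounds hK
    ((contDiffOn_metricForm g p).continuousOn.mono hKp)
    fun y hy v hv => metricForm_pos g (hKp hy) hv
  refine ⟨max (√c⁻¹) (√C), by positivity, fun x hx hxK => ⟨?_, ?_⟩⟩
  · refine (ContinuousLinearMap.opNorm_le_bound _ (Real.sqrt_nonneg _) fun v => ?_).trans
      (le_max_left _ _)
    have h1 := (hcb _ hxK (frameMat g p x v)).1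
    rw [metricForm_frameMat g hx, real_inner_self_eq_norm_sq] at h1
    refine le_of_sq_le_sq ?_ (by positivity)
    rw [mul_pow, Real.sq_sqrt (by positivity), inv_mul_eq_div, le_div_iff₀ hc0]
    linarith
  · refine (ContinuousLinearMap.opNorm_le_bound _ (Real.sqrt_nonneg _) fun v => ?_).trans
      (le_max_right _ _)
    have h1 := metricForm_frameMat g hx (Ring.inverse (frameMat g p x) v)
      (Ring.inverse (frameMat g p x) v)
    rw [← mul_apply_eq_comp, Ring.mul_inverse_cancel _ (isUnit_frameMat g hx), one_apply_eq_self,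
      real_inner_self_eq_norm_sq] at h1
    refine le_of_sq_le_sq ?_ (by positivity)
    rw [← h1, mul_pow, Real.sq_sqrt hC0]
    exact (hcb _ hxK v).2

end Frame

end

section

lemma IsOrthogonalStructure.star_mul_self {V : Type*} [NormedAddCommGroup V]
    [InnerProductSpace ℝ V] [FiniteDimensional ℝ V] {J : V →L[ℝ] V}
    (h : IsOrthogonalStructure J) : star J * J = 1 := by
  rw [h.1, neg_mul, h.2, neg_neg]

lemma aestronglyMeasurable_tuple_iff {X E ι : Type*} [MeasurableSpace X] {μ : Measure X}
    [NormedAddCommGroup E] [NormedSpace ℝ E] [FiniteDimensional ℝ E] [Fintype ι] {α : X → ι → E} :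
    AEStronglyMeasurable α μ ↔ ∀ a, AEStronglyMeasurable (fun x => α x a) μ := by
  borelize E
  have := FiniteDimensional.proper_real E
  simp only [aestronglyMeasurable_iff_aemeasurable, aemeasurable_pi_iff]

/-! ### Endomorphism fields in the orthonormal frame -/

variable {m : ℕ} {M : Type*} [TopologicalSpace M] [ChartedSpace (Model m) M]
  [IsManifold (𝓡 m) ∞ M] [T2Space M] [CompactSpace M] [MeasurableSpace M] [BorelSpace M]

/-- The matrix of an endomorphism of a tangent space in the orthonormal frame. -/
def frameEnd (g : RMetric m M) (x : M) (S : TangentSpace (𝓡 m) x →L[ℝ] TangentSpace (𝓡 m) x) :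
    Model m →L[ℝ] Model m := (frameInv g x).comp (S.comp (frame g x))

/-- The endomorphism of a tangent space with given matrix in the orthonormal frame. -/
def ofFrameEnd (g : RMetric m M) (x : M) (σ : Model m →L[ℝ] Model m) :
    TangentSpace (𝓡 m) x →L[ℝ] TangentSpace (𝓡 m) x := (frame g x).comp (σ.comp (frameInv g x))

/-- The matrices, in the orthonormal frame, of the values on the frame of an endomorphism-valued
form. -/
def frameGrad (g : RMetric m M) (x : M) (A : TangentSpace (𝓡 m) x →L[ℝ]
      (TangentSpace (𝓡 m) x →L[ℝ] TangentSpace (𝓡 m) x)) : Fin m → Model m →L[ℝ] Model m :=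
  fun a => frameEnd g x (A (frame g x (stdVec m a)))

/-- The endomorphism-valued form whose values on the orthonormal frame have given matrices. -/
def ofFrameGrad (g : RMetric m M) (x : M) (α : Fin m → Model m →L[ℝ] Model m) :
    TangentSpace (𝓡 m) x →L[ℝ] (TangentSpace (𝓡 m) x →L[ℝ] TangentSpace (𝓡 m) x) :=
  ∑ a, ContinuousLinearMap.smulRight
    ((EuclideanSpace.proj a : Model m →L[ℝ] ℝ).comp (frameInv g x)) (ofFrameEnd g x (α a))

variable (g : RMetric m M) (x : M)

lemma frameEnd_apply (S : TangentSpace (𝓡 m) x →L[ℝ] TangentSpace (𝓡 m) x) (v : Model m) :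
    frameEnd g x S v = frameInv g x (S (frame g x v)) := rfl

lemma frameEnd_ofFrameEnd (σ : Model m →L[ℝ] Model m) : frameEnd g x (ofFrameEnd g x σ) = σ := by
  ext1 v
  rw [frameEnd_apply, ofFrameEnd, ContinuousLinearMap.comp_apply, ContinuousLinearMap.comp_apply,
    frameInv_frame, frameInv_frame]

lemma frameEnd_injective : Function.Injective (frameEnd g x) := fun S T h => by
  ext1 v
  have h1 := DFunLike.congr_fun h (frameInv g x v)
  rw [frameEnd_apply, frameEnd_apply, frame_frameInv] at h1
  rw [← frame_frameInv g x (S v), h1, frame_frameInv]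

lemma frameEnd_comp (S T : TangentSpace (𝓡 m) x →L[ℝ] TangentSpace (𝓡 m) x) :
    frameEnd g x (S.comp T) = frameEnd g x S * frameEnd g x T := by
  ext1 v
  rw [mul_apply_eq_comp, frameEnd_apply, frameEnd_apply, frameEnd_apply, frame_frameInv]
  rfl

lemma frameEnd_id : frameEnd g x (ContinuousLinearMap.id ℝ (TangentSpace (𝓡 m) x)) = 1 := by
  ext1 v
  rw [frameEnd_apply, one_apply_eq_self]
  exact frameInv_frame g x v

lemma frameEnd_add (S T : TangentSpace (𝓡 m) x →L[ℝ] TangentSpace (𝓡 m) x) :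
    frameEnd g x (S + T) = frameEnd g x S + frameEnd g x T := by
  ext1 v
  simp only [frameEnd_apply, add_apply, map_add]

lemma frameEnd_smul (c : ℝ) (S : TangentSpace (𝓡 m) x →L[ℝ] TangentSpace (𝓡 m) x) :
    frameEnd g x (c • S) = c • frameEnd g x S := by
  ext1 v
  simp only [frameEnd_apply, smul_apply, map_smul]

lemma frameEnd_zero : frameEnd g x 0 = 0 := by
  ext1 v
  simp only [frameEnd_apply, zero_apply, map_zero]

lemma frameEnd_neg (S : TangentSpace (𝓡 m) x →L[ℝ] TangentSpace (𝓡 m) x) :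
    frameEnd g x (-S) = -frameEnd g x S := by
  ext1 v
  simp only [frameEnd_apply, neg_apply, map_neg]

lemma frameEnd_sub (S T : TangentSpace (𝓡 m) x →L[ℝ] TangentSpace (𝓡 m) x) :
    frameEnd g x (S - T) = frameEnd g x S - frameEnd g x T := by
  rw [sub_eq_add_neg, frameEnd_add, frameEnd_neg, sub_eq_add_neg]

lemma frameEnd_sum {κ : Type*} (s : Finset κ)
    (S : κ → TangentSpace (𝓡 m) x →L[ℝ] TangentSpace (𝓡 m) x) :
    frameEnd g x (∑ i ∈ s, S i) = ∑ i ∈ s, frameEnd g x (S i) := by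
  classical
  induction s using Finset.induction_on with
  | empty => rw [Finset.sum_empty, Finset.sum_empty, frameEnd_zero]
  | insert i s hi ih => rw [Finset.sum_insert hi, Finset.sum_insert hi, frameEnd_add, ih]

lemma inner_frameInv (v w : TangentSpace (𝓡 m) x) :
    inner ℝ (frameInv g x v) (frameInv g x w) = g.inner x v w := by
  rw [← inner_frame g x, frame_frameInv, frame_frameInv]

lemma star_frameEnd {S S' : TangentSpace (𝓡 m) x →L[ℝ] TangentSpace (𝓡 m) x}
    (h : ∀ v w, g.inner x (S v) w = g.inner x v (S' w)) :
    star (frameEnd g x S) = frameEnd g x S' := by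
  rw [ContinuousLinearMap.star_eq_adjoint, eq_comm, ContinuousLinearMap.eq_adjoint_iff]
  intro v w
  rw [frameEnd_apply, frameEnd_apply]
  conv_lhs => rw [← frameInv_frame g x w]
  conv_rhs => rw [← frameInv_frame g x v]
  rw [inner_frameInv, inner_frameInv, g.symm, ← h, g.symm]

lemma frame_eq (p : M) {x : M} (hx : x ∈ (chartAt (Model m) p).source) (v : Model m) :
    frame g x v = ofCoord p x (frameMat g p x v) := by
  rw [frameMat, ContinuousLinearMap.comp_apply, ofCoord_toCoord hx]

lemma frameInv_eq {p x : M} (hx : x ∈ (chartAt (Model m) p).source) (v : TangentSpace (𝓡 m) x) :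
    frameInv g x v = Ring.inverse (frameMat g p x) (toCoord p x v) := by
  rw [inverse_frameMat g hx, ContinuousLinearMap.comp_apply, ofCoord_toCoord hx]

lemma frameEnd_eq {p x : M} (hx : x ∈ (chartAt (Model m) p).source)
    (S : TangentSpace (𝓡 m) x →L[ℝ] TangentSpace (𝓡 m) x) :
    frameEnd g x S = Ring.inverse (frameMat g p x) * coordEnd p x S * frameMat g p x := by
  ext1 v
  rw [frameEnd_apply, mul_apply_eq_comp, mul_apply_eq_comp, coordEnd_apply, frameInv_eq g hx,
    frame_eq g p hx]

lemma coordEnd_eq {p x : M} (hx : x ∈ (chartAt (Model m) p).source)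
    (S : TangentSpace (𝓡 m) x →L[ℝ] TangentSpace (𝓡 m) x) :
    coordEnd p x S = frameMat g p x * frameEnd g x S * Ring.inverse (frameMat g p x) := by
  rw [frameEnd_eq g hx, mul_assoc, mul_assoc, mul_assoc,
    Ring.mul_inverse_cancel _ (isUnit_frameMat g hx), mul_one, ← mul_assoc,
    Ring.mul_inverse_cancel _ (isUnit_frameMat g hx), one_mul]

lemma traceL_frameEnd (S : TangentSpace (𝓡 m) x →L[ℝ] TangentSpace (𝓡 m) x) :
    traceL (Model m) (frameEnd g x S) = traceTangent x S := by
  have hx := mem_chart_source (Model m) x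
  rw [frameEnd_eq g hx, traceL_mul_comm, ← mul_assoc,
    Ring.mul_inverse_cancel _ (isUnit_frameMat g hx), one_mul, traceL_coordEnd hx]

variable {x} in
lemma frame_eq_sum (p : M) (hx : x ∈ (chartAt (Model m) p).source) (v : Model m) :
    frame g x v = ∑ i, (frameMat g p x v) i • coordVec p i x := by
  rw [frame_eq g p hx]
  conv_lhs => rw [← sum_stdVec (frameMat g p x v)]
  simp only [map_sum, map_smul, coordVec_eq]

variable {x} in
lemma eq_sum_frame (v : TangentSpace (𝓡 m) x) :
    v = ∑ a, (frameInv g x v) a • frame g x (stdVec m a) := by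
  conv_lhs => rw [← frame_frameInv g x v, ← sum_stdVec (frameInv g x v)]
  simp only [map_sum, map_smul]

lemma frameGrad_ofFrameGrad (α : Fin m → Model m →L[ℝ] Model m) :
    frameGrad g x (ofFrameGrad g x α) = α := by
  funext a
  rw [frameGrad, ofFrameGrad, sum_apply, frameEnd_sum, Finset.sum_eq_single a]
  · rw [ContinuousLinearMap.smulRight_apply, ContinuousLinearMap.comp_apply, frameInv_frame,
      frameEnd_smul, frameEnd_ofFrameEnd]
    simp [stdVec]
  · intro b _ hb
    rw [ContinuousLinearMap.smulRight_apply, ContinuousLinearMap.comp_apply, frameInv_frame,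
      frameEnd_smul, frameEnd_ofFrameEnd]
    have h0 : (EuclideanSpace.proj b : Model m →L[ℝ] ℝ) (stdVec m a) = 0 := by simp [stdVec, hb]
    rw [h0]
    exact zero_smul ℝ (α b)
  · simp

lemma frameGrad_sub (A B : TangentSpace (𝓡 m) x →L[ℝ]
      (TangentSpace (𝓡 m) x →L[ℝ] TangentSpace (𝓡 m) x)) :
    frameGrad g x (A - B) = frameGrad g x A - frameGrad g x B := by
  funext a
  rw [frameGrad, sub_apply, frameEnd_sub]
  rfl

lemma frameGrad_add (A B : TangentSpace (𝓡 m) x →L[ℝ]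
      (TangentSpace (𝓡 m) x →L[ℝ] TangentSpace (𝓡 m) x)) :
    frameGrad g x (A + B) = frameGrad g x A + frameGrad g x B := by
  funext a
  rw [frameGrad, add_apply, frameEnd_add]
  rfl

lemma frameGrad_smul (c : ℝ) (A : TangentSpace (𝓡 m) x →L[ℝ]
      (TangentSpace (𝓡 m) x →L[ℝ] TangentSpace (𝓡 m) x)) :
    frameGrad g x (c • A) = c • frameGrad g x A := by
  funext a
  rw [frameGrad, smul_apply, frameEnd_smul]
  rfl

/-! ### Inner products in the orthonormal frame -/

lemma gInv_eq (i j : Fin m) :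
    gInv g x i j = ∑ a, frameMat g x x (stdVec m a) i * frameMat g x x (stdVec m a) j := by
  have hx := mem_chart_source (Model m) x
  set F : Matrix (Fin m) (Fin m) ℝ := Matrix.of fun i a => frameMat g x x (stdVec m a) i with hF
  set G : Matrix (Fin m) (Fin m) ℝ :=
    Matrix.of fun i j => g.inner x (coordVec x i x) (coordVec x j x) with hG
  have h1 : F.transpose * (G * F) = 1 := by
    ext a b
    have h := metricForm_frameMat g hx (stdVec m a) (stdVec m b)
    rw [metricForm_eq_sum] at h
    simp only [gram_apply g hx] at h
    have h2 : inner ℝ (stdVec m a) (stdVec m b) = (1 : Matrix (Fin m) (Fin m) ℝ) a b := by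
      simp [stdVec, Matrix.one_apply, EuclideanSpace.inner_single_left]
    rw [← h2, ← h, Matrix.mul_apply]
    refine Finset.sum_congr rfl fun i _ => ?_
    rw [Matrix.mul_apply, Finset.mul_sum]
    refine Finset.sum_congr rfl fun j _ => ?_
    simp only [hF, hG, Matrix.transpose_apply, Matrix.of_apply, coordVec_eq]
    ring
  have h2 : F * F.transpose * G = 1 := by
    rw [← mul_assoc, mul_eq_one_comm, ← mul_assoc] at h1
    exact h1
  rw [gInv, Matrix.inv_eq_left_inv h2, Matrix.mul_apply]
  rfl

/-- Contraction with the inverse metric is summation over the orthonormal frame. -/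
lemma sum_gInv {W : Type*} [AddCommGroup W] [Module ℝ W]
    (b : TangentSpace (𝓡 m) x →ₗ[ℝ] TangentSpace (𝓡 m) x →ₗ[ℝ] W) :
    ∑ i, ∑ j, gInv g x i j • b (coordVec x i x) (coordVec x j x)
      = ∑ a, b (frame g x (stdVec m a)) (frame g x (stdVec m a)) := by
  have h : ∀ a, b (frame g x (stdVec m a)) (frame g x (stdVec m a)) = ∑ i, ∑ j,
      (frameMat g x x (stdVec m a) i * frameMat g x x (stdVec m a) j)
        • b (coordVec x i x) (coordVec x j x) := fun a => by
    rw [frame_eq_sum g x (mem_chart_source _ x)]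
    simp only [map_sum, map_smul, LinearMap.sum_apply, LinearMap.smul_apply, Finset.smul_sum,
      smul_smul]
    rw [Finset.sum_comm]
    refine Finset.sum_congr rfl fun i _ => Finset.sum_congr rfl fun j _ => ?_
    rw [mul_comm]
  simp only [h, gInv_eq, Finset.sum_smul]
  conv_rhs => rw [Finset.sum_comm]
  exact Finset.sum_congr rfl fun i _ => Finset.sum_comm

lemma innerEnd_eq (S T : TangentSpace (𝓡 m) x →L[ℝ] TangentSpace (𝓡 m) x) :
    innerEnd g x S T = hs (frameEnd g x S) (frameEnd g x T) := by
  have h := sum_gInv g x (LinearMap.mk₂ ℝ (fun v w => g.inner x (S v) (T w))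
    (fun v v' w => by simp only [map_add, add_apply])
    (fun c v w => by simp only [map_smul, smul_apply])
    (fun v w w' => by simp only [map_add]) (fun c v w => by simp only [map_smul]))
  simp only [LinearMap.mk₂_apply, smul_eq_mul] at h
  rw [innerEnd, h, hs_eq_sum (EuclideanSpace.basisFun (Fin m) ℝ)]
  refine Finset.sum_congr rfl fun a _ => ?_
  rw [EuclideanSpace.basisFun_apply, frameEnd_apply, frameEnd_apply, inner_frameInv]
  rfl

lemma innerGrad_eq (A B : TangentSpace (𝓡 m) x →L[ℝ]
      (TangentSpace (𝓡 m) x →L[ℝ] TangentSpace (𝓡 m) x)) :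
    innerGrad g x A B = hsGrad (frameGrad g x A) (frameGrad g x B) := by
  have h := sum_gInv g x (LinearMap.mk₂ ℝ (fun v w => hs (frameEnd g x (A v)) (frameEnd g x (B w)))
    (fun v v' w => by simp only [map_add, frameEnd_add, hs_add_left])
    (fun c v w => by
      rw [map_smul, frameEnd_smul]
      exact hs_smul_left _ _ _)
    (fun v w w' => by simp only [map_add, frameEnd_add, hs_add_right])
    (fun c v w => by
      rw [map_smul, frameEnd_smul]
      exact hs_smul_right _ _ _))
  simp only [LinearMap.mk₂_apply, smul_eq_mul] at h
  simp only [innerGrad, innerEnd_eq]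
  exact h

lemma frameEnd_quadTerm (J : TangentSpace (𝓡 m) x →L[ℝ] TangentSpace (𝓡 m) x)
    (A : TangentSpace (𝓡 m) x →L[ℝ] (TangentSpace (𝓡 m) x →L[ℝ] TangentSpace (𝓡 m) x)) :
    frameEnd g x (quadTerm g x J A)
      = ∑ a, frameEnd g x J * frameGrad g x A a * frameGrad g x A a := by
  have h := sum_gInv g x (LinearMap.mk₂ ℝ (fun v w => J.comp ((A v).comp (A w)))
    (fun v v' w => by rw [map_add, ContinuousLinearMap.add_comp, ContinuousLinearMap.comp_add])
    (fun c v w => by rw [map_smul, ContinuousLinearMap.smul_comp, ContinuousLinearMap.comp_smul])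
    (fun v w w' => by rw [map_add, ContinuousLinearMap.comp_add, ContinuousLinearMap.comp_add])
    (fun c v w => by rw [map_smul, ContinuousLinearMap.comp_smul, ContinuousLinearMap.comp_smul]))
  simp only [LinearMap.mk₂_apply] at h
  rw [quadTerm, h, frameEnd_sum]
  refine Finset.sum_congr rfl fun a _ => ?_
  rw [frameEnd_comp, frameEnd_comp, mul_assoc]
  rfl

lemma compatibleAt_iff (J : EndField m M) :
    CompatibleAt g J x ↔ IsOrthogonalStructure (frameEnd g x (J x)) := by
  have hsq : (∀ v, J x (J x v) = -v) ↔ frameEnd g x (J x) * frameEnd g x (J x) = -1 := by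
    rw [← frameEnd_comp, ← frameEnd_id g x, ← frameEnd_neg, (frameEnd_injective g x).eq_iff]
    exact ⟨fun h => ContinuousLinearMap.ext h, fun h v => DFunLike.congr_fun h v⟩
  constructor
  · rintro ⟨h1, h2⟩
    refine ⟨?_, hsq.1 h1⟩
    rw [← frameEnd_neg]
    refine star_frameEnd g x fun v w => ?_
    have h3 : J x (-(J x w)) = w := by rw [map_neg, h1, neg_neg]
    change g.inner x (J x v) w = g.inner x v (-(J x w))
    rw [← h2 v, h3]
  · rintro ⟨h1, h2⟩
    have h3 := hsq.2 h2
    refine ⟨h3, fun v w => ?_⟩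
    rw [← inner_frameInv g x v w]
    have h5 : ∀ v, frameInv g x (J x v) = frameEnd g x (J x) (frameInv g x v) := fun v => by
      rw [frameEnd_apply, frame_frameInv]
    rw [← inner_frameInv, h5, h5, ← ContinuousLinearMap.adjoint_inner_right,
      ← ContinuousLinearMap.star_eq_adjoint, ← mul_apply_eq_comp,
      IsOrthogonalStructure.star_mul_self ⟨h1, h2⟩, one_apply_eq_self]

/-! ### Measurability in the orthonormal frame -/

lemma aestronglyMeasurable_of_charts {E : Type*} [TopologicalSpace E]
    [TopologicalSpace.PseudoMetrizableSpace E] {μ : Measure M} {f : M → E}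
    (h : ∀ p : M, AEStronglyMeasurable f (μ.restrict (chartAt (Model m) p).source)) :
    AEStronglyMeasurable f μ := by
  have hU : (Set.univ : Set M) = ⋃ p : chartCenters m M, (chartAt (Model m) p.1).source := by
    refine (Set.eq_univ_of_forall fun x => Set.mem_iUnion.2 ?_).symm
    exact ⟨⟨_, frameCenter_mem x⟩, mem_source_frameCenter x⟩
  rw [← Measure.restrict_univ (μ := μ), hU, aestronglyMeasurable_iUnion_iff]
  exact fun p => h p.1

lemma measEnd_iff (S : EndField m M) :
    MeasEnd g S ↔ AEStronglyMeasurable (fun x => frameEnd g x (S x)) (vol g) := by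
  constructor
  · refine fun h => aestronglyMeasurable_of_charts (m := m) fun p => ?_
    refine (((aestronglyMeasurable_inverse_frameMat g p).mul (h p)).mul
      (aestronglyMeasurable_frameMat g p)).congr ?_
    filter_upwards [ae_restrict_mem (chartAt (Model m) p).open_source.measurableSet] with x hx
    exact (frameEnd_eq g hx _).symm
  · intro h p
    refine (((aestronglyMeasurable_frameMat g p).mul h.restrict).mul
      (aestronglyMeasurable_inverse_frameMat g p)).congr ?_
    filter_upwards [ae_restrict_mem (chartAt (Model m) p).open_source.measurableSet] with x hx
    exact (coordEnd_eq g hx _).symm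

lemma aestronglyMeasurable_coord {μ : Measure M} {T : M → Model m →L[ℝ] Model m}
    (hT : AEStronglyMeasurable T μ) (v : Model m) (i : Fin m) :
    AEStronglyMeasurable (fun x => T x v i) μ :=
  ((EuclideanSpace.proj i : Model m →L[ℝ] ℝ).continuous.comp
    (ContinuousLinearMap.apply ℝ (Model m) v).continuous).comp_aestronglyMeasurable hT

lemma coordVec_eq_sum {p x : M} (hx : x ∈ (chartAt (Model m) p).source) (i : Fin m) :
    coordVec p i x
      = ∑ a, (Ring.inverse (frameMat g p x) (stdVec m i)) a • frame g x (stdVec m a) := by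
  rw [eq_sum_frame g (coordVec p i x)]
  simp only [frameInv_eq g hx, coordVec_eq, toCoord_ofCoord hx]

lemma coordEnd_frame {p x : M} (hx : x ∈ (chartAt (Model m) p).source)
    (A : TangentSpace (𝓡 m) x →L[ℝ] (TangentSpace (𝓡 m) x →L[ℝ] TangentSpace (𝓡 m) x))
    (a : Fin m) :
    coordEnd p x (A (frame g x (stdVec m a)))
      = ∑ i, (frameMat g p x (stdVec m a)) i • coordEnd p x (A (coordVec p i x)) := by
  ext1 v
  simp only [frame_eq_sum g p hx, map_sum, map_smul, coordEnd_apply, sum_apply, smul_apply]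

lemma frameEnd_coordVec {p x : M} (hx : x ∈ (chartAt (Model m) p).source)
    (A : TangentSpace (𝓡 m) x →L[ℝ] (TangentSpace (𝓡 m) x →L[ℝ] TangentSpace (𝓡 m) x))
    (i : Fin m) :
    frameEnd g x (A (coordVec p i x))
      = ∑ a, (Ring.inverse (frameMat g p x) (stdVec m i)) a • frameGrad g x A a := by
  ext1 v
  simp only [coordVec_eq_sum g hx, map_sum, map_smul, frameEnd_apply, sum_apply, smul_apply,
    frameGrad]

lemma measGrad_iff (A : GradField m M) :
    MeasGrad g A ↔ AEStronglyMeasurable (fun x => frameGrad g x (A x)) (vol g) := by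
  constructor
  · refine fun h => aestronglyMeasurable_tuple_iff.2 fun a =>
      aestronglyMeasurable_of_charts (m := m) fun p => ?_
    have h1 : AEStronglyMeasurable (fun x => ∑ i, (frameMat g p x (stdVec m a)) i •
        coordEnd p x (A x (coordVec p i x))) ((vol g).restrict (chartAt (Model m) p).source) :=
      Finset.aestronglyMeasurable_fun_sum _ fun i _ =>
        (aestronglyMeasurable_coord (aestronglyMeasurable_frameMat g p) _ i).smul (h p i)
    refine (((aestronglyMeasurable_inverse_frameMat g p).mul h1).mul
      (aestronglyMeasurable_frameMat g p)).congr ?_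
    filter_upwards [ae_restrict_mem (chartAt (Model m) p).open_source.measurableSet] with x hx
    rw [frameGrad, frameEnd_eq g hx, coordEnd_frame g hx]
    rfl
  · intro h p i
    have h1 : AEStronglyMeasurable (fun x => ∑ a, (Ring.inverse (frameMat g p x) (stdVec m i)) a •
        frameGrad g x (A x) a) ((vol g).restrict (chartAt (Model m) p).source) :=
      Finset.aestronglyMeasurable_fun_sum _ fun a _ =>
        (aestronglyMeasurable_coord (aestronglyMeasurable_inverse_frameMat g p) _ a).smul
          (aestronglyMeasurable_tuple_iff.1 h a).restrict
    refine (((aestronglyMeasurable_frameMat g p).mul h1).mul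
      (aestronglyMeasurable_inverse_frameMat g p)).congr ?_
    filter_upwards [ae_restrict_mem (chartAt (Model m) p).open_source.measurableSet] with x hx
    rw [coordEnd_eq g hx, frameEnd_coordVec g hx]
    rfl

end

section

/-! ### Closability and Rellich's theorem in an open subset of `ℝ^m` -/

section Flat

variable {m : ℕ} {E : Type*} [NormedAddCommGroup E] [NormedSpace ℝ E] [FiniteDimensional ℝ E]
  {U : Set (Model m)}

lemma integrable_smul_of_continuousOn {φ : Model m → ℝ} {h : Model m → E} (hφ : Continuous φ)
    (hc : HasCompactSupport φ) (hU : tsupport φ ⊆ U) (hh : ContinuousOn h U) :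
    Integrable fun y => φ y • h y := by
  have h1 : IntegrableOn (fun y => φ y • h y) (tsupport φ) :=
    (hφ.continuousOn.smul (hh.mono hU)).integrableOn_compact hc
  refine (integrableOn_iff_integrable_of_support_subset fun y hy => ?_).1 h1
  refine subset_tsupport _ fun h0 => hy ?_
  simp only [h0, zero_smul]

lemma continuousOn_fderiv_add (hU : IsOpen U) {A : Model m → E}
    {L : Model m → E →L[ℝ] E} {e : Model m} (hA : ContDiffOn ℝ ∞ A U) (hL : ContinuousOn L U) :
    ContinuousOn (fun y => fderiv ℝ A y e + L y (A y)) U :=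
  ((hA.continuousOn_fderiv_of_isOpen hU (by simp)).clm_apply continuousOn_const).add
    (hL.clm_apply hA.continuousOn)

/-- If `A k → 0` and `∂_e A k + L (A k) → β` locally in `L¹`, then `β = 0`: the first order operator
`∂_e + L` is closable. -/
lemma ae_eq_zero_of_tendsto (hU : IsOpen U) {A : ℕ → Model m → E} {β : Model m → E}
    {L : Model m → E →L[ℝ] E} {e : Model m} (hA : ∀ k, ContDiffOn ℝ ∞ (A k) U)
    (hL : ContinuousOn L U) (hβ : AEStronglyMeasurable β (volume.restrict U))
    (h0 : ∀ K ⊆ U, IsCompact K → Tendsto (fun k => ∫⁻ y in K, ‖A k y‖ₑ) atTop (𝓝 0))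
    (h1 : ∀ K ⊆ U, IsCompact K → Tendsto
      (fun k => ∫⁻ y in K, ‖fderiv ℝ (A k) y e + L y (A k y) - β y‖ₑ) atTop (𝓝 0)) :
    ∀ᵐ y, y ∈ U → β y = 0 := by
  have hB := fun k => continuousOn_fderiv_add (e := e) hU (hA k) hL
  have hint : ∀ K ⊆ U, IsCompact K → IntegrableOn β K := by
    intro K hKU hK
    obtain ⟨k, hk⟩ := ((h1 K hKU hK).eventually (gt_mem_nhds zero_lt_one)).exists
    have h2 : IntegrableOn (fun y => fderiv ℝ (A k) y e + L y (A k y)) K :=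
      ((hB k).mono hKU).integrableOn_compact hK
    have h3 : IntegrableOn (fun y => fderiv ℝ (A k) y e + L y (A k y) - β y) K :=
      ⟨h2.1.sub (hβ.mono_measure (Measure.restrict_mono hKU le_rfl)), hk.trans ENNReal.one_lt_top⟩
    have h4 := h2.sub h3
    exact h4.congr (Eventually.of_forall fun y => by simp)
  refine hU.ae_eq_zero_of_integral_contDiff_smul_eq_zero
    ((locallyIntegrableOn_iff hU.isLocallyClosed).2 fun K hKU hK => hint K hKU hK)
    fun φ hφ hc hφU => ?_
  set K := tsupport φ with hKdef
  have hK : IsCompact K := hc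
  have hφ' : Continuous fun y => fderiv ℝ φ y e :=
    (hφ.continuous_fderiv (by simp)).clm_apply continuous_const
  have hc' : HasCompactSupport fun y => fderiv ℝ φ y e := hc.fderiv_apply ℝ e
  have hK' : tsupport (fun y => fderiv ℝ φ y e) ⊆ K := tsupport_fderiv_apply_subset ℝ e
  obtain ⟨C₁, hC₁⟩ := hc.exists_bound_of_continuous hφ.continuous
  obtain ⟨C₂, hC₂⟩ := hc'.exists_bound_of_continuous hφ'
  obtain ⟨C₃, hC₃⟩ := hK.exists_bound_of_continuousOn (hL.mono hφU)
  have hC₁0 : 0 ≤ C₁ := (norm_nonneg _).trans (hC₁ 0)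
  have hC₂0 : 0 ≤ C₂ := (norm_nonneg _).trans (hC₂ 0)
  -- the pairing of `β` with `φ` is small, after integration by parts
  have key : ∀ k, ‖∫ y, φ y • β y‖ₑ
      ≤ (ENNReal.ofReal C₁ * ∫⁻ y in K, ‖fderiv ℝ (A k) y e + L y (A k y) - β y‖ₑ)
        + ENNReal.ofReal (C₂ + C₁ * |C₃|) * ∫⁻ y in K, ‖A k y‖ₑ := by
    intro k
    have hAc := (hA k).continuousOn
    have hA' : ContinuousOn (fun y => fderiv ℝ (A k) y e) U :=
      ((hA k).continuousOn_fderiv_of_isOpen hU (by simp)).clm_apply continuousOn_const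
    have hparts := integral_smul_fderiv_eq_neg_fderiv_smul_of_integrable (μ := volume) (f := φ)
      (g := A k) (v := e) (integrable_smul_of_continuousOn hφ' hc' (hK'.trans hφU) hAc)
      (integrable_smul_of_continuousOn hφ.continuous hc hφU hA')
      (integrable_smul_of_continuousOn hφ.continuous hc hφU hAc)
      (fun y _ => hφ.differentiable (by simp) y)
      (fun y hy => ((hA k).contDiffAt (hU.mem_nhds (hφU hy))).differentiableAt (by simp))
    have hi1 := integrable_smul_of_continuousOn hφ' hc' (hK'.trans hφU) hAc
    have hi2 := integrable_smul_of_continuousOn hφ.continuous hc hφU hA'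
    have hi3 : Integrable fun y => φ y • β y := by
      have : IntegrableOn (fun y => φ y • β y) K :=
        (hint K hφU hK).continuousOn_smul hφ.continuous.continuousOn hK
      refine (integrableOn_iff_integrable_of_support_subset fun y hy => ?_).1 this
      refine subset_tsupport _ fun h0 => hy ?_
      simp only [h0, zero_smul]
    have e1 : ∫ y, φ y • β y
        = ∫ y, (φ y • β y - φ y • fderiv ℝ (A k) y e - fderiv ℝ φ y e • A k y) := by
      have s1 := integral_sub (hi3.sub hi2) hi1
      simp only [Pi.sub_apply] at s1
      rw [s1, integral_sub hi3 hi2, hparts, sub_neg_eq_add, add_sub_cancel_right]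
    have e2 : ∫⁻ y, ‖φ y • β y - φ y • fderiv ℝ (A k) y e - fderiv ℝ φ y e • A k y‖ₑ
        = ∫⁻ y in K, ‖φ y • β y - φ y • fderiv ℝ (A k) y e - fderiv ℝ φ y e • A k y‖ₑ := by
      refine (setLIntegral_eq_of_support_subset fun y hy => ?_).symm
      by_contra hyK
      have z1 : φ y = 0 := image_eq_zero_of_notMem_tsupport hyK
      have z2 : fderiv ℝ φ y e = 0 :=
        image_eq_zero_of_notMem_tsupport (f := fun y => fderiv ℝ φ y e) fun h => hyK (hK' h)
      exact hy (by simp [z1, z2])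
    have hm1 : AEMeasurable (fun y => ‖A k y‖ₑ) (volume.restrict K) :=
      ((hAc.mono hφU).aestronglyMeasurable hK.measurableSet).enorm
    rw [e1]
    refine (enorm_integral_le_lintegral_enorm _).trans ?_
    rw [e2]
    calc ∫⁻ y in K, ‖φ y • β y - φ y • fderiv ℝ (A k) y e - fderiv ℝ φ y e • A k y‖ₑ
        ≤ ∫⁻ y in K, (ENNReal.ofReal C₁ * ‖fderiv ℝ (A k) y e + L y (A k y) - β y‖ₑ
          + ENNReal.ofReal (C₂ + C₁ * |C₃|) * ‖A k y‖ₑ) := by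
          refine setLIntegral_mono' hK.measurableSet fun y hy => ?_
          have hb : ‖φ y • β y - φ y • fderiv ℝ (A k) y e - fderiv ℝ φ y e • A k y‖
              ≤ C₁ * ‖fderiv ℝ (A k) y e + L y (A k y) - β y‖
                + (C₂ + C₁ * |C₃|) * ‖A k y‖ := by
            have e3 : φ y • β y - φ y • fderiv ℝ (A k) y e - fderiv ℝ φ y e • A k y
                = -(φ y • (fderiv ℝ (A k) y e + L y (A k y) - β y))
                  + (φ y • L y (A k y) - fderiv ℝ φ y e • A k y) := by
              rw [smul_sub, smul_add]
              abel
            rw [e3]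
            refine (norm_add_le _ _).trans (add_le_add ?_ ((norm_sub_le _ _).trans ?_))
            · rw [norm_neg, norm_smul]
              exact mul_le_mul_of_nonneg_right (hC₁ y) (norm_nonneg _)
            · rw [norm_smul, norm_smul]
              have b1 : ‖L y (A k y)‖ ≤ |C₃| * ‖A k y‖ := (ContinuousLinearMap.le_opNorm _ _).trans
                (mul_le_mul_of_nonneg_right ((hC₃ y hy).trans (le_abs_self _)) (norm_nonneg _))
              have b2 : ‖φ y‖ * ‖L y (A k y)‖ ≤ C₁ * (|C₃| * ‖A k y‖) :=
                mul_le_mul (hC₁ y) b1 (norm_nonneg _) hC₁0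
              have b3 : ‖fderiv ℝ φ y e‖ * ‖A k y‖ ≤ C₂ * ‖A k y‖ :=
                mul_le_mul_of_nonneg_right (hC₂ y) (norm_nonneg _)
              linarith
          rw [← ofReal_norm, ← ofReal_norm, ← ofReal_norm, ← ENNReal.ofReal_mul hC₁0,
            ← ENNReal.ofReal_mul (by positivity), ← ENNReal.ofReal_add (by positivity)
              (by positivity)]
          exact ENNReal.ofReal_le_ofReal hb
      _ = _ := by
          rw [lintegral_add_right' _ (hm1.const_mul _), lintegral_const_mul' _ _ ENNReal.ofReal_ne_top,
            lintegral_const_mul' _ _ ENNReal.ofReal_ne_top]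
  have hlim := (ENNReal.Tendsto.const_mul (a := ENNReal.ofReal C₁) (h1 K hφU hK)
    (Or.inr ENNReal.ofReal_ne_top)).add (ENNReal.Tendsto.const_mul
      (a := ENNReal.ofReal (C₂ + C₁ * |C₃|)) (h0 K hφU hK) (Or.inr ENNReal.ofReal_ne_top))
  rw [mul_zero, mul_zero, add_zero] at hlim
  have := ge_of_tendsto' hlim key
  simpa using this

lemma contDiff_of_contDiffOn (hU : IsOpen U) {K : Set (Model m)} (hK : IsClosed K) (hKU : K ⊆ U)
    {f : Model m → E} (hf : ContDiffOn ℝ ∞ f U) (h0 : ∀ y, y ∉ K → f y = 0) : ContDiff ℝ ∞ f := by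
  refine contDiff_iff_contDiffAt.2 fun y => ?_
  by_cases hy : y ∈ K
  · exact hf.contDiffAt (hU.mem_nhds (hKU hy))
  · refine (contDiffAt_const (c := (0 : E))).congr_of_eventuallyEq ?_
    filter_upwards [hK.isOpen_compl.mem_nhds hy] with z hz
    exact h0 z hz

lemma norm_le_sum_stdVec {F : Type*} [NormedAddCommGroup F] [NormedSpace ℝ F]
    (T : Model m →L[ℝ] F) : ‖T‖ ≤ ∑ i, ‖T (stdVec m i)‖ := by
  refine T.opNorm_le_bound (Finset.sum_nonneg fun _ _ => norm_nonneg _) fun v => ?_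
  conv_lhs => rw [← sum_stdVec v]
  rw [map_sum, Finset.sum_mul]
  refine (norm_sum_le _ _).trans (Finset.sum_le_sum fun i _ => ?_)
  rw [map_smul, norm_smul, mul_comm]
  gcongr
  exact PiLp.norm_apply_le v i

/-- Rellich's theorem with a cut-off weight, for the first order operators `∂_i + L_i`. -/
lemma rellich_weighted (hU : IsOpen U) {χ : Model m → ℝ} {K : Set (Model m)} (hK : IsCompact K)
    (hKU : K ⊆ U) (hχ : ContDiff ℝ ∞ χ) (hχ0 : ∀ y, 0 ≤ χ y) (hχ1 : ∀ y, χ y ≤ 1)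
    (hχK : ∀ y, y ∉ K → χ y = 0) {A : ℕ → Model m → E} {B : ℕ → Model m → Fin m → E}
    {L : Fin m → Model m → E →L[ℝ] E} (hA : ∀ k, ContDiffOn ℝ ∞ (A k) U)
    (hL : ∀ i, ContinuousOn (L i) U)
    (hB : ∀ k, ∀ y ∈ U, ∀ i, B k y i = fderiv ℝ (A k) y (stdVec m i) + L i y (A k y))
    {C : ENNReal} (hC : C ≠ ⊤) (h0 : ∀ k, ∫⁻ y in U, ENNReal.ofReal (χ y) * ‖A k y‖ₑ ^ 2 ≤ C)
    (h1 : ∀ k, ∫⁻ y in U, ENNReal.ofReal (χ y) * ‖B k y‖ₑ ^ 2 ≤ C) :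
    ∃ φ : ℕ → ℕ, StrictMono φ ∧ ∃ A₀ : Model m → E,
      ∀ᵐ y, χ y ≠ 0 → Tendsto (fun k => A (φ k) y) atTop (𝓝 (A₀ y)) := by
  have hχc := hχ.continuous
  have hzero : ∀ k y, y ∉ K → χ y ^ 2 • A k y = 0 := fun k y hy => by
    rw [hχK y hy]
    simp
  have hsm : ∀ k, ContDiff ℝ ∞ fun y => χ y ^ 2 • A k y := fun k =>
    contDiff_of_contDiffOn hU hK.isClosed hKU ((hχ.pow 2).contDiffOn.smul (hA k)) (hzero k)
  -- bounds for the lower order terms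
  have hb : ∀ i, ∃ c : ℝ, 0 ≤ c ∧ ∀ y ∈ K, 2 * ‖fderiv ℝ χ y (stdVec m i)‖ + ‖L i y‖ ≤ c := by
    intro i
    have hc : ContinuousOn (fun y => 2 * ‖fderiv ℝ χ y (stdVec m i)‖ + ‖L i y‖) K :=
      ((((hχ.continuous_fderiv (by simp)).clm_apply continuous_const).norm.const_mul
        2).continuousOn).add ((hL i).mono hKU).norm
    obtain ⟨c, hc⟩ := hK.exists_bound_of_continuousOn hc
    exact ⟨|c|, abs_nonneg c, fun y hy =>
      (le_abs_self _).trans ((hc y hy).trans (le_abs_self c))⟩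
  choose c hc0 hc using hb
  have hfd : ∀ k y, y ∈ K → ‖fderiv ℝ (fun y => χ y ^ 2 • A k y) y‖
      ≤ χ y * ((∑ i, c i) * ‖A k y‖ + m * ‖B k y‖) := by
    intro k y hy
    refine (norm_le_sum_stdVec _).trans ?_
    have hd : DifferentiableAt ℝ (A k) y :=
      ((hA k).contDiffAt (hU.mem_nhds (hKU hy))).differentiableAt (by simp)
    have hχd : DifferentiableAt ℝ χ y := hχ.differentiable (by simp) y
    have e : ∀ i, fderiv ℝ (fun y => χ y ^ 2 • A k y) y (stdVec m i)
        = (χ y ^ 2) • (B k y i - L i y (A k y))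
          + (2 * χ y * fderiv ℝ χ y (stdVec m i)) • A k y := by
      intro i
      have h2 : HasFDerivAt (fun y => χ y ^ 2 • A k y) _ y :=
        (hχd.hasFDerivAt.pow 2).smul hd.hasFDerivAt
      rw [h2.fderiv, hB k y (hKU hy)]
      simp only [add_apply, smul_apply, ContinuousLinearMap.smulRight_apply, add_sub_cancel_right]
      simp [mul_assoc]
    have hi : ∀ i, ‖fderiv ℝ (fun y => χ y ^ 2 • A k y) y (stdVec m i)‖
        ≤ χ y * (c i * ‖A k y‖ + ‖B k y‖) := by
      intro i
      rw [e]
      have hsq : χ y ^ 2 ≤ χ y := by nlinarith [hχ0 y, hχ1 y]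
      have hBi : ‖B k y i‖ ≤ ‖B k y‖ := norm_le_pi_norm _ i
      have b1 : ‖(χ y ^ 2) • (B k y i - L i y (A k y))‖ ≤ χ y * (‖B k y‖ + ‖L i y‖ * ‖A k y‖) := by
        rw [norm_smul, Real.norm_of_nonneg (sq_nonneg _)]
        refine mul_le_mul hsq ((norm_sub_le _ _).trans (add_le_add hBi
          (ContinuousLinearMap.le_opNorm _ _))) (norm_nonneg _) (hχ0 y)
      have b2 : ‖(2 * χ y * fderiv ℝ χ y (stdVec m i)) • A k y‖
          = χ y * (2 * ‖fderiv ℝ χ y (stdVec m i)‖ * ‖A k y‖) := by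
        rw [norm_smul, norm_mul, norm_mul, Real.norm_of_nonneg (hχ0 y)]
        norm_num
        ring
      refine (norm_add_le _ _).trans ((add_le_add b1 b2.le).trans ?_)
      rw [← mul_add]
      refine mul_le_mul_of_nonneg_left ?_ (hχ0 y)
      have b3 := mul_le_mul_of_nonneg_right (hc i y hy) (norm_nonneg (A k y))
      linarith
    refine (Finset.sum_le_sum fun i _ => hi i).trans ?_
    rw [← Finset.mul_sum, Finset.sum_add_distrib, Finset.sum_mul]
    simp
  set c₀ := ∑ i, c i with hc₀
  have hc₀0 : 0 ≤ c₀ := Finset.sum_nonneg fun i _ => hc0 i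
  obtain ⟨φ, hφ, f₀, h⟩ := rellich_vector (A := C + ENNReal.ofReal (2 * c₀ ^ 2) * C
      + ENNReal.ofReal (2 * m ^ 2) * C) hK hzero hsm
    (by simp [hC, ENNReal.mul_eq_top])
    (fun k => by
      refine le_trans ?_ (((h0 k).trans le_self_add).trans le_self_add)
      rw [← setLIntegral_eq_of_support_subset (s := U) fun y hy => by
        by_contra h
        exact hy (by simp [hχK y fun h' => h (hKU h')])]
      refine setLIntegral_mono' hU.measurableSet fun y hy => ?_
      rw [← ofReal_norm, ← ofReal_norm, ← ENNReal.ofReal_pow (norm_nonneg _),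
        ← ENNReal.ofReal_pow (norm_nonneg _), ← ENNReal.ofReal_mul (hχ0 y)]
      refine ENNReal.ofReal_le_ofReal ?_
      rw [norm_smul, Real.norm_of_nonneg (sq_nonneg _), mul_pow]
      refine mul_le_mul_of_nonneg_right ?_ (sq_nonneg _)
      rw [← pow_mul]
      exact pow_le_of_le_one (hχ0 y) (hχ1 y) (by norm_num))
    (fun k => by
      rw [← setLIntegral_eq_of_support_subset (s := U) fun y hy => by
        by_contra h
        have : y ∉ tsupport (fun y => χ y ^ 2 • A k y) := fun h' => by
          refine h (hKU ?_)
          refine closure_minimal (fun z hz => ?_) hK.isClosed h'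
          by_contra hzK
          exact hz (hzero k z hzK)
        exact hy (by
          simp only
          rw [← ofReal_norm, image_eq_zero_of_notMem_tsupport (f := fderiv ℝ fun y => χ y ^ 2 • A k y)
            fun h' => this (tsupport_fderiv_subset ℝ h')]
          simp)]
      have hm1 : AEMeasurable (fun y => ENNReal.ofReal (χ y) * ‖A k y‖ₑ ^ 2) (volume.restrict U) :=
        hχc.measurable.ennreal_ofReal.aemeasurable.mul
          (((hA k).continuousOn.aestronglyMeasurable hU.measurableSet).enorm.pow_const 2)
      calc ∫⁻ y in U, ‖fderiv ℝ (fun y => χ y ^ 2 • A k y) y‖ₑ ^ 2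
          ≤ ∫⁻ y in U, (ENNReal.ofReal (2 * c₀ ^ 2) * (ENNReal.ofReal (χ y) * ‖A k y‖ₑ ^ 2)
            + ENNReal.ofReal (2 * m ^ 2) * (ENNReal.ofReal (χ y) * ‖B k y‖ₑ ^ 2)) := by
            refine setLIntegral_mono' hU.measurableSet fun y hy => ?_
            have hb : ‖fderiv ℝ (fun y => χ y ^ 2 • A k y) y‖
                ≤ χ y * (c₀ * ‖A k y‖ + m * ‖B k y‖) := by
              by_cases hyK : y ∈ K
              · exact hfd k y hyK
              · have : y ∉ tsupport (fun y => χ y ^ 2 • A k y) := fun h' => by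
                  refine hyK ?_
                  refine closure_minimal (fun z hz => ?_) hK.isClosed h'
                  by_contra hzK
                  exact hz (hzero k z hzK)
                rw [image_eq_zero_of_notMem_tsupport (f := fderiv ℝ fun y => χ y ^ 2 • A k y)
                  fun h' => this (tsupport_fderiv_subset ℝ h'), hχK y hyK]
                simp
            rw [← ofReal_norm, ← ofReal_norm, ← ofReal_norm, ← ENNReal.ofReal_pow (norm_nonneg _),
              ← ENNReal.ofReal_pow (norm_nonneg _), ← ENNReal.ofReal_pow (norm_nonneg _),
              ← ENNReal.ofReal_mul (hχ0 y), ← ENNReal.ofReal_mul (hχ0 y),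
              ← ENNReal.ofReal_mul (by positivity), ← ENNReal.ofReal_mul (by positivity),
              ← ENNReal.ofReal_add (mul_nonneg (by positivity) (mul_nonneg (hχ0 y) (sq_nonneg _)))
                (mul_nonneg (by positivity) (mul_nonneg (hχ0 y) (sq_nonneg _)))]
            refine ENNReal.ofReal_le_ofReal ((pow_le_pow_left₀ (norm_nonneg _) hb 2).trans ?_)
            have hsq : χ y ^ 2 ≤ χ y := by nlinarith [hχ0 y, hχ1 y]
            have h2 : (c₀ * ‖A k y‖ + m * ‖B k y‖) ^ 2
                ≤ 2 * c₀ ^ 2 * ‖A k y‖ ^ 2 + 2 * m ^ 2 * ‖B k y‖ ^ 2 := by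
              nlinarith [sq_nonneg (c₀ * ‖A k y‖ - m * ‖B k y‖)]
            rw [mul_pow]
            refine (mul_le_mul hsq h2 (sq_nonneg _) (hχ0 y)).trans (le_of_eq ?_)
            ring
        _ ≤ _ := by
            rw [lintegral_add_left' (hm1.const_mul _), lintegral_const_mul' _ _ ENNReal.ofReal_ne_top,
              lintegral_const_mul' _ _ ENNReal.ofReal_ne_top]
            refine add_le_add (le_add_left ?_) ?_
            · exact mul_le_mul_right (h0 k) _
            · exact mul_le_mul_right (h1 k) _)
  refine ⟨φ, hφ, fun y => (χ y ^ 2)⁻¹ • f₀ y, ?_⟩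
  filter_upwards [h] with y hy hχy
  refine (hy.const_smul (χ y ^ 2)⁻¹).congr fun k => ?_
  rw [smul_smul, inv_mul_cancel₀ (pow_ne_zero 2 hχy), one_smul]

end Flat

end

section

/-! ### Smooth endomorphism fields and their derivatives in the frame -/

section Commutator

variable {E : Type*} [NormedAddCommGroup E] [NormedSpace ℝ E]

/-- The commutator with an endomorphism. -/
def commutatorL (X : E →L[ℝ] E) : (E →L[ℝ] E) →L[ℝ] (E →L[ℝ] E) :=
  ContinuousLinearMap.mul ℝ (E →L[ℝ] E) X - (ContinuousLinearMap.mul ℝ (E →L[ℝ] E)).flip X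

lemma commutatorL_apply (X Y : E →L[ℝ] E) : commutatorL X Y = X * Y - Y * X := rfl

set_option synthInstance.maxHeartbeats 200000 in
lemma continuous_commutatorL : Continuous (commutatorL (E := E)) :=
  (ContinuousLinearMap.mul ℝ (E →L[ℝ] E)).continuous.sub
    (ContinuousLinearMap.mul ℝ (E →L[ℝ] E)).flip.continuous

end Commutator

variable {m : ℕ} {M : Type*} [TopologicalSpace M] [ChartedSpace (Model m) M]
  [IsManifold (𝓡 m) ∞ M]

lemma continuousOn_gram_inv (g : RMetric m M) (p : M) (k l : Fin m) :
    ContinuousOn (fun y => (gram g p y)⁻¹ k l) (extChartAt (𝓡 m) p).target := by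
  have h1 : ContinuousOn (fun y => gram g p y) (extChartAt (𝓡 m) p).target :=
    continuousOn_pi.2 fun i => continuousOn_pi.2 fun j => (contDiffOn_gram g p i j).continuousOn
  have h2 : ContinuousOn (fun y => (gram g p y).det) (extChartAt (𝓡 m) p).target :=
    (Continuous.matrix_det continuous_id).comp_continuousOn h1
  have h3 : ContinuousOn (fun y => (gram g p y).adjugate k l) (extChartAt (𝓡 m) p).target :=
    ((Continuous.matrix_adjugate continuous_id).matrix_elem k l).comp_continuousOn h1
  refine ((h2.inv₀ fun y hy => (gram_posDef g hy).det_pos.ne').mul h3).congr fun y hy => ?_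
  rw [Matrix.inv_def, Ring.inverse_eq_inv']
  rfl

lemma continuousOn_christoffel (g : RMetric m M) (p : M) (i j k : Fin m) :
    ContinuousOn (fun y => christoffel g p y i j k) (extChartAt (𝓡 m) p).target := by
  have hd : ∀ a b (v : Model m), ContinuousOn (fun y => fderiv ℝ (fun z => gram g p z a b) y v)
      (extChartAt (𝓡 m) p).target := fun a b v =>
    ((contDiffOn_gram g p a b).continuousOn_fderiv_of_isOpen (isOpen_extChartAt_target p)
      (by simp)).clm_apply continuousOn_const
  exact continuousOn_const.mul (continuousOn_finsetSum _ fun l _ =>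
    (continuousOn_gram_inv g p k l).mul (((hd _ _ _).add (hd _ _ _)).sub (hd _ _ _)))

set_option synthInstance.maxHeartbeats 200000 in
lemma continuousOn_christoffelMap_stdVec (g : RMetric m M) (p : M) (i : Fin m) :
    ContinuousOn (fun y => christoffelMap g p y (stdVec m i)) (extChartAt (𝓡 m) p).target := by
  have h : ∀ y, christoffelMap g p y (stdVec m i) = ∑ j, ∑ k, christoffel g p y i j k •
      ContinuousLinearMap.smulRight (EuclideanSpace.proj j : Model m →L[ℝ] ℝ) (stdVec m k) := by
    intro y
    simp only [christoffelMap, sum_apply, smul_apply, ContinuousLinearMap.smulRight_apply]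
    rw [Finset.sum_eq_single i]
    · simp [stdVec]
    · intro b _ hb
      simp [stdVec, hb]
    · simp
  simp only [h]
  exact continuousOn_finsetSum _ fun j _ => continuousOn_finsetSum _ fun k _ =>
    (continuousOn_christoffel g p i j k).smul continuousOn_const

/-- The coefficients of an endomorphism-valued form in the chart around `p`. -/
def coordGrad (p x : M) (A : TangentSpace (𝓡 m) x →L[ℝ]
    (TangentSpace (𝓡 m) x →L[ℝ] TangentSpace (𝓡 m) x)) : Fin m → Model m →L[ℝ] Model m :=
  fun i => coordEnd p x (A (coordVec p i x))

lemma coordGrad_sub (p x : M) (A B : TangentSpace (𝓡 m) x →L[ℝ]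
    (TangentSpace (𝓡 m) x →L[ℝ] TangentSpace (𝓡 m) x)) (i : Fin m) :
    coordGrad p x (A - B) i = coordGrad p x A i - coordGrad p x B i := by
  ext1 v
  simp only [coordGrad, coordEnd_apply, sub_apply, map_sub]

lemma mem_source_symm {p : M} {y : Model m} (hy : y ∈ (extChartAt (𝓡 m) p).target) :
    (extChartAt (𝓡 m) p).symm y ∈ (chartAt (Model m) p).source := by
  simpa using (extChartAt (𝓡 m) p).map_target hy

lemma coordGrad_covDeriv (g : RMetric m M) {S : EndField m M} (hS : IsSmooth S) (p : M)
    {y : Model m} (hy : y ∈ (extChartAt (𝓡 m) p).target) (i : Fin m) :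
    coordGrad p ((extChartAt (𝓡 m) p).symm y) (covDeriv g S ((extChartAt (𝓡 m) p).symm y)) i
      = fderiv ℝ (localEnd p S) y (stdVec m i)
        + commutatorL (christoffelMap g p y (stdVec m i)) (localEnd p S y) := by
  rw [coordGrad, coordEnd_covDeriv' g hS (mem_source_symm hy), coordVec_eq,
    toCoord_ofCoord (mem_source_symm hy), (extChartAt (𝓡 m) p).right_inv hy, covAt,
    commutatorL_apply, add_sub_assoc]

lemma continuousOn_commutatorL_christoffelMap (g : RMetric m M) (p : M) (i : Fin m) :
    ContinuousOn (fun y => commutatorL (christoffelMap g p y (stdVec m i)))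
      (extChartAt (𝓡 m) p).target :=
  continuous_commutatorL.comp_continuousOn (continuousOn_christoffelMap_stdVec g p i)

lemma continuousOn_coordGrad_covDeriv (g : RMetric m M) {S : EndField m M} (hS : IsSmooth S)
    (p : M) (i : Fin m) :
    ContinuousOn (fun y => coordGrad p ((extChartAt (𝓡 m) p).symm y)
      (covDeriv g S ((extChartAt (𝓡 m) p).symm y)) i) (extChartAt (𝓡 m) p).target :=
  (continuousOn_fderiv_add (isOpen_extChartAt_target p) (contDiffOn_localEnd hS p)
    (continuousOn_commutatorL_christoffelMap g p i)).congr fun _ hy => coordGrad_covDeriv g hS p hy i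

lemma continuousOn_of_chart {E : Type*} [TopologicalSpace E] {p : M} {f : M → E}
    (h : ContinuousOn (fun y => f ((extChartAt (𝓡 m) p).symm y)) (extChartAt (𝓡 m) p).target) :
    ContinuousOn f (chartAt (Model m) p).source := by
  have h1 := continuousOn_extChartAt (I := 𝓡 m) p
  rw [extChartAt_source] at h1
  refine (h.comp h1 fun x hx => mem_extChartAt_target hx).congr fun x hx => ?_
  simp only [Function.comp_apply]
  rw [(extChartAt (𝓡 m) p).left_inv (by rwa [extChartAt_source])]

variable [T2Space M] [CompactSpace M] [MeasurableSpace M] [BorelSpace M]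

/-- On the support of a partition function, the norms in the frame and in the chart are
equivalent. -/
lemma exists_frame_bounds (g : RMetric m M) (p : M) : ∃ C : ℝ, 0 ≤ C ∧
    ∀ x ∈ (chartAt (Model m) p).source, extChartAt (𝓡 m) p x ∈ chartSupport p →
      (∀ S, ‖frameEnd g x S‖ ≤ C * ‖coordEnd p x S‖ ∧ ‖coordEnd p x S‖ ≤ C * ‖frameEnd g x S‖) ∧
      ∀ A, ‖frameGrad g x A‖ ≤ C * ‖coordGrad p x A‖
        ∧ ‖coordGrad p x A‖ ≤ C * ‖frameGrad g x A‖ := by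
  obtain ⟨c, hc, hcb⟩ := exists_frameMat_bound g p (isCompact_chartSupport p)
    (chartSupport_subset p)
  have hstd : ∀ i, ‖stdVec m i‖ = 1 := fun i => by simp [stdVec]
  have hmul : ∀ X Y Z : Model m →L[ℝ] Model m, ‖X‖ ≤ c → ‖Z‖ ≤ c →
      ‖X * Y * Z‖ ≤ c ^ 2 * ‖Y‖ := fun X Y Z hX hZ => by
    calc ‖X * Y * Z‖ ≤ ‖X‖ * ‖Y‖ * ‖Z‖ := norm_mul₃_le
      _ ≤ c * ‖Y‖ * c := by gcongr
      _ = c ^ 2 * ‖Y‖ := by ring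
  have hsum : ∀ (F : Model m →L[ℝ] Model m) (v : Model m) (B : Fin m → Model m →L[ℝ] Model m),
      ‖F‖ ≤ c → ‖v‖ = 1 → ‖∑ i, (F v) i • B i‖ ≤ m * c * ‖B‖ := fun F v B hF hv => by
    refine (norm_sum_le _ _).trans ((Finset.sum_le_card_nsmul _ _ (c * ‖B‖) fun i _ => ?_).trans
      (le_of_eq (by simp [mul_assoc])))
    rw [norm_smul]
    refine mul_le_mul ((PiLp.norm_apply_le _ i).trans ((F.le_opNorm v).trans ?_))
      (norm_le_pi_norm B i) (norm_nonneg _) hc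
    rw [hv, mul_one]
    exact hF
  refine ⟨c ^ 2 + c ^ 2 * (m * c), by positivity, fun x hx hxs => ?_⟩
  obtain ⟨hF, hF'⟩ := hcb x hx hxs
  refine ⟨fun S => ⟨?_, ?_⟩, fun A => ⟨?_, ?_⟩⟩
  · rw [frameEnd_eq g hx]
    refine (hmul _ _ _ hF' hF).trans (mul_le_mul_of_nonneg_right ?_ (norm_nonneg _))
    exact le_add_of_nonneg_right (by positivity)
  · rw [coordEnd_eq g hx]
    refine (hmul _ _ _ hF hF').trans (mul_le_mul_of_nonneg_right ?_ (norm_nonneg _))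
    exact le_add_of_nonneg_right (by positivity)
  · refine (pi_norm_le_iff_of_nonneg (by positivity)).2 fun a => ?_
    rw [frameGrad, frameEnd_eq g hx, coordEnd_frame g hx]
    refine (hmul _ _ _ hF' hF).trans ((mul_le_mul_of_nonneg_left
      (hsum _ _ (coordGrad p x A) hF (hstd a)) (sq_nonneg c)).trans ?_)
    rw [← mul_assoc]
    refine mul_le_mul_of_nonneg_right ?_ (norm_nonneg _)
    exact le_add_of_nonneg_left (by positivity)
  · refine (pi_norm_le_iff_of_nonneg (by positivity)).2 fun i => ?_
    rw [coordGrad, coordEnd_eq g hx, frameEnd_coordVec g hx]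
    refine (hmul _ _ _ hF hF').trans ((mul_le_mul_of_nonneg_left
      (hsum _ _ (frameGrad g x A) hF' (hstd i)) (sq_nonneg c)).trans ?_)
    rw [← mul_assoc]
    refine mul_le_mul_of_nonneg_right ?_ (norm_nonneg _)
    exact le_add_of_nonneg_left (by positivity)

/-- The pairs `(σ, ∇σ)` with `σ` a smooth section of `End(TM)`, in the orthonormal frame. -/
def IsSmoothJet (g : RMetric m M) (σ : M → Model m →L[ℝ] Model m)
    (α : M → Fin m → Model m →L[ℝ] Model m) : Prop :=
  ∃ S : EndField m M, IsSmooth S ∧ (∀ x, σ x = frameEnd g x (S x)) ∧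
    ∀ x, α x = frameGrad g x (covDeriv g S x)

variable (g : RMetric m M) {S T : EndField m M}

lemma measEnd_of_isSmooth (hS : IsSmooth S) : MeasEnd g S := fun p =>
  (continuousOn_of_chart (f := fun x => coordEnd p x (S x))
    (contDiffOn_localEnd hS p).continuousOn).aestronglyMeasurable
      (chartAt (Model m) p).open_source.measurableSet

lemma measGrad_covDeriv (hS : IsSmooth S) : MeasGrad g (covDeriv g S) := fun p i =>
  (continuousOn_of_chart (f := fun x => coordGrad p x (covDeriv g S x) i)
    (continuousOn_coordGrad_covDeriv g hS p i)).aestronglyMeasurable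
      (chartAt (Model m) p).open_source.measurableSet

lemma exists_bound_smooth (hS : IsSmooth S) : ∃ C : ℝ, ∀ x, ‖frameEnd g x (S x)‖ ≤ C ∧
    ‖frameGrad g x (covDeriv g S x)‖ ≤ C := by
  have h : ∀ p : M, ∃ C : ℝ, ∀ x, chartPartition m M p x ≠ 0 → ‖frameEnd g x (S x)‖ ≤ C ∧
      ‖frameGrad g x (covDeriv g S x)‖ ≤ C := by
    intro p
    obtain ⟨c, hc, hcb⟩ := exists_frame_bounds g p
    obtain ⟨C₁, hC₁⟩ := (isCompact_chartSupport p).exists_bound_of_continuousOn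
      ((contDiffOn_localEnd hS p).continuousOn.mono (chartSupport_subset p))
    obtain ⟨C₂, hC₂⟩ := (isCompact_chartSupport p).exists_bound_of_continuousOn
      ((continuousOn_pi.2 fun i => continuousOn_coordGrad_covDeriv g hS p i).mono
        (chartSupport_subset p))
    refine ⟨max (c * C₁) (c * C₂), fun x hx => ?_⟩
    have hxs := mem_source_of_ne_zero hx
    have hxK : extChartAt (𝓡 m) p x ∈ chartSupport p := ⟨x, subset_tsupport _ hx, rfl⟩
    obtain ⟨h1, h2⟩ := hcb x hxs hxK
    have e : (extChartAt (𝓡 m) p).symm (extChartAt (𝓡 m) p x) = x :=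
      (extChartAt (𝓡 m) p).left_inv (by rwa [extChartAt_source])
    have h3 := hC₁ _ hxK
    have h4 := hC₂ _ hxK
    rw [localEnd_apply hxs] at h3
    beta_reduce at h4
    rw [e] at h4
    exact ⟨(h1 _).1.trans ((mul_le_mul_of_nonneg_left h3 hc).trans (le_max_left _ _)),
      (h2 _).1.trans ((mul_le_mul_of_nonneg_left h4 hc).trans (le_max_right _ _))⟩
  choose C hC using h
  refine ⟨∑ p ∈ chartCenters m M, |C p|, fun x => ?_⟩
  have h1 : |C (frameCenter m x)| ≤ ∑ p ∈ chartCenters m M, |C p| :=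
    Finset.single_le_sum (f := fun p => |C p|) (fun _ _ => abs_nonneg _) (frameCenter_mem x)
  have h2 := hC (frameCenter m x) x (frameCenter_ne_zero x)
  exact ⟨h2.1.trans ((le_abs_self _).trans h1), h2.2.trans ((le_abs_self _).trans h1)⟩

lemma eq_neg_mul_mul {R : Type*} [Ring R] {s t a b : R} (h : a * t + s * b = 0) (hts : t * s = 1) :
    b = -(t * a * t) := by
  have h1 : b = t * (s * b) := by rw [← mul_assoc, hts, one_mul]
  rw [h1, eq_neg_of_add_eq_zero_right h, mul_neg, mul_assoc]

lemma covDeriv_inverse (hS : IsSmooth S) (hT : IsSmooth T)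
    (h1 : ∀ x, (S x).comp (T x) = ContinuousLinearMap.id ℝ _)
    (h2 : ∀ x, (T x).comp (S x) = ContinuousLinearMap.id ℝ _) (x : M) (u : TangentSpace (𝓡 m) x) :
    frameEnd g x (covDeriv g T x u)
      = -(frameEnd g x (T x) * frameEnd g x (covDeriv g S x u) * frameEnd g x (T x)) := by
  have h := covDeriv_comp g hS hT x u
  have e : (fun x => (S x).comp (T x)) = fun x => ContinuousLinearMap.id ℝ _ := funext h1
  rw [e, covDeriv_id] at h
  have h3 := congrArg (frameEnd g x) h.symm
  change frameEnd g x (_ + _) = frameEnd g x 0 at h3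
  rw [frameEnd_zero, frameEnd_add, frameEnd_comp, frameEnd_comp] at h3
  have h4 : frameEnd g x (T x) * frameEnd g x (S x) = 1 := by
    rw [← frameEnd_comp, h2, frameEnd_id]
  exact eq_neg_mul_mul h3 h4

end

section

/-! ### The Sobolev space of endomorphism fields as a jet algebra -/

variable {m : ℕ} {M : Type*} [TopologicalSpace M] [ChartedSpace (Model m) M]
  [IsManifold (𝓡 m) ∞ M] [T2Space M] [CompactSpace M] [MeasurableSpace M] [BorelSpace M]
  (g : RMetric m M)

lemma frameGrad_zero (x : M) : frameGrad g x 0 = 0 := by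
  funext a
  exact frameEnd_zero g x

lemma isSmoothJet_mul {σ τ : M → Model m →L[ℝ] Model m} {α β : M → Fin m → Model m →L[ℝ] Model m}
    (h : IsSmoothJet g σ α) (h' : IsSmoothJet g τ β) :
    IsSmoothJet g (fun x => σ x * τ x) (fun x a => α x a * τ x + σ x * β x a) := by
  obtain ⟨S, hS, h1, h2⟩ := h
  obtain ⟨T, hT, h3, h4⟩ := h'
  refine ⟨_, hS.comp hT, fun x => ?_, fun x => ?_⟩
  · beta_reduce
    rw [h1, h3, frameEnd_comp]
  · funext a
    beta_reduce
    rw [h1, h2, h3, h4, frameGrad, frameGrad, frameGrad, covDeriv_comp g hS hT, frameEnd_add,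
      frameEnd_comp, frameEnd_comp]

lemma isSmoothJet_star {σ : M → Model m →L[ℝ] Model m} {α : M → Fin m → Model m →L[ℝ] Model m}
    (h : IsSmoothJet g σ α) : IsSmoothJet g (fun x => star (σ x)) (fun x a => star (α x a)) := by
  obtain ⟨S, hS, h1, h2⟩ := h
  obtain ⟨S', hS', h3, h4⟩ := exists_adjoint g hS
  refine ⟨S', hS', fun x => ?_, fun x => ?_⟩
  · beta_reduce
    rw [h1, star_frameEnd g x (h3 x)]
  · funext a
    beta_reduce
    rw [h2, frameGrad, star_frameEnd g x (h4 x _)]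
    rfl

lemma isSmoothJet_inv {σ : M → Model m →L[ℝ] Model m} {α : M → Fin m → Model m →L[ℝ] Model m}
    (h : IsSmoothJet g σ α) (hu : ∀ x, IsUnit (σ x)) :
    IsSmoothJet g (fun x => Ring.inverse (σ x))
      (fun x a => -(Ring.inverse (σ x) * α x a * Ring.inverse (σ x))) := by
  obtain ⟨S, hS, h1, h2⟩ := h
  let T : EndField m M := fun x => ofFrameEnd g x (Ring.inverse (σ x))
  have hT : ∀ x, frameEnd g x (T x) = Ring.inverse (σ x) := fun x => frameEnd_ofFrameEnd g x _
  have hST : ∀ x, (S x).comp (T x) = ContinuousLinearMap.id ℝ _ := fun x =>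
    frameEnd_injective g x (by
      rw [frameEnd_comp, hT, ← h1, Ring.mul_inverse_cancel _ (hu x), frameEnd_id])
  have hTS : ∀ x, (T x).comp (S x) = ContinuousLinearMap.id ℝ _ := fun x =>
    frameEnd_injective g x (by
      rw [frameEnd_comp, hT, ← h1, Ring.inverse_mul_cancel _ (hu x), frameEnd_id])
  have hTs := isSmooth_of_inverse hS hST hTS
  refine ⟨T, hTs, fun x => (hT x).symm, fun x => ?_⟩
  funext a
  beta_reduce
  rw [h2, frameGrad, frameGrad, covDeriv_inverse g hS hTs hST hTS, hT]

lemma isSmoothJet_trace_smul {σ τ : M → Model m →L[ℝ] Model m}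
    {α β : M → Fin m → Model m →L[ℝ] Model m} {χ : ℝ → ℝ} (h : IsSmoothJet g σ α)
    (h' : IsSmoothJet g τ β) (hχ : ContDiff ℝ ∞ χ) :
    IsSmoothJet g (fun x => χ (traceL (Model m) (σ x)) • τ x) (fun x a =>
      (deriv χ (traceL (Model m) (σ x)) * traceL (Model m) (α x a)) • τ x
        + χ (traceL (Model m) (σ x)) • β x a) := by
  obtain ⟨S, hS, h1, h2⟩ := h
  obtain ⟨T, hT, h3, h4⟩ := h'
  refine ⟨_, hT.smul (isSmoothFun_trace hχ hS), fun x => ?_, fun x => ?_⟩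
  · beta_reduce
    rw [h1, h3, frameEnd_smul, traceL_frameEnd]
  · funext a
    beta_reduce
    rw [h1, h2, h3, h4, frameGrad, frameGrad, frameGrad, covDeriv_trace_smul g hχ hS hT,
      frameEnd_add, frameEnd_smul, frameEnd_smul, traceL_frameEnd, traceL_frameEnd]

/-- Convergence in `L²` on the manifold implies local convergence in `L¹` in the charts. -/
lemma tendsto_lintegral_chart {F E : Type*} [NormedAddCommGroup F] [NormedAddCommGroup E]
    {p : M} {f : ℕ → M → F} {G : ℕ → Model m → E} {C : ℝ} (hC : 0 ≤ C)
    (hf : ∀ k, AEStronglyMeasurable (f k) (vol g))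
    (hG : ∀ k, ∀ y ∈ chartDomain p, ‖G k y‖ ≤ C * ‖f k ((extChartAt (𝓡 m) p).symm y)‖)
    (h : Tendsto (fun k => eLpNorm (f k) 2 (vol g)) atTop (𝓝 0)) (K : Set (Model m))
    (hKp : K ⊆ chartDomain p) (hK : IsCompact K) :
    Tendsto (fun k => ∫⁻ y in K, ‖G k y‖ₑ) atTop (𝓝 0) := by
  obtain ⟨C', hC', hle⟩ := exists_lintegral_compact_le g p hK hKp
  have h1 : ∀ k, ∫⁻ x, ‖f k x‖ₑ ∂vol g ≤ eLpNorm (f k) 2 (vol g) * vol g Set.univ ^ (1 / 2 : ℝ) := by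
    intro k
    rw [← eLpNorm_one_eq_lintegral_enorm]
    refine (eLpNorm_le_eLpNorm_mul_rpow_measure_univ (p := 1) (q := 2) (by norm_num)
      (hf k)).trans (le_of_eq ?_)
    norm_num
  have h2 : ∀ k, ∫⁻ y in K, ‖G k y‖ₑ
      ≤ ENNReal.ofReal C * (C' * (eLpNorm (f k) 2 (vol g) * vol g Set.univ ^ (1 / 2 : ℝ))) := by
    intro k
    calc ∫⁻ y in K, ‖G k y‖ₑ
        ≤ ∫⁻ y in K, ENNReal.ofReal C * ‖f k ((extChartAt (𝓡 m) p).symm y)‖ₑ := by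
          refine setLIntegral_mono' hK.measurableSet fun y hy => ?_
          rw [← ofReal_norm, ← ofReal_norm, ← ENNReal.ofReal_mul hC]
          exact ENNReal.ofReal_le_ofReal (hG k y (hKp hy))
      _ = ENNReal.ofReal C * ∫⁻ y in K, ‖f k ((extChartAt (𝓡 m) p).symm y)‖ₑ :=
          lintegral_const_mul' _ _ ENNReal.ofReal_ne_top
      _ ≤ _ := mul_le_mul_right ((hle _ (hf k).enorm).trans (mul_le_mul_right (h1 k) _)) _
  have hv : vol g Set.univ ^ (1 / 2 : ℝ) ≠ ⊤ :=
    ENNReal.rpow_ne_top_of_nonneg (by norm_num) (measure_ne_top _ _)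
  have hlim := ENNReal.Tendsto.const_mul (a := ENNReal.ofReal C)
    (ENNReal.Tendsto.const_mul (a := C') (ENNReal.Tendsto.mul_const h (Or.inr hv)) (Or.inr hC'))
    (Or.inr ENNReal.ofReal_ne_top)
  rw [zero_mul, mul_zero, mul_zero] at hlim
  exact tendsto_of_tendsto_of_tendsto_of_le_of_le tendsto_const_nhds hlim (fun _ => zero_le) h2

lemma norm_apply_le_of_norm_le {E ι : Type*} [NormedAddCommGroup E] [Fintype ι] {B : ι → E} {r : ℝ}
    (h : ‖B‖ ≤ r) (i : ι) : ‖B i‖ ≤ r := (norm_le_pi_norm B i).trans h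

lemma symm_mem_bounds {p : M} {y : Model m} (hy : y ∈ chartDomain p) :
    (extChartAt (𝓡 m) p).symm y ∈ (chartAt (Model m) p).source ∧
      extChartAt (𝓡 m) p ((extChartAt (𝓡 m) p).symm y) ∈ chartSupport p := by
  refine ⟨mem_source_symm hy.1, ?_⟩
  rw [(extChartAt (𝓡 m) p).right_inv hy.1]
  exact chartDomain_subset_chartSupport p hy

lemma isSmoothJet_closable {σ : ℕ → M → Model m →L[ℝ] Model m}
    {α : ℕ → M → Fin m → Model m →L[ℝ] Model m} {α₀ : M → Fin m → Model m →L[ℝ] Model m}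
    (h : ∀ k, IsSmoothJet g (σ k) (α k)) (hα₀ : AEStronglyMeasurable α₀ (vol g))
    (h0 : Tendsto (fun k => eLpNorm (σ k) 2 (vol g)) atTop (𝓝 0))
    (h1 : Tendsto (fun k => eLpNorm (α k - α₀) 2 (vol g)) atTop (𝓝 0)) :
    α₀ =ᵐ[vol g] 0 := by
  choose S hS hσ hα using h
  let A₀ : GradField m M := fun x => ofFrameGrad g x (α₀ x)
  have hA₀ : ∀ x, frameGrad g x (A₀ x) = α₀ x := fun x => frameGrad_ofFrameGrad g x _
  have hA₀m : MeasGrad g A₀ := (measGrad_iff g A₀).2 (by simpa only [hA₀] using hα₀)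
  have hσm : ∀ k, AEStronglyMeasurable (σ k) (vol g) := fun k =>
    ((measEnd_iff g _).1 (measEnd_of_isSmooth g (hS k))).congr
      (Eventually.of_forall fun x => (hσ k x).symm)
  have hαm : ∀ k, AEStronglyMeasurable (α k) (vol g) := fun k =>
    ((measGrad_iff g _).1 (measGrad_covDeriv g (hS k))).congr
      (Eventually.of_forall fun x => (hα k x).symm)
  refine ae_vol_of_ae_chart g fun p _ => ?_
  obtain ⟨C, hC, hCb⟩ := exists_frame_bounds g p
  have key : ∀ i, ∀ᵐ y, y ∈ chartDomain p →
      coordGrad p ((extChartAt (𝓡 m) p).symm y) (A₀ ((extChartAt (𝓡 m) p).symm y)) i = 0 := by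
    intro i
    have hp := (chartAt (Model m) p).open_source.measurableSet
    have hm : AEStronglyMeasurable (fun y => coordGrad p ((extChartAt (𝓡 m) p).symm y)
        (A₀ ((extChartAt (𝓡 m) p).symm y)) i) (volume.restrict (chartDomain p)) := by
      have h2 := aestronglyMeasurable_chart g p
        ((aestronglyMeasurable_indicator_iff hp).2 (hA₀m p i))
      refine h2.congr ?_
      filter_upwards [ae_restrict_mem (isOpen_chartDomain p).measurableSet] with y hy
      exact Set.indicator_of_mem (mem_source_symm hy.1) _
    refine ae_eq_zero_of_tendsto (isOpen_chartDomain p)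
      (fun k => (contDiffOn_localEnd (hS k) p).mono (chartDomain_subset p))
      ((continuousOn_commutatorL_christoffelMap g p i).mono (chartDomain_subset p)) hm
      (tendsto_lintegral_chart g hC hσm (fun k y hy => ?_) h0)
      (tendsto_lintegral_chart g hC (fun k => (hαm k).sub hα₀) (fun k y hy => ?_) h1) (e := stdVec m i)
    · obtain ⟨hb1, hb2⟩ := symm_mem_bounds hy
      rw [hσ]
      exact ((hCb _ hb1 hb2).1 _).2
    · obtain ⟨hb1, hb2⟩ := symm_mem_bounds hy
      rw [← coordGrad_covDeriv g (hS k) p hy.1 i, ← coordGrad_sub, Pi.sub_apply, hα, ← hA₀,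
        ← frameGrad_sub]
      exact norm_apply_le_of_norm_le ((hCb _ hb1 hb2).2 _).2 i
  filter_upwards [ae_all_iff.2 key] with y hy hyd
  obtain ⟨hb1, hb2⟩ := symm_mem_bounds hyd
  have h2 := ((hCb _ hb1 hb2).2 (A₀ ((extChartAt (𝓡 m) p).symm y))).1
  have h3 : coordGrad p ((extChartAt (𝓡 m) p).symm y) (A₀ ((extChartAt (𝓡 m) p).symm y)) = 0 :=
    funext fun i => hy i hyd
  rw [h3, norm_zero, mul_zero, hA₀] at h2
  exact norm_le_zero_iff.1 h2

open Classical in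
/-- The partition function of the chart around `p`, in coordinates. -/
def chartCutoff (p : M) : Model m → ℝ :=
  (extChartAt (𝓡 m) p).target.indicator fun y => chartPartition m M p ((extChartAt (𝓡 m) p).symm y)

lemma chartCutoff_apply {p : M} {y : Model m} (hy : y ∈ (extChartAt (𝓡 m) p).target) :
    chartCutoff p y = chartPartition m M p ((extChartAt (𝓡 m) p).symm y) := by
  rw [chartCutoff, Set.indicator_of_mem hy]

lemma chartCutoff_eq_zero {p : M} {y : Model m} (hy : y ∉ chartSupport p) :
    chartCutoff p y = 0 := by
  by_cases h : y ∈ (extChartAt (𝓡 m) p).target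
  · rw [chartCutoff_apply h]
    by_contra h'
    exact hy (chartDomain_subset_chartSupport p ⟨h, h'⟩)
  · rw [chartCutoff, Set.indicator_of_notMem h]

lemma contDiff_chartCutoff (p : M) : ContDiff ℝ ∞ (chartCutoff (m := m) p) := by
  refine contDiff_of_contDiffOn (isOpen_extChartAt_target p) (isCompact_chartSupport p).isClosed
    (chartSupport_subset p) ?_ fun y hy => chartCutoff_eq_zero hy
  exact (contDiffOn_of_contMDiffOn (f := chartPartition m M p)
    ((chartPartition m M p).contMDiff.contMDiffOn)).congr fun y hy => chartCutoff_apply hy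

lemma chartCutoff_nonneg (p : M) (y : Model m) : 0 ≤ chartCutoff p y :=
  Set.indicator_nonneg (fun _ _ => (chartPartition m M).nonneg _ _) _

lemma chartCutoff_le_one (p : M) (y : Model m) : chartCutoff p y ≤ 1 := by
  by_cases h : y ∈ (extChartAt (𝓡 m) p).target
  · rw [chartCutoff_apply h]
    exact (chartPartition m M).le_one _ _
  · rw [chartCutoff, Set.indicator_of_notMem h]
    exact zero_le_one

lemma lintegral_cutoff_le {F E : Type*} [NormedAddCommGroup F] [NormedAddCommGroup E]
    {p : M} {f : M → F} {G : Model m → E} {C : ℝ} {C' B : ENNReal}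
    (hle : ∀ f : M → ENNReal, AEMeasurable f (vol g) → ∫⁻ y in (extChartAt (𝓡 m) p).target,
        ENNReal.ofReal (chartPartition m M p ((extChartAt (𝓡 m) p).symm y))
          * f ((extChartAt (𝓡 m) p).symm y) ≤ C' * ∫⁻ x, f x ∂vol g)
    (hf : AEStronglyMeasurable f (vol g))
    (hG : ∀ y ∈ chartDomain p, ‖G y‖ ≤ C * ‖f ((extChartAt (𝓡 m) p).symm y)‖)
    (hB : eLpNorm f 2 (vol g) ≤ B) :
    ∫⁻ y in (extChartAt (𝓡 m) p).target, ENNReal.ofReal (chartCutoff p y) * ‖G y‖ₑ ^ 2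
      ≤ ENNReal.ofReal (C ^ 2) * (C' * B ^ 2) := by
  calc ∫⁻ y in (extChartAt (𝓡 m) p).target, ENNReal.ofReal (chartCutoff p y) * ‖G y‖ₑ ^ 2
      ≤ ∫⁻ y in (extChartAt (𝓡 m) p).target, ENNReal.ofReal (C ^ 2) *
        (ENNReal.ofReal (chartPartition m M p ((extChartAt (𝓡 m) p).symm y))
          * ‖f ((extChartAt (𝓡 m) p).symm y)‖ₑ ^ 2) := by
        refine setLIntegral_mono' (measurableSet_target p) fun y hy => ?_
        rw [chartCutoff_apply hy]
        by_cases h : chartPartition m M p ((extChartAt (𝓡 m) p).symm y) = 0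
        · rw [h, ENNReal.ofReal_zero, zero_mul]
          exact zero_le
        · rw [mul_left_comm]
          refine mul_le_mul_right ?_ _
          rw [← ofReal_norm, ← ofReal_norm, ← ENNReal.ofReal_pow (norm_nonneg _),
            ← ENNReal.ofReal_pow (norm_nonneg _), ← ENNReal.ofReal_mul (sq_nonneg _), ← mul_pow]
          exact ENNReal.ofReal_le_ofReal (pow_le_pow_left₀ (norm_nonneg _) (hG y ⟨hy, h⟩) 2)
    _ ≤ _ := by
        rw [lintegral_const_mul' _ _ ENNReal.ofReal_ne_top]
        refine mul_le_mul_right ((hle (fun x => ‖f x‖ₑ ^ 2) (hf.enorm.pow_const 2)).trans ?_) _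
        refine mul_le_mul_right ?_ _
        rw [← eLpNorm_two_sq]
        exact pow_le_pow_left' hB 2

lemma isSmoothJet_rellich {σ : ℕ → M → Model m →L[ℝ] Model m}
    {α : ℕ → M → Fin m → Model m →L[ℝ] Model m} {C : ENNReal}
    (h : ∀ k, IsSmoothJet g (σ k) (α k)) (hC : C ≠ ⊤) (h0 : ∀ k, eLpNorm (σ k) 2 (vol g) ≤ C)
    (h1 : ∀ k, eLpNorm (α k) 2 (vol g) ≤ C) :
    ∃ φ : ℕ → ℕ, StrictMono φ ∧ ∃ σ₀ : M → Model m →L[ℝ] Model m,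
      ∀ᵐ x ∂vol g, Tendsto (fun k => σ (φ k) x) atTop (𝓝 (σ₀ x)) := by
  choose S hS hσ hα using h
  have hσm : ∀ k, AEStronglyMeasurable (σ k) (vol g) := fun k =>
    ((measEnd_iff g _).1 (measEnd_of_isSmooth g (hS k))).congr
      (Eventually.of_forall fun x => (hσ k x).symm)
  have hαm : ∀ k, AEStronglyMeasurable (α k) (vol g) := fun k =>
    ((measGrad_iff g _).1 (measGrad_covDeriv g (hS k))).congr
      (Eventually.of_forall fun x => (hα k x).symm)
  obtain ⟨φ, hφ, hlim⟩ := exists_common_subseq (chartCenters m M)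
    (fun p φ => ∀ᵐ y, y ∈ chartDomain p → ∃ l : Model m →L[ℝ] Model m,
      Tendsto (fun k => σ (φ k) ((extChartAt (𝓡 m) p).symm y)) atTop (𝓝 l))
    (fun p _ φ hφ => by
      obtain ⟨c, hc, hcb⟩ := exists_frame_bounds g p
      obtain ⟨C', hC', hle⟩ := exists_lintegral_chart_le g p
      obtain ⟨ψ, hψ, A₀, hA₀⟩ := rellich_weighted (C := ENNReal.ofReal (c ^ 2) * (C' * C ^ 2))
        (isOpen_extChartAt_target p) (isCompact_chartSupport p) (chartSupport_subset p)
        (contDiff_chartCutoff p) (chartCutoff_nonneg p) (chartCutoff_le_one p)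
        (fun y => chartCutoff_eq_zero) (A := fun k => localEnd p (S (φ k)))
        (B := fun k y => coordGrad p ((extChartAt (𝓡 m) p).symm y)
          (covDeriv g (S (φ k)) ((extChartAt (𝓡 m) p).symm y)))
        (fun k => contDiffOn_localEnd (hS (φ k)) p)
        (continuousOn_commutatorL_christoffelMap g p)
        (fun k y hy i => coordGrad_covDeriv g (hS (φ k)) p hy i)
        (ENNReal.mul_ne_top ENNReal.ofReal_ne_top
          (ENNReal.mul_ne_top hC' (ENNReal.pow_ne_top hC)))
        (fun k => lintegral_cutoff_le g hle (hσm (φ k)) (fun y hy => by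
          obtain ⟨hb1, hb2⟩ := symm_mem_bounds hy
          rw [hσ]
          exact ((hcb _ hb1 hb2).1 _).2) (h0 (φ k)))
        (fun k => lintegral_cutoff_le g hle (hαm (φ k)) (fun y hy => by
          obtain ⟨hb1, hb2⟩ := symm_mem_bounds hy
          rw [hα]
          exact ((hcb _ hb1 hb2).2 _).2) (h1 (φ k)))
      refine ⟨ψ, hψ, ?_⟩
      filter_upwards [hA₀] with y hy hyd
      have h2 := hy (by
        rw [chartCutoff_apply hyd.1]
        exact hyd.2)
      refine ⟨_, (((tendsto_const_nhds (x := Ring.inverse (frameMat g p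
        ((extChartAt (𝓡 m) p).symm y)))).mul h2).mul (tendsto_const_nhds (x := frameMat g p
        ((extChartAt (𝓡 m) p).symm y)))).congr fun k => ?_⟩
      rw [Function.comp_apply, hσ, frameEnd_eq g (mem_source_symm hyd.1)]
      rfl)
    (fun p φ ψ hψ h => by
      filter_upwards [h] with y hy hyd
      obtain ⟨l, hl⟩ := hy hyd
      exact ⟨l, hl.comp hψ.tendsto_atTop⟩)
  refine ⟨φ, hφ, fun x => limUnder atTop fun k => σ (φ k) x, ?_⟩
  refine (ae_vol_of_ae_chart g (P := fun x => ∃ l : Model m →L[ℝ] Model m,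
    Tendsto (fun k => σ (φ k) x) atTop (𝓝 l)) hlim).mono fun x hx => tendsto_nhds_limUnder hx

/-- The smooth endomorphism fields and their covariant derivatives form a jet algebra. -/
theorem isJetAlgebra_isSmoothJet : IsJetAlgebra (vol g) (IsSmoothJet g) where
  aesm_fst := by
    rintro σ α ⟨S, hS, h1, -⟩
    exact ((measEnd_iff g _).1 (measEnd_of_isSmooth g hS)).congr
      (Eventually.of_forall fun x => (h1 x).symm)
  aesm_snd := by
    rintro σ α ⟨S, hS, -, h2⟩
    exact ((measGrad_iff g _).1 (measGrad_covDeriv g hS)).congr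
      (Eventually.of_forall fun x => (h2 x).symm)
  bdd := by
    rintro σ α ⟨S, hS, h1, h2⟩
    obtain ⟨C, hC⟩ := exists_bound_smooth g hS
    exact ⟨C, fun x => by
      rw [h1, h2]
      exact hC x⟩
  add := by
    rintro σ α τ β ⟨S, hS, h1, h2⟩ ⟨T, hT, h3, h4⟩
    refine ⟨S + T, hS.add hT, fun x => ?_, fun x => ?_⟩
    · beta_reduce
      rw [h1, h3, ← frameEnd_add]
      rfl
    · beta_reduce
      rw [h2, h4, ← frameGrad_add, covDeriv_add g hS hT]
  smul := by
    rintro c σ α ⟨S, hS, h1, h2⟩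
    refine ⟨c • S, hS.const_smul c, fun x => ?_, fun x => ?_⟩
    · beta_reduce
      rw [h1, ← frameEnd_smul]
      rfl
    · beta_reduce
      rw [h2, ← frameGrad_smul, covDeriv_const_smul g hS]
  one := ⟨_, isSmooth_id, fun x => (frameEnd_id g x).symm, fun x => by
    rw [covDeriv_id, frameGrad_zero]⟩
  mul := isSmoothJet_mul g
  star_mem := isSmoothJet_star g
  inv := isSmoothJet_inv g
  trace_smul := isSmoothJet_trace_smul g
  closable := isSmoothJet_closable g
  rellich := isSmoothJet_rellich g

end

section

/-! ### Translation of the variational problem to the frame -/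

section Pointwise

variable {X : Type*} [MeasurableSpace X] {μ : Measure X}
  {V : Type*} [NormedAddCommGroup V] [InnerProductSpace ℝ V] [FiniteDimensional ℝ V]
  {ι : Type*} [Fintype ι]

/-- A nonnegative quadratic quantity comparable to the square of a norm converges to zero in `L¹`
if and only if the norm converges to zero in `L²`. -/
lemma tendsto_lintegral_iff_of_bounds {E : Type*} [NormedAddCommGroup E] {f : ℕ → X → E}
    {q : E → ℝ} {c : ℝ} (hc : 0 ≤ c) (h1 : ∀ v, ‖v‖ ^ 2 ≤ q v) (h2 : ∀ v, q v ≤ c * ‖v‖ ^ 2) :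
    Tendsto (fun k => ∫⁻ x, ENNReal.ofReal (q (f k x)) ∂μ) atTop (𝓝 0)
      ↔ Tendsto (fun k => eLpNorm (f k) 2 μ) atTop (𝓝 0) := by
  rw [tendsto_eLpNorm_two_iff]
  have e : ∀ v : E, ‖v‖ₑ ^ 2 = ENNReal.ofReal (‖v‖ ^ 2) := fun v => by
    rw [← ofReal_norm, ENNReal.ofReal_pow (norm_nonneg _)]
  constructor
  · intro h
    refine tendsto_of_tendsto_of_tendsto_of_le_of_le tendsto_const_nhds h (fun _ => zero_le)
      fun k => lintegral_mono fun x => ?_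
    beta_reduce
    rw [e]
    exact ENNReal.ofReal_le_ofReal (h1 _)
  · intro h
    have h3 := ENNReal.Tendsto.const_mul (a := ENNReal.ofReal c) h (Or.inr ENNReal.ofReal_ne_top)
    rw [mul_zero] at h3
    refine tendsto_of_tendsto_of_tendsto_of_le_of_le tendsto_const_nhds h3 (fun _ => zero_le)
      fun k => ?_
    beta_reduce
    rw [← lintegral_const_mul' _ _ ENNReal.ofReal_ne_top]
    refine lintegral_mono fun x => ?_
    beta_reduce
    rw [e, ← ENNReal.ofReal_mul hc]
    exact ENNReal.ofReal_le_ofReal (h2 _)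

lemma tendsto_lintegral_hs_iff {f : ℕ → X → V →L[ℝ] V} :
    Tendsto (fun k => ∫⁻ x, ENNReal.ofReal (hs (f k x) (f k x)) ∂μ) atTop (𝓝 0)
      ↔ Tendsto (fun k => eLpNorm (f k) 2 μ) atTop (𝓝 0) :=
  tendsto_lintegral_iff_of_bounds (q := fun v => hs v v) (Nat.cast_nonneg _) norm_sq_le_hs hs_self_le

lemma tendsto_lintegral_hsGrad_iff {f : ℕ → X → ι → V →L[ℝ] V} :
    Tendsto (fun k => ∫⁻ x, ENNReal.ofReal (hsGrad (f k x) (f k x)) ∂μ) atTop (𝓝 0)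
      ↔ Tendsto (fun k => eLpNorm (f k) 2 μ) atTop (𝓝 0) :=
  tendsto_lintegral_iff_of_bounds (q := fun v => hsGrad v v) (by positivity) norm_sq_le_hsGrad
    hsGrad_self_le

lemma hs_sum_left {κ : Type*} (s : Finset κ) (f : κ → V →L[ℝ] V) (τ : V →L[ℝ] V) :
    hs (∑ i ∈ s, f i) τ = ∑ i ∈ s, hs (f i) τ := by
  simp only [hs, star_sum, Finset.sum_mul, map_sum]

end Pointwise

variable {m : ℕ} {M : Type*} [TopologicalSpace M] [ChartedSpace (Model m) M]
  [IsManifold (𝓡 m) ∞ M] [T2Space M] [CompactSpace M] [MeasurableSpace M] [BorelSpace M]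
  (g : RMetric m M)

/-- An endomorphism field in the orthonormal frame. -/
def frameField (S : EndField m M) : M → Model m →L[ℝ] Model m := fun x => frameEnd g x (S x)

/-- An endomorphism-valued form in the orthonormal frame. -/
def frameGradField (A : GradField m M) : M → Fin m → Model m →L[ℝ] Model m :=
  fun x => frameGrad g x (A x)

lemma isSmoothJet_frameField {S : EndField m M} (hS : IsSmooth S) :
    IsSmoothJet g (frameField g S) (frameGradField g (covDeriv g S)) :=
  ⟨S, hS, fun _ => rfl, fun _ => rfl⟩

lemma isSobolevGrad_iff (S : EndField m M) (A : GradField m M) :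
    IsSobolevGrad g S A
      ↔ MemClosure (vol g) (IsSmoothJet g) (frameField g S) (frameGradField g A) := by
  have e1 : ∀ T : ℕ → EndField m M,
      Tendsto (fun k => ∫⁻ x, ENNReal.ofReal (innerEnd g x (T k x - S x) (T k x - S x)) ∂vol g)
        atTop (𝓝 0)
      ↔ Tendsto (fun k => eLpNorm (frameField g (T k) - frameField g S) 2 (vol g)) atTop (𝓝 0) := by
    intro T
    rw [← tendsto_lintegral_hs_iff]
    simp only [innerEnd_eq, frameEnd_sub]
    rfl
  have e2 : ∀ T : ℕ → EndField m M,
      Tendsto (fun k => ∫⁻ x, ENNReal.ofReal (innerGrad g x (covDeriv g (T k) x - A x)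
        (covDeriv g (T k) x - A x)) ∂vol g) atTop (𝓝 0)
      ↔ Tendsto (fun k => eLpNorm (frameGradField g (covDeriv g (T k)) - frameGradField g A) 2
        (vol g)) atTop (𝓝 0) := by
    intro T
    rw [← tendsto_lintegral_hsGrad_iff]
    simp only [innerGrad_eq, frameGrad_sub]
    rfl
  constructor
  · rintro ⟨h1, h2, T, hT, h3, h4⟩
    exact ⟨(measEnd_iff g S).1 h1, (measGrad_iff g A).1 h2, _, _,
      fun k => isSmoothJet_frameField g (hT k), (e1 T).1 h3, (e2 T).1 h4⟩
  · rintro ⟨h1, h2, s, a, hsa, h3, h4⟩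
    choose T hT hs ha using hsa
    have hs' : ∀ k, s k = frameField g (T k) := fun k => funext (hs k)
    have ha' : ∀ k, a k = frameGradField g (covDeriv g (T k)) := fun k => funext (ha k)
    simp only [hs'] at h3
    simp only [ha'] at h4
    exact ⟨(measEnd_iff g S).2 h1, (measGrad_iff g A).2 h2, T, hT, (e1 T).2 h3, (e2 T).2 h4⟩

lemma memClosure_weakGrad {S : EndField m M} (hS : MemW12 g S) :
    MemClosure (vol g) (IsSmoothJet g) (frameField g S) (frameGradField g (weakGrad g S)) := by
  rw [← isSobolevGrad_iff, weakGrad, dif_pos hS]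
  exact hS.choose_spec

lemma frameField_ofFrameEnd (σ : M → Model m →L[ℝ] Model m) :
    frameField g (fun x => ofFrameEnd g x (σ x)) = σ :=
  funext fun x => frameEnd_ofFrameEnd g x (σ x)

lemma frameGradField_ofFrameGrad (α : M → Fin m → Model m →L[ℝ] Model m) :
    frameGradField g (fun x => ofFrameGrad g x (α x)) = α :=
  funext fun x => frameGrad_ofFrameGrad g x (α x)

lemma memW12_of_memClosure {S : EndField m M} {α : M → Fin m → Model m →L[ℝ] Model m}
    (h : MemClosure (vol g) (IsSmoothJet g) (frameField g S) α) :
    MemW12 g S ∧ frameGradField g (weakGrad g S) =ᵐ[vol g] α := by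
  have h1 : MemW12 g S := ⟨fun x => ofFrameGrad g x (α x), by
    rwa [isSobolevGrad_iff, frameGradField_ofFrameGrad]⟩
  exact ⟨h1, (isJetAlgebra_isSmoothJet g).ae_eq_of_memClosure (memClosure_weakGrad g h1) h⟩

lemma memStructures_of_isAdmissible {J : EndField m M} (h : IsAdmissible g J) :
    MemStructures (vol g) (IsSmoothJet g) (frameField g J) (frameGradField g (weakGrad g J)) :=
  ⟨memClosure_weakGrad g h.1, h.2.mono fun x hx => (compatibleAt_iff g x J).1 hx⟩

lemma isAdmissible_of_memStructures {J : EndField m M} {α : M → Fin m → Model m →L[ℝ] Model m}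
    (h : MemStructures (vol g) (IsSmoothJet g) (frameField g J) α) : IsAdmissible g J :=
  ⟨(memW12_of_memClosure g h.1).1, h.2.mono fun x hx => (compatibleAt_iff g x J).2 hx⟩

lemma energy_eq (J : EndField m M) : energy g J
    = ∫ x, hsGrad (frameGradField g (weakGrad g J) x) (frameGradField g (weakGrad g J) x) ∂vol g := by
  simp only [energy, innerGrad_eq]
  rfl

lemma energy_of_memClosure {S : EndField m M} {α : M → Fin m → Model m →L[ℝ] Model m}
    (h : MemClosure (vol g) (IsSmoothJet g) (frameField g S) α) :
    energy g S = ∫ x, hsGrad (α x) (α x) ∂vol g := by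
  rw [energy_eq]
  refine integral_congr_ae ?_
  filter_upwards [(memW12_of_memClosure g h).2] with x hx
  rw [hx]

lemma isMinimalStructure_of_isEnergyMinimizer {J : EndField m M} (h : IsEnergyMinimizer g J) :
    IsMinimalStructure (vol g) (IsSmoothJet g) (frameField g J)
      (frameGradField g (weakGrad g J)) := by
  refine ⟨memStructures_of_isAdmissible g h.1, fun K k hK => ?_⟩
  rw [← energy_eq]
  rw [← frameField_ofFrameEnd g K] at hK
  rw [← energy_of_memClosure g hK.1]
  exact h.2 _ (isAdmissible_of_memStructures g hK)

lemma isEnergyMinimizer_of_isMinimalStructure {J : EndField m M}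
    {α : M → Fin m → Model m →L[ℝ] Model m}
    (h : IsMinimalStructure (vol g) (IsSmoothJet g) (frameField g J) α) :
    IsEnergyMinimizer g J := by
  refine ⟨isAdmissible_of_memStructures g h.1, fun K hK => ?_⟩
  rw [energy_of_memClosure g h.1.1, energy_eq]
  exact h.2 _ _ (memStructures_of_isAdmissible g hK)

lemma exists_isEnergyMinimizer (hg : ∃ J₀ : EndField m M, IsCompatibleACS g J₀) :
    ∃ J, IsEnergyMinimizer g J := by
  obtain ⟨J₀, hJ₀, hc⟩ := hg
  obtain ⟨J, a, hJ⟩ := (isJetAlgebra_isSmoothJet g).exists_minimal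
    ⟨_, _, (isJetAlgebra_isSmoothJet g).memClosure (isSmoothJet_frameField g hJ₀),
      Eventually.of_forall fun x => (compatibleAt_iff g x J₀).1 (hc x)⟩
  refine ⟨fun x => ofFrameEnd g x (J x), isEnergyMinimizer_of_isMinimalStructure g (α := a) ?_⟩
  rwa [frameField_ofFrameEnd]

lemma IsEnergyMinimizer.isWeaklyHarmonic {J : EndField m M} (h : IsEnergyMinimizer g J) :
    IsWeaklyHarmonic g J := by
  intro T hT hT'
  obtain ⟨-, C, hC⟩ := hT
  have key := (isJetAlgebra_isSmoothJet g).euler_lagrange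
    (isMinimalStructure_of_isEnergyMinimizer g h) (memClosure_weakGrad g hT') (C := √C) (by
      filter_upwards [hC] with x hx
      rw [innerEnd_eq] at hx
      exact Real.le_sqrt_of_sq_le ((norm_sq_le_hs _).trans hx))
  simp only [innerGrad_eq, innerEnd_eq, frameEnd_quadTerm, hs_sum_left]
  exact key

/-- Convergence in `L²` of fields and derivatives is convergence in the `W^{1,2}` norm. -/
lemma tendsto_normW12 {S : ℕ → EndField m M} {α : ℕ → M → Fin m → Model m →L[ℝ] Model m}
    (h : ∀ k, MemClosure (vol g) (IsSmoothJet g) (frameField g (S k)) (α k))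
    (h0 : Tendsto (fun k => eLpNorm (frameField g (S k)) 2 (vol g)) atTop (𝓝 0))
    (h1 : Tendsto (fun k => eLpNorm (α k) 2 (vol g)) atTop (𝓝 0)) :
    Tendsto (fun k => normW12 g (S k)) atTop (𝓝 0) := by
  have e : ∀ k, normW12 g (S k) = √(∫⁻ x, ENNReal.ofReal (hs (frameField g (S k) x)
      (frameField g (S k) x)) ∂vol g
        + ∫⁻ x, ENNReal.ofReal (hsGrad (α k x) (α k x)) ∂vol g).toReal := by
    intro k
    have hm := aestronglyMeasurable_hs (h k).1 (h k).1
    have hm' := aestronglyMeasurable_hsGrad (h k).2.1 (h k).2.1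
    rw [normW12, ← lintegral_add_left' hm.aemeasurable.ennreal_ofReal]
    congr 1
    have e1 : ∫ x, (innerEnd g x (S k x) (S k x)
        + innerGrad g x (weakGrad g (S k) x) (weakGrad g (S k) x)) ∂vol g
        = ∫ x, (hs (frameField g (S k) x) (frameField g (S k) x) + hsGrad (α k x) (α k x)) ∂vol g := by
      refine integral_congr_ae ?_
      filter_upwards [(memW12_of_memClosure g (h k)).2] with x hx
      rw [innerEnd_eq, innerGrad_eq, ← hx]
      rfl
    rw [e1, integral_eq_lintegral_of_nonneg_ae (Eventually.of_forall fun x =>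
      add_nonneg (hs_self_nonneg _) (hsGrad_self_nonneg _)) (hm.add hm')]
    congr 1
    refine lintegral_congr fun x => ?_
    exact ENNReal.ofReal_add (hs_self_nonneg _) (hsGrad_self_nonneg _)
  have h2 := (tendsto_lintegral_hs_iff.2 h0).add (tendsto_lintegral_hsGrad_iff.2 h1)
  rw [add_zero] at h2
  have h3 := (ENNReal.tendsto_toReal ENNReal.zero_ne_top).comp h2
  have h4 := (Real.continuous_sqrt.tendsto _).comp h3
  rw [ENNReal.toReal_zero, Real.sqrt_zero] at h4
  exact h4.congr fun k => (e k).symm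

lemma exists_subseq_isEnergyMinimizer {J : ℕ → EndField m M} (h : ∀ i, IsEnergyMinimizer g (J i)) :
    ∃ (k : ℕ → ℕ) (J₀ : EndField m M), StrictMono k ∧ IsEnergyMinimizer g J₀ ∧
      Tendsto (fun i => normW12 g (J (k i) - J₀)) atTop (𝓝 0) := by
  have hD := isJetAlgebra_isSmoothJet g
  have hJ := fun i => isMinimalStructure_of_isEnergyMinimizer g (h i)
  have hE : ∀ i, energy g (J i) = energy g (J 0) := fun i =>
    le_antisymm ((h i).2 _ (h 0).1) ((h 0).2 _ (h i).1)
  obtain ⟨φ, j, a, hφ, h1, h2, h3, h4⟩ := hD.exists_subseq_tendsto (fun i => (hJ i).1)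
    (I := energy g (J 0)) (by
      simp only [← energy_eq, hE]
      exact tendsto_const_nhds)
    (fun K k hK => by
      rw [energy_eq]
      exact (hJ 0).2 K k hK)
  have hj := frameField_ofFrameEnd g j
  refine ⟨φ, fun x => ofFrameEnd g x (j x), hφ,
    isEnergyMinimizer_of_isMinimalStructure g (α := a) ⟨by rwa [hj], fun K k hK => ?_⟩, ?_⟩
  · rw [h2, energy_eq]
    exact (hJ 0).2 K k hK
  · have e : ∀ i, frameField g (J (φ i) - fun x => ofFrameEnd g x (j x))
        = fun x => frameField g (J (φ i)) x - j x := fun i => by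
      funext x
      conv_rhs => rw [← hj]
      exact frameEnd_sub g x _ _
    refine tendsto_normW12 g (α := fun i x =>
      frameGradField g (weakGrad g (J (φ i))) x - a x) (fun i => ?_) ?_ h4
    · rw [e]
      exact hD.memClosure_sub (hJ (φ i)).1.1 h1.1
    · simp only [e]
      exact h3

end

end AlmostHermitian

end

theorem theorem2p2 {n : ℕ} {M : Type*} [TopologicalSpace M]
    [ChartedSpace (EuclideanSpace ℝ (Fin (2 * n))) M] [IsManifold (𝓡 (2 * n)) ∞ M]
    [T2Space M] [CompactSpace M] [MeasurableSpace M] [BorelSpace M]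
    (g : ContMDiffRiemannianMetric (𝓡 (2 * n)) ∞ (EuclideanSpace ℝ (Fin (2 * n)))
      (fun x : M => TangentSpace (𝓡 (2 * n)) x))
    (hg : ∃ J₀ : AlmostHermitian.EndField (2 * n) M, AlmostHermitian.IsCompatibleACS g J₀) :
    (∃ J, AlmostHermitian.IsEnergyMinimizer g J) ∧
    (∀ J, AlmostHermitian.IsEnergyMinimizer g J → AlmostHermitian.IsWeaklyHarmonic g J) ∧
    (∀ Jseq : ℕ → AlmostHermitian.EndField (2 * n) M,
      (∀ i, AlmostHermitian.IsEnergyMinimizer g (Jseq i)) →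
      ∃ (k : ℕ → ℕ) (J : AlmostHermitian.EndField (2 * n) M), StrictMono k ∧
        AlmostHermitian.IsEnergyMinimizer g J ∧
        Tendsto (fun i => AlmostHermitian.normW12 g (Jseq (k i) - J)) atTop (𝓝 0)) :=
  ⟨AlmostHermitian.exists_isEnergyMinimizer g hg,
    fun _ hJ => AlmostHermitian.IsEnergyMinimizer.isWeaklyHarmonic g hJ,
    fun _ hJ => AlmostHermitian.exists_subseq_isEnergyMinimizer g hJ⟩
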